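/- **Setting.** Let $G$ be a group with a conjugacy-closed generating set $X$. For $g$ in the monoid $\mathrm{Mon}(X)$ generated by $X$ let $\ell(g)$ be the least length of a factorization of $g$ into elements of $X$; write $h\le g$ if $g=hh'$ with $h,h'\in \mathrm{Mon}(X)$ and $\ell(h)+\ell(h')=\ell(g)$, and let $[1,g]=\{h: h\le g\}$. - $O_g$ is the order complex of $[1,g]$. The *interval complex* $K_g$ is the one-vertex $\Delta$-complex obtained from $O_g$ by identifying (preserving the order of the vertices) the simplices of two chains $x_0<\dots<x_k$ and $y_0<\dots<y_k$ whenever $x_{i-1}^{-1}x_i=y_{i-1}^{-1}y_i$ for $1\le i\le k$. - A *weighted linear factorization* of $h$ is a map $u:[0,1]\to \mathrm{Mon}(X)$ that is trivial outside a finite set, whose values, multiplied in increasing order of the argument, give $h$, and whose values have lengths adding up to $\ell(h)$. Write $u=0^{x_L}s_1^{x_1}\cdots s_k^{x_k}1^{x_R}$ with $0<s_1<\dots<s_k<1$ if $u(0)=x_L$, $u(s_i)=x_i\neq1$, $u(1)=x_R$ and $u$ is trivial elsewhere. These maps form a cell complex $\mathrm{WFact}(G,h,\mathbf I)$, with one $k$-simplex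 for every sequence of entries $[x_L\ x_1\cdots x_k\ x_R]$ (entries whose positions collide are multiplied). - $\mathcal F(G,g,\mathbf I)=\bigsqcup_{h\in[1,g]}\mathrm{WFact}(G,h,\mathbf I)$, ordered by $v\subseteq u$ if $v(r)\le u(r)$ for all $r$. - $\mathcal F(G,g,\mathbf S)$ is the quotient of $\mathcal F(G,g,\mathbf I)$ that identifies $0^{x_L}s_1^{x_1}\cdots s_k^{x_k}1^{x_R}$ and $0^{y_L}s_1^{x_1}\cdots s_k^{x_k}1^{y_R}$ if $gx_Rg^{-1}x_L=gy_Rg^{-1}y_L$, with the quotient topology; one class is below another if this holds for some representatives. Every class has a unique representative of the form $0^{z_L}s_1^{z_1}\cdots s_k^{z_k}1^{1}$. **Theorem, part 1.** Let $W$ be a Coxeter group, with the set of all its reflections as generating set, and let $c\in W$ be a Coxeter element (the product, in some order, of the finitely many simple reflections of a Coxeter system). Then the subspace of maximal elements of $\mathcal F(W,c,\mathbf S)$ is homeomorphic to $K_c$, and $K_c$ is path connected with fundamental group isomorphic to the dual Artin group $\mathrm{Art}^*(W,c)$: the group generated by the nontrivial elements of $[1,c]$, whose relators are the words read along the closed loops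 in $[1,c]$ based at the identity (an edge from $p$ to $q$, for $p<q$ in $[1,c]$, reads as the generator $p^{-1}q$, or as its inverse if it is traversed downwards). **Theorem, part 2.** Let $d\ge1$, let $\mathrm{Sym}_d$ be generated by its transpositions, let $\delta=(1\ 2\ \cdots\ d)$, with permutations composed from right to left, and call $K_\delta$ the dual braid complex. Let $NC_d(\mathbf S)$ be the set of partitions of the unit circle $\mathbf S\subset\mathbb C$ such that points in the same block have the same $d$-th power and the convex hulls of the blocks are pairwise disjoint, ordered by refinement (finer partitions are smaller). For a class with representative $0^{z_L}s_1^{z_1}\cdots s_k^{z_k}1^{1}$ let $\Psi$ of it be the partition of $\mathbf S$ in which, for $s\in[0,1)$, the $d$-th roots of $e^{2\pi i s}$, numbered $1,\dots,d$ by increasing argument in $[0,2\pi)$, are partitioned into the orbits of the permutation at $s$ (into singletons if there is none). Then: 1. the subspace of maximal elements of $\mathcal F(\mathrm{Sym}_d,\delta,\mathbf S)$ is homeomorphic to $K_\delta$; 2. $\Psi$ is an isomorphism of posets $\mathcal F(\mathrm{Sym}_d,\delta,\mathbf S)\to NC_d(\mathbf S)$, and a homeomorphism for the topology on $NC_d(\mathbf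 S)$ that is imported along $\Psi$; 3. with this topology, the subspace of maximal elements of $NC_d(\mathbf S)$ is homeomorphic to $K_\delta$; 4. $K_\delta$ is path connected, with fundamental group isomorphic to the braid group $\mathrm{Braid}_d$. -/

import Mathlib

open scoped unitInterval

noncomputable section

/-! ### Groups with a generating set: length, absolute order, intervals -/

namespace MarkedGroup

section Length

variable {G : Type*} [Group G]

/-- The word length `ℓ(g)` of an element `g` of the monoid generated by `X`: the least length of
a factorization of `g` into elements of `X`. (It is only used for elements of that monoid.) -/
def len (X : Set G) (g : G) : ℕ :=
  sInf {n | ∃ l : List G, l.length = n ∧ (∀ x ∈ l, x ∈ X) ∧ l.prod = g}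

/-- The order on the monoid generated by `X`: `h ≤ g` if there is `h'` with `h * h' = g` and
`ℓ(h) + ℓ(h') = ℓ(g)`. -/
def AbsLE (X : Set G) (h g : G) : Prop :=
  h ∈ Submonoid.closure X ∧ h⁻¹ * g ∈ Submonoid.closure X ∧
    len X h + len X (h⁻¹ * g) = len X g

variable {X : Set G}

theorem exists_word {g : G} (hg : g ∈ Submonoid.closure X) :
    ∃ l : List G, l.length = len X g ∧ (∀ x ∈ l, x ∈ X) ∧ l.prod = g := by
  obtain ⟨l, hl, hp⟩ := Submonoid.exists_list_of_mem_closure hg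
  exact Nat.sInf_mem (s := {n | ∃ l : List G, l.length = n ∧ (∀ x ∈ l, x ∈ X) ∧ l.prod = g})
    ⟨l.length, l, rfl, hl, hp⟩

theorem len_le {l : List G} (hl : ∀ x ∈ l, x ∈ X) : len X l.prod ≤ l.length :=
  Nat.sInf_le ⟨l, rfl, hl, rfl⟩

theorem len_one : len X (1 : G) = 0 := by
  have := len_le (X := X) (l := ([] : List G)) (by simp)
  simpa using this

theorem len_mul_le {g h : G} (hg : g ∈ Submonoid.closure X) (hh : h ∈ Submonoid.closure X) :
    len X (g * h) ≤ len X g + len X h := by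
  obtain ⟨l, h1, h2, rfl⟩ := exists_word hg
  obtain ⟨m, h3, h4, rfl⟩ := exists_word hh
  rw [← h1, ← h3, ← List.prod_append, ← List.length_append]
  refine len_le fun x hx => ?_
  rcases List.mem_append.1 hx with hx | hx
  exacts [h2 x hx, h4 x hx]

theorem eq_one_of_len {g : G} (hg : g ∈ Submonoid.closure X) (h : len X g = 0) : g = 1 := by
  obtain ⟨l, h1, -, rfl⟩ := exists_word hg
  rw [h, List.length_eq_zero_iff] at h1
  simp [h1]

theorem AbsLE.refl {g : G} (hg : g ∈ Submonoid.closure X) : AbsLE X g g := by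
  refine ⟨hg, ?_, ?_⟩
  · simp
  · simp [len_one]

theorem AbsLE.mem_right {h g : G} (H : AbsLE X h g) : g ∈ Submonoid.closure X := by
  simpa using Submonoid.mul_mem _ H.1 H.2.1

theorem AbsLE.trans {a b c : G} (h : AbsLE X a b) (h' : AbsLE X b c) : AbsLE X a c := by
  have e : a⁻¹ * c = (a⁻¹ * b) * (b⁻¹ * c) := by group
  have m : a⁻¹ * c ∈ Submonoid.closure X := e ▸ Submonoid.mul_mem _ h.2.1 h'.2.1
  refine ⟨h.1, m, le_antisymm ?_ ?_⟩
  · have h1 := len_mul_le h.2.1 h'.2.1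
    rw [← e] at h1
    have := h.2.2
    have := h'.2.2
    omega
  · simpa using len_mul_le h.1 m

theorem AbsLE.antisymm {a b : G} (h : AbsLE X a b) (h' : AbsLE X b a) : a = b := by
  have h1 := h.2.2
  have h2 := h'.2.2
  have := eq_one_of_len h.2.1 (by omega)
  exact (inv_mul_eq_one.1 this)

end Length

section Interval

variable {G : Type*} [Group G]

/-- The interval poset `P_g = [1, g]`. -/
def Interval (X : Set G) (g : G) : Type _ := {h : G // AbsLE X h g}

instance (X : Set G) (g : G) : PartialOrder (Interval X g) where
  le a b := AbsLE X a.1 b.1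
  le_refl a := AbsLE.refl a.2.1
  le_trans _ _ _ h h' := AbsLE.trans h h'
  le_antisymm _ _ h h' := Subtype.ext (AbsLE.antisymm h h')

/-- The nontrivial elements of `[1, g]`. -/
def IntervalGen (X : Set G) (g : G) : Type _ := {h : G // AbsLE X h g ∧ h ≠ 1}

/-- `Reads X g v l w`: the word `l` in the nontrivial elements of `[1, g]` and their inverses is
the word read along an edge path from `v` to `w` in the interval `[1, g]`, where the path may
use an edge from `p` to `q` for any `p < q` in `[1, g]`. Such an edge has the label `p⁻¹ * q`; it
contributes this label if it is traversed upwards, and the inverse of the label if it is traversed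
downwards. -/
def Reads (X : Set G) (g : G) : G → List (IntervalGen X g × Bool) → G → Prop
  | v, [], w => v = w
  | v, (x, true) :: l, w => AbsLE X v (v * x.1) ∧ AbsLE X (v * x.1) g ∧ Reads X g (v * x.1) l w
  | v, (x, false) :: l, w =>
      AbsLE X (v * x.1⁻¹) v ∧ AbsLE X v g ∧ Reads X g (v * x.1⁻¹) l w

/-- The words read along the closed loops in `[1, g]` based at the identity. -/
def loopRelators (X : Set G) (g : G) : Set (FreeGroup (IntervalGen X g)) :=
  {r | ∃ l : List (IntervalGen X g × Bool), Reads X g 1 l 1 ∧ r = FreeGroup.mk l}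

/-- The interval group of `[1, g]`, by its dual presentation: the generators are the nontrivial
elements of `[1, g]`, and the relators are the words of the closed loops in `[1, g]` based at the
identity. -/
abbrev IntervalGroup (X : Set G) (g : G) : Type _ := PresentedGroup (loopRelators X g)

end Interval

end MarkedGroup

/-! ### The order complex of a poset -/

/-- The points of the order complex `Δ(P)`, in barycentric coordinates: the formal convex
combinations of elements of `P` that are supported on a chain. -/
def OrderComplex (P : Type*) [PartialOrder P] : Type _ :=
  {t : P →₀ ℝ // (∀ p, 0 ≤ t p) ∧ (t.sum fun _ a => a) = 1 ∧
    IsChain (· ≤ ·) (t.support : Set P)}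

namespace OrderComplex

variable {P : Type*} [PartialOrder P]

/-- The closed simplex spanned by the chain `c 0 < ⋯ < c k`. -/
def simplex {k : ℕ} (c : Fin (k + 1) ↪o P) (w : stdSimplex ℝ (Fin (k + 1))) : OrderComplex P :=
  ⟨Finsupp.embDomain c.toEmbedding (Finsupp.equivFunOnFinite.symm w.1), by
    refine ⟨fun p => ?_, ?_, ?_⟩
    · by_cases hp : p ∈ Set.range c
      · obtain ⟨i, rfl⟩ := hp
        have := Finsupp.embDomain_apply_self c.toEmbedding (Finsupp.equivFunOnFinite.symm w.1) i
        simp only [RelEmbedding.coe_toEmbedding] at this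
        rw [this]
        exact w.2.1 i
      · rw [Finsupp.embDomain_of_notMem_range _ _ _ (by simpa using hp)]
    · rw [Finsupp.sum_embDomain, Finsupp.sum_fintype _ _ (fun _ => rfl)]
      exact w.2.2
    · rw [Finsupp.support_embDomain, Finset.coe_map]
      rintro _ ⟨i, -, rfl⟩ _ ⟨j, -, rfl⟩ -
      rcases le_total i j with h | h
      · exact Or.inl (c.monotone h)
      · exact Or.inr (c.monotone h)⟩

/-- The topology of a simplicial complex: a set is open if and only if its preimage in every
closed simplex is open. -/
instance : TopologicalSpace (OrderComplex P) :=
  ⨆ (k : ℕ) (c : Fin (k + 1) ↪o P), TopologicalSpace.coinduced (simplex c) inferInstance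

end OrderComplex

namespace MarkedGroup

variable {G : Type*} [Group G]

/-! ### The interval complex -/

/-- The gluing of faces of the order complex `O_g = Δ([1, g])`: the simplices of two chains
`x_0 < ⋯ < x_k` and `y_0 < ⋯ < y_k` are identified, preserving the order of the vertices, if
`x_{i-1}⁻¹ x_i = y_{i-1}⁻¹ y_i` for all `1 ≤ i ≤ k`. -/
inductive FaceGluing (X : Set G) (g : G) :
    OrderComplex (Interval X g) → OrderComplex (Interval X g) → Prop
  | glue {k : ℕ} (x y : Fin (k + 1) ↪o Interval X g)
      (hxy : ∀ i : Fin k, (x i.castSucc).1⁻¹ * (x i.succ).1 = (y i.castSucc).1⁻¹ * (y i.succ).1)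
      (w : stdSimplex ℝ (Fin (k + 1))) :
      FaceGluing X g (OrderComplex.simplex x w) (OrderComplex.simplex y w)

/-- The interval complex `K_g`, with the quotient topology from the order complex `O_g`. -/
def IntervalComplex (X : Set G) (g : G) : Type _ := Quot (FaceGluing X g)

instance (X : Set G) (g : G) : TopologicalSpace (IntervalComplex X g) :=
  inferInstanceAs (TopologicalSpace (Quot (FaceGluing X g)))

/-! ### Weighted linear factorizations -/

/-- The linear factorizations `[x_L x_1 ⋯ x_k x_R]` of `g`. The entry `x_L` has index `0` and the
entry `x_R` has index `k + 1`. -/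
def LinearFact (X : Set G) (g : G) (k : ℕ) : Type _ :=
  {x : Fin (k + 2) → G // (∀ i, x i ∈ Submonoid.closure X) ∧
    (∀ i, i ≠ 0 → i ≠ Fin.last (k + 1) → x i ≠ 1) ∧
    (List.ofFn fun i => len X (x i)).sum = len X g ∧ (List.ofFn x).prod = g}

/-- The `G`-multiset `u : I → G` is a weighted linear factorization of `g`: it is trivial away
from finitely many points `r_1 < ⋯ < r_m`, all of its values are in the monoid generated by `X`,
the product `u(r_1) ⋯ u(r_m)` is `g`, and the lengths add up to `ℓ(g)`. -/
def IsWeightedFact (X : Set G) (g : G) (u : I → G) : Prop :=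
  (∀ r, u r ∈ Submonoid.closure X) ∧
  ∃ R : List I, R.Pairwise (· < ·) ∧ (∀ r, r ∉ R → u r = 1) ∧
    (R.map u).prod = g ∧ (R.map fun r => len X (u r)).sum = len X g

/-- `WFact(G, g, I)`, the weighted linear factorizations of `g`. -/
def WFact (X : Set G) (g : G) : Type _ := {u : I → G // IsWeightedFact X g u}

/-- The positions `0 = s_L ≤ s_1 ≤ ⋯ ≤ s_k ≤ s_R = 1`: a closed `k`-simplex. -/
def Positions (k : ℕ) : Type :=
  {s : Fin (k + 2) → I // Monotone s ∧ s 0 = 0 ∧ s (Fin.last (k + 1)) = 1}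

instance (k : ℕ) : TopologicalSpace (Positions k) := instTopologicalSpaceSubtype

/-- The multiset `0^{x_L} s_1^{x_1} ⋯ s_k^{x_k} 1^{x_R}`. If several of the positions coincide,
then the corresponding entries are multiplied in their given order. -/
def place {m : ℕ} (x : Fin m → G) (s : Fin m → I) (r : I) : G :=
  (List.ofFn fun i => if s i = r then x i else 1).prod

theorem prod_place (L : List (I × G)) (hL : L.Pairwise fun p q => p.1 ≤ q.1) (R : List I)
    (hR : R.Pairwise (· < ·)) (hLR : ∀ p ∈ L, p.1 ∈ R) :
    (R.map fun r => (L.map fun p => if p.1 = r then p.2 else 1).prod).prod =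
      (L.map Prod.snd).prod := by
  induction L with
  | nil => simp
  | cons p L ih =>
    rw [List.pairwise_cons] at hL
    have ih := ih hL.2 (fun q hq => hLR q (List.mem_cons_of_mem _ hq))
    obtain ⟨A, C, rfl⟩ := List.append_of_mem (hLR p List.mem_cons_self)
    rw [List.pairwise_append, List.pairwise_cons] at hR
    have hA : ∀ r ∈ A, (L.map fun q => if q.1 = r then q.2 else 1).prod = 1 := by
      intro r hr
      refine List.prod_eq_one fun y hy => ?_
      obtain ⟨q, hq, rfl⟩ := List.mem_map.1 hy
      have h1 := hR.2.2 r hr p.1 List.mem_cons_self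
      have h2 := hL.1 q hq
      rw [if_neg (h1.trans_le h2).ne']
    have hA1 : (A.map fun r => (L.map fun q => if q.1 = r then q.2 else 1).prod).prod = 1 := by
      refine List.prod_eq_one fun y hy => ?_
      obtain ⟨r, hr, rfl⟩ := List.mem_map.1 hy
      exact hA r hr
    have hA2 : (A.map fun r => ((p :: L).map fun q => if q.1 = r then q.2 else 1).prod).prod
        = 1 := by
      refine List.prod_eq_one fun y hy => ?_
      obtain ⟨r, hr, rfl⟩ := List.mem_map.1 hy
      rw [List.map_cons, List.prod_cons, hA r hr,
        if_neg (hR.2.2 r hr p.1 List.mem_cons_self).ne', mul_one]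
    have hC : (C.map fun r => ((p :: L).map fun q => if q.1 = r then q.2 else 1).prod)
        = C.map fun r => (L.map fun q => if q.1 = r then q.2 else 1).prod := by
      refine List.map_congr_left fun r hr => ?_
      rw [List.map_cons, List.prod_cons, if_neg (hR.2.1.1 r hr).ne, one_mul]
    rw [List.map_append, List.prod_append, List.map_cons, List.prod_cons, hA1] at ih
    rw [List.map_append, List.prod_append, hA2, List.map_cons, List.prod_cons, hC, one_mul,
      List.map_cons, List.prod_cons, if_pos rfl, List.map_cons, List.prod_cons, ← ih, one_mul,
      mul_assoc]

theorem sum_len_place {X : Set G} (L : List (I × G))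
    (hX : ∀ p ∈ L, p.2 ∈ Submonoid.closure X) (R : List I) (hR : R.Nodup) :
    (R.map fun r => len X (L.map fun p => if p.1 = r then p.2 else 1).prod).sum ≤
      (L.map fun p => len X p.2).sum := by
  induction L with
  | nil => simp [len_one]
  | cons p L ih =>
    have ih' := ih (fun q hq => hX q (List.mem_cons_of_mem _ hq))
    have hm : ∀ r, (L.map fun p => if p.1 = r then p.2 else 1).prod ∈ Submonoid.closure X := by
      intro r
      refine Submonoid.list_prod_mem _ fun y hy => ?_
      obtain ⟨q, hq, rfl⟩ := List.mem_map.1 hy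
      split_ifs
      exacts [hX q (List.mem_cons_of_mem _ hq), Submonoid.one_mem _]
    have h1 : (R.map fun r => len X ((p :: L).map fun q => if q.1 = r then q.2 else 1).prod).sum
        ≤ (R.map fun r => (if p.1 = r then len X p.2 else 0) +
          len X (L.map fun q => if q.1 = r then q.2 else 1).prod).sum := by
      refine List.sum_le_sum fun r _ => ?_
      rw [List.map_cons, List.prod_cons]
      split_ifs
      · exact len_mul_le (hX p List.mem_cons_self) (hm r)
      · simp
    have h2 : (R.map fun r => if p.1 = r then len X p.2 else 0).sum ≤ len X p.2 := by
      clear h1 ih' ih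
      induction R with
      | nil => simp
      | cons a R ihR =>
        rw [List.nodup_cons] at hR
        rw [List.map_cons, List.sum_cons]
        by_cases h : p.1 = a
        · have : (R.map fun r => if p.1 = r then len X p.2 else 0).sum = 0 := by
            refine List.sum_eq_zero fun y hy => ?_
            obtain ⟨r, hr, rfl⟩ := List.mem_map.1 hy
            rw [if_neg]
            rintro rfl
            exact hR.1 (h ▸ hr)
          rw [this, if_pos h, add_zero]
        · rw [if_neg h, zero_add]
          exact ihR hR.2
    rw [List.sum_map_add] at h1
    rw [List.map_cons, List.sum_cons]
    omega

theorem len_prod_le {X : Set G} (l : List G) (hl : ∀ x ∈ l, x ∈ Submonoid.closure X) :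
    len X l.prod ≤ (l.map (len X)).sum := by
  induction l with
  | nil => simp [len_one]
  | cons a l ih =>
    have ih := ih (fun x hx => hl x (List.mem_cons_of_mem _ hx))
    have := len_mul_le (hl a List.mem_cons_self)
      (Submonoid.list_prod_mem _ fun x hx => hl x (List.mem_cons_of_mem _ hx))
    rw [List.prod_cons, List.map_cons, List.sum_cons]
    omega

theorem isWeightedFact_place {X : Set G} {g : G} {k : ℕ} (x : LinearFact X g k)
    (s : Positions k) : IsWeightedFact X g (place x.1 s.1) := by
  obtain ⟨x, hx, -, hlen, hprod⟩ := x
  obtain ⟨s, hs, -, -⟩ := s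
  set L : List (I × G) := List.ofFn fun i => (s i, x i) with hL
  have hpl : ∀ r, place x s r = (L.map fun p => if p.1 = r then p.2 else 1).prod := by
    intro r
    rw [hL, List.map_ofFn]
    rfl
  have hLX : ∀ p ∈ L, p.2 ∈ Submonoid.closure X := by
    intro p hp
    obtain ⟨i, rfl⟩ := (List.mem_ofFn' _ _).1 hp
    exact hx i
  have hmem : ∀ r, place x s r ∈ Submonoid.closure X := by
    intro r
    refine Submonoid.list_prod_mem _ fun y hy => ?_
    obtain ⟨i, rfl⟩ := (List.mem_ofFn' _ _).1 hy
    dsimp only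
    split_ifs
    exacts [hx i, Submonoid.one_mem _]
  have hsort : ((Finset.univ.image s).sort (· ≤ ·)).Pairwise (· < ·) :=
    (Finset.sortedLT_sort _).pairwise
  have hR : ∀ i, s i ∈ (Finset.univ.image s).sort (· ≤ ·) := by
    intro i
    rw [Finset.mem_sort]
    exact Finset.mem_image_of_mem _ (Finset.mem_univ _)
  have hP : (((Finset.univ.image s).sort (· ≤ ·)).map (place x s)).prod = g := by
    rw [List.map_congr_left fun r _ => hpl r, prod_place L _ _ hsort]
    · rw [← hprod, hL, List.map_ofFn]
      rfl
    · intro p hp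
      obtain ⟨i, rfl⟩ := (List.mem_ofFn' _ _).1 hp
      exact hR i
    · rw [hL, List.pairwise_ofFn]
      exact fun i j hij => hs hij.le
  refine ⟨hmem, (Finset.univ.image s).sort (· ≤ ·), hsort, ?_, hP, le_antisymm ?_ ?_⟩
  · intro r hr
    refine List.prod_eq_one fun y hy => ?_
    obtain ⟨i, rfl⟩ := (List.mem_ofFn' _ _).1 hy
    dsimp only
    rw [if_neg]
    rintro rfl
    exact hr (hR i)
  · have := sum_len_place L hLX _ (Finset.sort_nodup (Finset.univ.image s) (· ≤ ·))
    rw [List.map_congr_left fun r _ => congrArg (len X) (hpl r), ← hlen]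
    refine this.trans_eq ?_
    rw [hL, List.map_ofFn]
    rfl
  · have := len_prod_le (X := X) (((Finset.univ.image s).sort (· ≤ ·)).map (place x s)) (by
      intro y hy
      obtain ⟨r, -, rfl⟩ := List.mem_map.1 hy
      exact hmem r)
    rw [hP, List.map_map] at this
    exact this

/-- The closed cell of `WFact(G, g, I)` that belongs to a linear factorization of `g`. -/
def WFact.cell {X : Set G} {g : G} {k : ℕ} (x : LinearFact X g k) (s : Positions k) :
    WFact X g :=
  ⟨place x.1 s.1, isWeightedFact_place x s⟩

/-- The cell complex topology: a set is open if and only if its preimage in every closed cell is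
open. -/
instance (X : Set G) (g : G) : TopologicalSpace (WFact X g) :=
  ⨆ (k : ℕ) (x : LinearFact X g k), TopologicalSpace.coinduced (WFact.cell x) inferInstance

/-! ### The linear and the circular topological poset -/

/-- `F(G, g, I)`, the disjoint union of the spaces `WFact(G, h, I)` for `h` in `[1, g]`. -/
def LinFactPoset (X : Set G) (g : G) : Type _ := Σ h : Interval X g, WFact X h.1

instance (X : Set G) (g : G) : TopologicalSpace (LinFactPoset X g) :=
  inferInstanceAs (TopologicalSpace (Σ h : Interval X g, WFact X h.1))

/-- The underlying `G`-multiset on the unit interval. -/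
def LinFactPoset.toFun {X : Set G} {g : G} (u : LinFactPoset X g) : I → G := u.2.1

/-- The subfactorization order. -/
instance (X : Set G) (g : G) : LE (LinFactPoset X g) :=
  ⟨fun v u => ∀ r, AbsLE X (v.toFun r) (u.toFun r)⟩

/-- The elements `0^{x_L} s_1^{x_1} ⋯ s_k^{x_k} 1^{x_R}` and `0^{y_L} s_1^{y_1} ⋯ s_k^{y_k} 1^{y_R}`
are equivalent if `x_i = y_i` for `1 ≤ i ≤ k` and `g x_R g⁻¹ x_L = g y_R g⁻¹ y_L`. -/
instance circularSetoid (X : Set G) (g : G) : Setoid (LinFactPoset X g) where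
  r u v := (∀ r, r ≠ 0 → r ≠ 1 → u.toFun r = v.toFun r) ∧
    g * u.toFun 1 * g⁻¹ * u.toFun 0 = g * v.toFun 1 * g⁻¹ * v.toFun 0
  iseqv :=
    ⟨fun _ => ⟨fun _ _ _ => rfl, rfl⟩, fun h => ⟨fun r h0 h1 => (h.1 r h0 h1).symm, h.2.symm⟩,
      fun h h' => ⟨fun r h0 h1 => (h.1 r h0 h1).trans (h'.1 r h0 h1), h.2.trans h'.2⟩⟩

/-- `F(G, g, S)`, with the quotient topology from `F(G, g, I)`. -/
def CircFactPoset (X : Set G) (g : G) : Type _ := Quotient (circularSetoid X g)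

instance (X : Set G) (g : G) : TopologicalSpace (CircFactPoset X g) :=
  inferInstanceAs (TopologicalSpace (Quotient (circularSetoid X g)))

/-- The quotient map `q : F(G, g, I) → F(G, g, S)`. -/
def CircFactPoset.mk {X : Set G} {g : G} (u : LinFactPoset X g) : CircFactPoset X g :=
  Quotient.mk _ u

/-- The order inherited from `F(G, g, I)`: some representatives are comparable. -/
instance (X : Set G) (g : G) : LE (CircFactPoset X g) :=
  ⟨fun a b => ∃ v u : LinFactPoset X g, CircFactPoset.mk v = a ∧ CircFactPoset.mk u = b ∧ v ≤ u⟩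

/-- The `G`-multiset `0^{z_L} s_1^{z_1} ⋯ s_k^{z_k} 1^1` that represents the class of an element of
`F(G, g, I)`: the value at `1` has been moved to `0`. -/
def LinFactPoset.normalForm {X : Set G} {g : G} (u : LinFactPoset X g) (r : I) : G :=
  if r = 0 then g * u.toFun 1 * g⁻¹ * u.toFun 0 else if r = 1 then 1 else u.toFun r

/-- The normal form depends on the class only. -/
def CircFactPoset.normalForm {X : Set G} {g : G} (a : CircFactPoset X g) : I → G :=
  Quotient.lift (s := circularSetoid X g) LinFactPoset.normalForm (by
    intro u v h
    funext r
    simp only [LinFactPoset.normalForm]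
    split_ifs with h0 h1
    exacts [h.2, rfl, h.1 r h0 h1]) a

end MarkedGroup

/-! ### Fundamental groups, Coxeter elements, braid groups -/

/-- The path connected space `Y` has a fundamental group isomorphic to `A`. -/
def HasFundamentalGroup (Y : Type*) [TopologicalSpace Y] (A : Type*) [Group A] : Prop :=
  PathConnectedSpace Y ∧ ∀ y : Y, Nonempty (FundamentalGroup Y y ≃* A)

namespace CoxeterSystem

variable {B W : Type*} [Group W] {M : CoxeterMatrix B} (cs : CoxeterSystem M W)

/-- The set of all reflections. -/
def reflections : Set W := {t | cs.IsReflection t}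

/-- A Coxeter element: a product of all the simple reflections, each used once, in some order. -/
def IsCoxeterElement (c : W) : Prop :=
  ∃ l : List B, l.Nodup ∧ (∀ b, b ∈ l) ∧ cs.wordProd l = c

/-- The dual Artin group `Art*(W, c)`. -/
abbrev DualArtinGroup (c : W) : Type _ := MarkedGroup.IntervalGroup cs.reflections c

end CoxeterSystem

/-- The relators of Artin's presentation of the braid group with generators
`σ_0, …, σ_{d-2}`. -/
def braidRelators (d : ℕ) : Set (FreeGroup (Fin (d - 1))) :=
  {r | (∃ i j : Fin (d - 1), i.1 + 1 < j.1 ∧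
      r = FreeGroup.of i * FreeGroup.of j * (FreeGroup.of j * FreeGroup.of i)⁻¹) ∨
    (∃ i j : Fin (d - 1), i.1 + 1 = j.1 ∧
      r = FreeGroup.of i * FreeGroup.of j * FreeGroup.of i *
        (FreeGroup.of j * FreeGroup.of i * FreeGroup.of j)⁻¹)}

/-- The `d`-strand braid group. -/
abbrev BraidGroup (d : ℕ) : Type := PresentedGroup (braidRelators d)

/-! ### The symmetric group and continuous noncrossing partitions -/

/-- The transpositions in the symmetric group. -/
def transpositions (d : ℕ) : Set (Equiv.Perm (Fin d)) := {t | t.IsSwap}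

/-- `F(Sym_d, δ, S)`, where `δ` is the `d`-cycle `i ↦ i + 1`. -/
abbrev SymCircFactPoset (d : ℕ) : Type :=
  MarkedGroup.CircFactPoset (transpositions d) (finRotate d)

/-- The dual braid complex `K_δ`. -/
abbrev DualBraidComplex (d : ℕ) : Type :=
  MarkedGroup.IntervalComplex (transpositions d) (finRotate d)

/-- The partitions of the unit circle for which points in the same block have the same `d`-th
power, and for which the convex hulls of the blocks are pairwise disjoint. -/
def noncrossingPartitions (d : ℕ) : Set (Setoid Circle) :=
  {π | (∀ z w : Circle, π z w → z ^ d = w ^ d) ∧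
    π.classes.PairwiseDisjoint fun A => convexHull ℝ ((fun z : Circle => (z : ℂ)) '' A)}

/-- The poset `NC_d(S)` of degree-`d` continuous noncrossing partitions, ordered by refinement
(the finer partition is the smaller one). -/
abbrev NCCircle (d : ℕ) : Type := noncrossingPartitions d

/-- The argument of `z`, in `[0, 1)` as a fraction of the full turn. -/
def turn (z : Circle) : ℝ := Int.fract (Complex.arg (z : ℂ) / (2 * Real.pi))

/-- The number `s` in `[0, 1)` with `z ^ d = exp (2 π i s)`. -/
def powerTurn (d : ℕ) (z : Circle) : I :=
  ⟨Int.fract (d * turn z), Int.fract_nonneg _, (Int.fract_lt_one _).le⟩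

/-- The number of `z` among the `d`-th roots of `z ^ d`, when these are numbered
`0, …, d - 1` in the order of increasing argument in `[0, 2π)`. -/
def rootIndex (d : ℕ) [NeZero d] (z : Circle) : Fin d :=
  ⟨⌊d * turn z⌋₊, by
    have hd : (0 : ℝ) < d := by exact_mod_cast Nat.pos_of_ne_zero (NeZero.ne d)
    have h0 : 0 ≤ turn z := Int.fract_nonneg _
    have h1 : turn z < 1 := Int.fract_lt_one _
    rw [Nat.floor_lt (by positivity)]
    nlinarith⟩

/-- The partition `0^{ψ(z_L)} s_1^{ψ(z_1)} ⋯ s_k^{ψ(z_k)}` of the circle that belongs to the multiset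
`0^{z_L} s_1^{z_1} ⋯ s_k^{z_k} 1^1`: the `d`-th roots of `exp (2 π i s)`, numbered as in `rootIndex`,
are partitioned into the orbits of the permutation at `s`. -/
def circlePartition (d : ℕ) [NeZero d] (a : SymCircFactPoset d) : Setoid Circle where
  r z w := powerTurn d z = powerTurn d w ∧
    (a.normalForm (powerTurn d z)).SameCycle (rootIndex d z) (rootIndex d w)
  iseqv :=
    ⟨fun _ => ⟨rfl, Equiv.Perm.SameCycle.refl _ _⟩,
      fun h => ⟨h.1.symm, h.1 ▸ h.2.symm⟩,
      fun h h' => ⟨h.1.trans h'.1, h.2.trans (by rw [h.1]; exact h'.2)⟩⟩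

/-- The topology of `NC_d(S)`, imported from `F(Sym_d, δ, S)` along the map that takes a multiset to
its partition: a set of partitions is open if and only if its preimage is open. -/
instance (d : ℕ) [NeZero d] : TopologicalSpace (NCCircle d) :=
  TopologicalSpace.coinduced
    ((noncrossingPartitions d).restrictPreimage (circlePartition d)) inferInstance

end

/-!
The proof has three parts.

*Maximal elements and the interval complex.* A class in `F(G, g, S)` is maximal if and only if its
representatives are factorizations of `g` itself (`isMax_mk_iff`). A chain `x_0 < ⋯ < x_k` in
`[1, g]` with barycentric coordinates `w` gives the factorization of `g` whose entries are the
successive quotients of `1 ≤ x_0 < ⋯ < x_k ≤ g`, placed at the partial sums of `w`. The element of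
the chain of which the weight covers the position `r` is the product of the entries up to `r`, so
that the point of the order complex and the factorization determine each other
(`place_eq_of_simplex_eq`, `simplex_eq_of_place_eq`). The two gluings also agree: both forget the
entries at the ends `0` and `1` of the unit interval. As both sides carry the topology of closed
cells, the bijection is a homeomorphism (`nonempty_max_homeomorph`).

*The fundamental group.* The interval group acts freely on the complex with the simplices
`{a * x_0, …, a * x_k}`, for `a` in the group and a chain `x_0 < ⋯ < x_k`; the action is a
covering action, as a translation that moves the heights by less than one preserves the vertices
of a simplex (`exists_nhds_disjoint`). The quotient is the interval complex. The complex is simply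
connected: it is covered by the stars of its vertices, which contract to the vertices, and the
classes of the edges form a cocycle on the Cayley graph that is trivial on triangles, so that it
has a potential by the presentation of the interval group (`exists_potential`,
`simplyConnectedSpace_of_potential`). For the `d`-cycle, all reduced factorizations of an element
into transpositions are connected by moves in elements of rank two (`wellDefinedAt`), and the
moves hold for the band generators of the braid group (`dualRelations_swapGen`), so that the
interval group is the braid group (`intervalGroupEquivBraid`).

*Noncrossing partitions.* Below a common upper bound, the absolute order on the symmetric group is
the refinement order of the cycles (`absLE_of_sameCycle`), and the order on `F(G, g, S)` is the
pointwise order of the normal forms. So the partition of a class determines it, together with its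
order. If `i < i'` lie in a cycle of `c ≤ δ`, then the transposition of `i` and `i'` cuts this
cycle into its parts inside and outside of the interval from `i` to `i'`
(`sameCycle_swap_mul_iff_side`). This shows that the blocks of the partition of a class do not
cross, and it is also the induction step by which a noncrossing family of partitions is factored
(`exists_geodesic_of_crossFree`). Not to cross means that the convex hulls are disjoint
(`mem_noncrossingPartitions_iff`).
-/

/-! ### Realizations of families of simplices -/

namespace SimplexFamily

variable {V J : Type*} {n : J → ℕ} (e : ∀ j, Fin (n j + 1) → V)

/-- The formal combination of elements of `V` with the coefficients `w` at the vertices `f`. -/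
noncomputable def push {k : ℕ} (f : Fin (k + 1) → V) (w : Fin (k + 1) → ℝ) : V →₀ ℝ :=
  ∑ i, Finsupp.single (f i) (w i)

theorem push_combo {k : ℕ} (f : Fin (k + 1) → V) (a b : ℝ) (w w' : Fin (k + 1) → ℝ) :
    push f (a • w + b • w') = a • push f w + b • push f w' := by
  simp [push, Finset.smul_sum, Finset.sum_add_distrib]

theorem push_single {k : ℕ} (f : Fin (k + 1) → V) (i : Fin (k + 1)) :
    push f (Pi.single i 1) = Finsupp.single (f i) 1 := by
  rw [push, Finset.sum_eq_single i]
  · simp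
  · intro j _ hj
    simp [Pi.single_eq_of_ne hj]
  · simp

theorem push_apply {k : ℕ} (f : Fin (k + 1) → V) (w : Fin (k + 1) → ℝ) (v : V) :
    push f w v = ∑ i, Finsupp.single (f i) (w i) v := by
  simp [push, Finsupp.finsetSum_apply]

theorem exists_of_push_pos {k : ℕ} {f : Fin (k + 1) → V} {w : Fin (k + 1) → ℝ} {v : V}
    (h : 0 < push f w v) : ∃ i, f i = v ∧ 0 < w i := by
  classical
  rw [push_apply] at h
  obtain ⟨i, hi⟩ : ∃ i, 0 < Finsupp.single (f i) (w i) v := by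
    by_contra! hc
    exact h.not_ge (Finset.sum_nonpos fun i _ => hc i)
  rw [Finsupp.single_apply] at hi
  split_ifs at hi with hv
  · exact ⟨i, hv, hi⟩
  · exact absurd hi (lt_irrefl _)

theorem push_pos {k : ℕ} {f : Fin (k + 1) → V} {w : Fin (k + 1) → ℝ} (hw : ∀ i, 0 ≤ w i)
    {i : Fin (k + 1)} (hi : 0 < w i) : 0 < push f w (f i) := by
  classical
  rw [push_apply]
  refine Finset.sum_pos' (fun j _ => ?_) ⟨i, Finset.mem_univ _, by simpa using hi⟩
  rw [Finsupp.single_apply]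
  split_ifs
  exacts [hw j, le_rfl]

/-- The union of the simplices spanned by the families `e j` of vertices, as a set of formal
convex combinations of vertices. -/
def Realization : Type _ :=
  {t : V →₀ ℝ // ∃ j, ∃ w ∈ stdSimplex ℝ (Fin (n j + 1)), push (e j) w = t}

variable {e}

/-- The closed simplex with vertices `e j`. -/
noncomputable def simplex (e : ∀ j, Fin (n j + 1) → V) (j : J)
    (w : stdSimplex ℝ (Fin (n j + 1))) : Realization e :=
  ⟨push (e j) w.1, j, w.1, w.2, rfl⟩

/-- The weak topology: a set is open if and only if its preimage in every closed simplex is. -/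
noncomputable instance : TopologicalSpace (Realization e) :=
  ⨆ j, TopologicalSpace.coinduced (simplex e j) inferInstance

theorem continuous_simplex (j : J) : Continuous (simplex e j) :=
  continuous_iff_coinduced_le.2 (le_iSup (fun j => TopologicalSpace.coinduced (simplex e j) _) j)

theorem continuous_dom_iff {Z : Type*} [TopologicalSpace Z] {f : Realization e → Z} :
    Continuous f ↔ ∀ j, Continuous fun w => f (simplex e j w) := by
  refine continuous_iSup_dom.trans (forall_congr' fun j => ?_)
  exact continuous_coinduced_dom

theorem exists_simplex (y : Realization e) : ∃ j w, simplex e j w = y := by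
  obtain ⟨t, j, w, hw, rfl⟩ := y
  exact ⟨j, ⟨w, hw⟩, rfl⟩

/-- The family of all simplices is a quotient map. -/
theorem isQuotientMap_simplex :
    Topology.IsQuotientMap fun p : Σ j, stdSimplex ℝ (Fin (n j + 1)) => simplex e p.1 p.2 := by
  rw [Topology.isQuotientMap_iff, Topology.isCoinducing_iff]
  refine ⟨fun s => ?_, fun y => ?_⟩
  rotate_left
  · obtain ⟨j, w, h⟩ := exists_simplex y
    exact ⟨⟨j, w⟩, h⟩
  · refine isOpen_sigma_iff.trans (Iff.trans ?_ isOpen_iSup_iff.symm)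
    rfl

theorem continuous_coord (v : V) : Continuous fun y : Realization e => y.1 v := by
  classical
  rw [continuous_dom_iff]
  intro j
  have : (fun w : stdSimplex ℝ (Fin (n j + 1)) => (simplex e j w).1 v) =
      fun w => ∑ i, if e j i = v then w.1 i else 0 := by
    funext w
    simp [simplex, push_apply, Finsupp.single_apply]
  rw [this]
  refine continuous_finsetSum _ fun i _ => ?_
  split_ifs
  · exact (continuous_apply i).comp continuous_subtype_val
  · exact continuous_const

theorem exists_pos (y : Realization e) : ∃ v, 0 < y.1 v := by
  obtain ⟨j, w, rfl⟩ := exists_simplex y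
  have : (0 : ℝ) < ∑ i, w.1 i := by rw [w.2.2]; exact one_pos
  obtain ⟨i, hi⟩ : ∃ i, 0 < w.1 i := by
    by_contra! hc
    exact this.not_ge (Finset.sum_nonpos fun i _ => hc i)
  exact ⟨e j i, push_pos w.2.1 hi⟩

theorem mk_eq_mk {Y : Type*} [TopologicalSpace Y] {y y' : Y} {p q : Path y y'}
    (h : p.Homotopic q) : Path.Homotopic.Quotient.mk p = Path.Homotopic.Quotient.mk q :=
  Path.Homotopic.Quotient.eq.2 h

/-! ### Straight paths and simple connectivity -/

/-- Two points lie in a common closed simplex. -/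
def Common (y y' : Realization e) : Prop := ∃ j w w', simplex e j w = y ∧ simplex e j w' = y'

theorem Common.symm {y y' : Realization e} (h : Common y y') : Common y' y := by
  obtain ⟨j, w, w', h, h'⟩ := h
  exact ⟨j, w', w, h', h⟩

theorem common_simplex (j : J) (w w' : stdSimplex ℝ (Fin (n j + 1))) :
    Common (simplex e j w) (simplex e j w') := ⟨j, w, w', rfl, rfl⟩

/-- The point that divides the segment from `w` to `w'` in the ratio `s : 1 - s`. -/
def segPoint {k : ℕ} (w w' : stdSimplex ℝ (Fin (k + 1))) (s : I) : stdSimplex ℝ (Fin (k + 1)) :=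
  ⟨(1 - s.1) • w.1 + s.1 • w'.1, convex_stdSimplex ℝ _ w.2 w'.2 (by linarith [s.2.2]) s.2.1
    (by ring)⟩

theorem continuous_segPoint {k : ℕ} :
    Continuous fun p : stdSimplex ℝ (Fin (k + 1)) × stdSimplex ℝ (Fin (k + 1)) × I =>
      segPoint p.1 p.2.1 p.2.2 := by
  unfold segPoint
  fun_prop

theorem simplex_segPoint (j : J) (w w' : stdSimplex ℝ (Fin (n j + 1))) (s : I) :
    (simplex e j (segPoint w w' s)).1 =
      (1 - s.1) • (simplex e j w).1 + s.1 • (simplex e j w').1 := push_combo _ _ _ _ _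

/-- The straight path between two points of a common simplex. -/
noncomputable def line {y y' : Realization e} (h : Common y y') : Path y y' where
  toFun s := ⟨(1 - s.1) • y.1 + s.1 • y'.1, by
    obtain ⟨j, w, w', rfl, rfl⟩ := h
    exact ⟨j, _, (segPoint w w' s).2, simplex_segPoint j w w' s⟩⟩
  continuous_toFun := by
    obtain ⟨j, w, w', rfl, rfl⟩ := h
    have h1 : Continuous fun s : I => simplex e j (segPoint w w' s) :=
      (continuous_simplex j).comp (continuous_segPoint.comp (by fun_prop :
        Continuous fun s : I => (w, w', s)))
    refine h1.congr fun s => ?_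
    exact Subtype.ext (simplex_segPoint j w w' s)
  source' := Subtype.ext (by simp)
  target' := Subtype.ext (by simp)

theorem line_symm {y y' : Realization e} (h : Common y y') : (line h).symm = line h.symm := by
  ext s
  refine Subtype.ext ?_
  change (1 - (1 - s.1)) • y.1 + (1 - s.1) • y'.1 = (1 - s.1) • y'.1 + s.1 • y.1
  rw [add_comm]
  simp

/-- The homotopy class of the straight path. -/
noncomputable def lineClass {y y' : Realization e} (h : Common y y') :
    Path.Homotopic.Quotient y y' := Path.Homotopic.Quotient.mk (line h)

/-- The straight paths along the boundary of a triangle in a closed simplex compose up to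
homotopy, since a simplex is convex. -/
theorem lineClass_trans (j : J) (w₀ w₁ w₂ : stdSimplex ℝ (Fin (n j + 1))) :
    (lineClass (common_simplex (e := e) j w₀ w₁)).trans (lineClass (common_simplex j w₁ w₂)) =
      lineClass (common_simplex j w₀ w₂) := by
  have : ContractibleSpace (stdSimplex ℝ (Fin (n j + 1))) :=
    (convex_stdSimplex ℝ _).contractibleSpace ⟨_, w₀.2⟩
  have key : ∀ w w' : stdSimplex ℝ (Fin (n j + 1)), ∃ γ : Path w w',
      line (common_simplex (e := e) j w w') = γ.map (continuous_simplex j) := by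
    intro w w'
    refine ⟨⟨⟨segPoint w w', continuous_segPoint.comp (by fun_prop :
        Continuous fun s : I => (w, w', s))⟩, Subtype.ext (by simp [segPoint]),
        Subtype.ext (by simp [segPoint])⟩, ?_⟩
    ext s
    exact Subtype.ext (simplex_segPoint j w w' s).symm
  obtain ⟨a, ha⟩ := key w₀ w₁
  obtain ⟨b, hb⟩ := key w₁ w₂
  obtain ⟨c, hc⟩ := key w₀ w₂
  rw [lineClass, lineClass, lineClass, ha, hb, hc, ← Path.Homotopic.Quotient.mk_trans,
    ← Path.map_trans]
  exact mk_eq_mk ((SimplyConnectedSpace.paths_homotopic (a.trans b) c).map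
    ⟨_, continuous_simplex j⟩)

theorem lineClass_trans_of_mem {j : J} {w₀ w₁ w₂ : stdSimplex ℝ (Fin (n j + 1))}
    {y₀ y₁ y₂ : Realization e} (h₀ : y₀ = simplex e j w₀) (h₁ : y₁ = simplex e j w₁)
    (h₂ : y₂ = simplex e j w₂) (h₀₁ : Common y₀ y₁) (h₁₂ : Common y₁ y₂) (h₀₂ : Common y₀ y₂) :
    (lineClass h₀₁).trans (lineClass h₁₂) = lineClass h₀₂ := by
  subst h₀ h₁ h₂
  exact lineClass_trans j w₀ w₁ w₂

theorem lineClass_trans_symm {y y' : Realization e} (h : Common y y') :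
    (lineClass h).trans (lineClass h.symm) = Path.Homotopic.Quotient.refl y := by
  rw [lineClass, lineClass, ← line_symm h]
  exact Path.Homotopic.Quotient.trans_symm (Path.Homotopic.Quotient.mk (line h))

section Cone

/-- A vertex, given as a point. -/
noncomputable def vert (hV : ∀ v, ∃ j i, e j i = v) (v : V) : Realization e :=
  ⟨Finsupp.single v 1, by
    obtain ⟨j, i, rfl⟩ := hV v
    exact ⟨j, _, single_mem_stdSimplex ℝ i, push_single _ _⟩⟩

variable (hV : ∀ v, ∃ j i, e j i = v)

theorem vert_eq (j : J) (i : Fin (n j + 1)) :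
    vert hV (e j i) = simplex e j ⟨Pi.single i 1, single_mem_stdSimplex ℝ i⟩ :=
  Subtype.ext (push_single _ _).symm

theorem common_vert {y : Realization e} {v : V} (h : 0 < y.1 v) : Common (vert hV v) y := by
  obtain ⟨j, w, rfl⟩ := exists_simplex y
  obtain ⟨i, rfl, -⟩ := exists_of_push_pos h
  exact ⟨j, _, w, (vert_eq hV j i).symm, rfl⟩

theorem common_vert_vert (j : J) (i i' : Fin (n j + 1)) :
    Common (vert hV (e j i)) (vert hV (e j i')) := by
  rw [vert_eq, vert_eq]
  exact common_simplex _ _ _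

/-- The open star of a vertex `v`. -/
def star (v : V) : Set (Realization e) := {y | 0 < y.1 v}

theorem isOpen_star (v : V) : IsOpen (star (e := e) v) :=
  isOpen_Ioi.preimage (continuous_coord v)

/-- The linear contraction of an open star to its vertex. -/
noncomputable def coneMap (v : V) (p : star (e := e) v × I) : Realization e :=
  line (common_vert hV p.1.2).symm p.2

/-- The product with the compact interval preserves quotient maps, so continuity can be checked
on the closed simplices. -/
theorem continuous_coneMap (v : V) : Continuous (coneMap hV v) := by
  have hq := (isQuotientMap_simplex (e := e)).restrictPreimage_isOpen (isOpen_star v)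
  refine hq.continuous_lift_prod_left ?_
  set S := (fun p : Σ j, stdSimplex ℝ (Fin (n j + 1)) => simplex e p.1 p.2) ⁻¹' star v with hS
  change Continuous fun q : S × I =>
    coneMap hV v ((star v).restrictPreimage _ q.1, q.2)
  rw [continuous_iff_continuousAt]
  rintro ⟨⟨⟨j, w⟩, hw⟩, s⟩
  obtain ⟨i, hi, hwi⟩ := exists_of_push_pos (show 0 < push (e j) w.1 v from hw)
  -- The index `i` works in a neighbourhood of the given point.
  let T : Set (S × I) := {q | q.1.1.1 = j}
  have hT : IsOpen T := by
    have h1 : IsOpen (Set.range (Sigma.mk (β := fun j => stdSimplex ℝ (Fin (n j + 1))) j)) :=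
      isOpen_range_sigmaMk
    have h2 : T = (fun q : S × I => q.1.1) ⁻¹' Set.range (Sigma.mk j) := by
      ext ⟨⟨⟨j', w'⟩, h'⟩, s'⟩
      constructor
      · rintro (rfl : j' = j)
        exact ⟨w', rfl⟩
      · rintro ⟨w'', h''⟩
        exact (congrArg Sigma.fst h'').symm
    rw [h2]
    exact h1.preimage (by fun_prop)
  let S' : Set (stdSimplex ℝ (Fin (n j + 1))) := {w | 0 < push (e j) w.1 v}
  let φ : S' × I → S × I := fun q => (⟨⟨j, q.1.1⟩, q.1.2⟩, q.2)
  have hφ : Topology.IsOpenEmbedding φ := by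
    have h1 : Topology.IsOpenEmbedding (fun q : S' => (⟨⟨j, q.1⟩, q.2⟩ : S)) := by
      have h2 : Topology.IsOpenEmbedding
          (Sigma.mk (β := fun j => stdSimplex ℝ (Fin (n j + 1))) j) :=
        Topology.IsOpenEmbedding.sigmaMk
      exact h2.restrictPreimage S
    exact h1.prodMap Topology.IsOpenEmbedding.id
  have hpt : (⟨⟨⟨j, w⟩, hw⟩, s⟩ : S × I) = φ ⟨⟨w, hw⟩, s⟩ := rfl
  rw [hpt, ← hφ.continuousAt_iff]
  refine Continuous.continuousAt ?_
  have h3 : (fun q : S × I => coneMap hV v ((star v).restrictPreimage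
      (fun p : Σ j, stdSimplex ℝ (Fin (n j + 1)) => simplex e p.1 p.2) q.1, q.2)) ∘ φ =
      fun q : S' × I => simplex e j (segPoint q.1.1 ⟨Pi.single i 1, single_mem_stdSimplex ℝ i⟩
        q.2) := by
    funext q
    refine Subtype.ext ?_
    rw [simplex_segPoint, ← vert_eq hV, hi]
    rfl
  rw [h3]
  exact (continuous_simplex j).comp (continuous_segPoint.comp (by fun_prop :
        Continuous fun q : S' × I => (q.1.1, (⟨Pi.single i 1, single_mem_stdSimplex ℝ i⟩ :
          stdSimplex ℝ (Fin (n j + 1))), q.2)))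

/-- A path in the open star of a vertex is homotopic to the detour over the vertex. -/
theorem mk_eq_of_mem_star {y y' : Realization e} (γ : Path y y') (v : V)
    (h : ∀ t, 0 < (γ t).1 v) (hy : 0 < y.1 v) (hy' : 0 < y'.1 v) :
    Path.Homotopic.Quotient.mk γ =
      (lineClass (common_vert hV hy).symm).trans (lineClass (common_vert hV hy')) := by
  let f : C(star (e := e) v, Realization e) := ⟨Subtype.val, continuous_subtype_val⟩
  let g : C(star (e := e) v, Realization e) := ContinuousMap.const _ (vert hV v)
  let F : f.Homotopy g :=
    { toFun := fun p => coneMap hV v (p.2, p.1)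
      continuous_toFun := (continuous_coneMap hV v).comp continuous_swap
      map_zero_left := fun x => (line (common_vert hV x.2).symm).source
      map_one_left := fun x => (line (common_vert hV x.2).symm).target }
  let γ' : Path (⟨y, hy⟩ : star (e := e) v) ⟨y', hy'⟩ :=
    { toFun := fun t => ⟨γ t, h t⟩
      continuous_toFun := γ.continuous.subtype_mk _
      source' := Subtype.ext γ.source
      target' := Subtype.ext γ.target }
  have key := Path.Homotopic.map_trans_evalAt F γ'
  have e1 : γ'.map (map_continuous f) = γ := by ext t; rfl
  have e2 : ∀ x, F.evalAt x = line (common_vert hV x.2).symm := by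
    intro x; ext t; rfl
  have e3 : γ'.map (map_continuous g) = Path.refl (vert hV v) := by ext t; rfl
  rw [e2, e2] at key
  have key' : (Path.Homotopic.Quotient.mk γ).trans (lineClass (common_vert hV hy').symm) =
      (lineClass (common_vert hV hy).symm).trans (Path.Homotopic.Quotient.refl _) := by
    have := mk_eq_mk key
    erw [e1, e3] at this
    exact this
  rw [Path.Homotopic.Quotient.trans_refl] at key'
  rw [← key', Path.Homotopic.Quotient.trans_assoc, lineClass_trans_symm (common_vert hV hy').symm,
    Path.Homotopic.Quotient.trans_refl]

end Cone

/-- A potential on the vertices, compatible with the edges, extends to all points; since every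
path is cut into pieces inside open stars, this determines the homotopy class of every path. -/
theorem simplyConnectedSpace_of_potential (hV : ∀ v, ∃ j i, e j i = v) (v₀ : V)
    (C : ∀ v, Path.Homotopic.Quotient (vert hV v₀) (vert hV v))
    (hC : ∀ j i i', (C (e j i)).trans (lineClass (common_vert_vert hV j i i')) = C (e j i')) :
    SimplyConnectedSpace (Realization e) := by
  let P : ∀ (y : Realization e) (v : V), 0 < y.1 v →
      Path.Homotopic.Quotient (vert hV v₀) y := fun y v hv =>
    (C v).trans (lineClass (common_vert hV hv))
  have hP : ∀ y v v' hv hv', P y v hv = P y v' hv' := by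
    intro y v v' hv hv'
    obtain ⟨j, w, rfl⟩ := exists_simplex y
    obtain ⟨i, rfl, hi⟩ := exists_of_push_pos hv
    obtain ⟨i', rfl, hi'⟩ := exists_of_push_pos hv'
    change (C _).trans _ = (C _).trans _
    rw [← hC j i i', Path.Homotopic.Quotient.trans_assoc]
    congr 1
    exact (lineClass_trans_of_mem (vert_eq hV j i) (vert_eq hV j i') rfl _ _ _).symm
  choose vv hvv using exists_pos (e := e)
  let Q : ∀ y, Path.Homotopic.Quotient (vert hV v₀) y := fun y => P y (vv y) (hvv y)
  have hloc : ∀ {y y' : Realization e} (γ : Path y y') (v : V), (∀ t, 0 < (γ t).1 v) →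
      (Q y).trans (Path.Homotopic.Quotient.mk γ) = Q y' := by
    intro y y' γ v h
    have hy : 0 < y.1 v := by simpa using h 0
    have hy' : 0 < y'.1 v := by simpa using h 1
    change (P y _ (hvv y)).trans _ = P y' _ (hvv y')
    rw [hP y _ v (hvv y) hy, hP y' _ v (hvv y') hy', mk_eq_of_mem_star hV γ v h hy hy']
    simp only [P]
    rw [Path.Homotopic.Quotient.trans_assoc, ← Path.Homotopic.Quotient.trans_assoc (lineClass _),
      lineClass_trans_symm (common_vert hV hy), Path.Homotopic.Quotient.refl_trans]
  have hglob : ∀ {y y' : Realization e} (γ : Path y y'),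
      (Q y).trans (Path.Homotopic.Quotient.mk γ) = Q y' := by
    intro y y' γ
    obtain ⟨t, t0, tm, ⟨N, hN⟩, ht⟩ := exists_monotone_Icc_subset_open_cover_unitInterval
      (c := fun v : V => γ ⁻¹' star v) (fun v => (isOpen_star v).preimage γ.continuous)
      (fun s _ => Set.mem_iUnion.2 (exists_pos (γ s)))
    have hn : ∀ m, (Q (γ 0)).trans (Path.Homotopic.Quotient.mk (γ.subpath 0 (t m))) =
        Q (γ (t m)) := by
      intro m
      induction m with
      | zero =>
        rw [t0, Path.subpath_self]
        exact Path.Homotopic.Quotient.trans_refl _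
      | succ m ih =>
        obtain ⟨v, hv⟩ := ht m
        have h1 := mk_eq_mk
          ⟨Path.Homotopy.subpathTransSubpath γ 0 (t m) (t (m + 1))⟩
        have h2 : Path.Homotopic.Quotient.mk (γ.subpath 0 (t (m + 1))) =
          (Path.Homotopic.Quotient.mk (γ.subpath 0 (t m))).trans
            (Path.Homotopic.Quotient.mk (γ.subpath (t m) (t (m + 1)))) := h1.symm
        rw [h2, ← Path.Homotopic.Quotient.trans_assoc, ih]
        refine hloc _ v fun s => ?_
        have h3 : γ.subpath (t m) (t (m + 1)) s ∈ γ '' Set.Icc (t m) (t (m + 1)) := by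
          rw [← Path.range_subpath_of_le γ _ _ (tm (Nat.le_succ m))]
          exact ⟨s, rfl⟩
        obtain ⟨r, hr, hr'⟩ := h3
        rw [← hr']
        exact hv hr
    have h1 := hn N
    rw [hN N le_rfl, Path.subpath_zero_one] at h1
    obtain ⟨γ, h0, h1'⟩ := γ
    subst h0 h1'
    exact h1
  rw [simply_connected_iff_paths_homotopic]
  refine ⟨⟨⟨vert hV v₀⟩, fun y y' => ?_⟩, fun y y' => ⟨fun p q => ?_⟩⟩
  · obtain ⟨p, -⟩ := Path.Homotopic.Quotient.mk_surjective (Q y)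
    obtain ⟨q, -⟩ := Path.Homotopic.Quotient.mk_surjective (Q y')
    exact ⟨p.symm.trans q⟩
  · obtain ⟨p, rfl⟩ := Path.Homotopic.Quotient.mk_surjective p
    obtain ⟨q, rfl⟩ := Path.Homotopic.Quotient.mk_surjective q
    have h := (hglob p).trans (hglob q).symm
    have h2 := congrArg (fun z => (Q y).symm.trans z) h
    simpa only [← Path.Homotopic.Quotient.trans_assoc, Path.Homotopic.Quotient.symm_trans,
      Path.Homotopic.Quotient.refl_trans] using h2

end SimplexFamily

/-! ### Conjugation-invariant generating sets -/

namespace MarkedGroup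

variable {G : Type*} [Group G] {X : Set G} {g : G}

theorem one_le_of_mem (hg : g ∈ Submonoid.closure X) : AbsLE X 1 g :=
  ⟨Submonoid.one_mem _, by simpa using hg, by simp [len_one]⟩

theorem AbsLE.one_le {h : G} (H : AbsLE X h g) : AbsLE X 1 h := one_le_of_mem H.1

theorem mem_closure_conj (hX : ∀ a x, x ∈ X → a * x * a⁻¹ ∈ X) (a : G) {x : G}
    (hx : x ∈ Submonoid.closure X) : a * x * a⁻¹ ∈ Submonoid.closure X := by
  induction hx using Submonoid.closure_induction with
  | mem x hx => exact Submonoid.subset_closure (hX a x hx)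
  | one => simp
  | mul x y _ _ h1 h2 => simpa using Submonoid.mul_mem _ h1 h2

theorem len_conj (hX : ∀ a x, x ∈ X → a * x * a⁻¹ ∈ X) (a x : G) :
    len X (a * x * a⁻¹) = len X x := by
  have key : ∀ (a x : G) (n : ℕ),
      (∃ l : List G, l.length = n ∧ (∀ x ∈ l, x ∈ X) ∧ l.prod = x) →
      ∃ l : List G, l.length = n ∧ (∀ x ∈ l, x ∈ X) ∧ l.prod = a * x * a⁻¹ := by
    rintro a x n ⟨l, h1, h2, h3⟩
    refine ⟨l.map (MulAut.conj a), by simpa using h1, ?_, ?_⟩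
    · intro y hy
      obtain ⟨z, hz, rfl⟩ := List.mem_map.1 hy
      exact hX a z (h2 z hz)
    · rw [← map_list_prod, h3, MulAut.conj_apply]
  unfold len
  congr 1
  ext n
  refine ⟨fun h => ?_, key a x n⟩
  have := key a⁻¹ _ n h
  rwa [show a⁻¹ * (a * x * a⁻¹) * a⁻¹⁻¹ = x by group] at this

/-- A right factor is also a left factor, since `v * x = x * (x⁻¹ * v * x)`. -/
theorem AbsLE.right_factor (hX : ∀ a x, x ∈ X → a * x * a⁻¹ ∈ X) {v w : G} (h : AbsLE X v w) :
    AbsLE X (v⁻¹ * w) w := by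
  have e : (v⁻¹ * w)⁻¹ * w = (v⁻¹ * w)⁻¹ * v * (v⁻¹ * w)⁻¹⁻¹ := by group
  refine ⟨h.2.1, ?_, ?_⟩
  · rw [e]
    exact mem_closure_conj hX _ h.1
  · rw [e, len_conj hX, add_comm]
    exact h.2.2

theorem AbsLE.len_le {h : G} (H : AbsLE X h g) : len X h ≤ len X g := by
  have := H.2.2
  omega

theorem len_lt_of_le_of_ne {h : G} (H : AbsLE X h g) (hne : h ≠ g) : len X h < len X g := by
  have h1 := H.2.2
  have h2 : len X (h⁻¹ * g) ≠ 0 := fun h0 => hne (inv_mul_eq_one.1 (eq_one_of_len H.2.1 h0))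
  omega

theorem AbsLE.inv_mul_le {a b c : G} (hab : AbsLE X a b) (hac : AbsLE X a c) (hbc : AbsLE X b c) :
    AbsLE X (a⁻¹ * b) (a⁻¹ * c) := by
  have e : (a⁻¹ * b)⁻¹ * (a⁻¹ * c) = b⁻¹ * c := by group
  refine ⟨hab.2.1, by rw [e]; exact hbc.2.1, ?_⟩
  rw [e]
  have h1 := hab.2.2
  have h2 := hbc.2.2
  have h3 := hac.2.2
  omega

end MarkedGroup

/-! ### Interval groups -/

namespace MarkedGroup

variable {G : Type*} [Group G] {X : Set G} {g : G}

namespace IntervalGroup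

/-- The generator that belongs to an element of `[1, g]`; it is trivial for the identity, and for
elements outside of `[1, g]`. -/
noncomputable def gen (X : Set G) (g : G) (x : G) : IntervalGroup X g :=
  open scoped Classical in
  if h : AbsLE X x g ∧ x ≠ 1 then PresentedGroup.of ⟨x, h⟩ else 1

@[simp]
theorem gen_one : gen X g 1 = 1 := by simp [gen]

theorem gen_of (x : IntervalGen X g) : gen X g x.1 = PresentedGroup.of x := by
  rw [gen, dif_pos x.2]
  rfl

section Lift

variable {H : Type*} [Group H] (f : IntervalGen X g → H) (Φ : G → H)
  (hΦ : ∀ (v : G) (x : IntervalGen X g), AbsLE X v (v * x.1) → AbsLE X (v * x.1) g →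
    Φ v * f x = Φ (v * x.1))
include hΦ

/-- The word read along a path of edges in `[1, g]` transports the potential `Φ` from its start
to its end. -/
theorem mul_lift_of_reads (l : List (IntervalGen X g × Bool)) (v w : G) (h : Reads X g v l w) :
    Φ v * FreeGroup.lift f (FreeGroup.mk l) = Φ w := by
  rw [FreeGroup.lift_mk]
  induction l generalizing v with
  | nil =>
    obtain rfl : v = w := h
    simp
  | cons p l ih =>
    obtain ⟨x, b⟩ := p
    cases b with
    | true =>
      obtain ⟨h1, h2, h3⟩ := h
      have := ih _ h3
      simp only [List.map_cons, List.prod_cons, cond_true]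
      rw [← mul_assoc, hΦ v x h1 h2, this]
    | false =>
      obtain ⟨h1, h2, h3⟩ := h
      have := ih _ h3
      simp only [List.map_cons, List.prod_cons, cond_false]
      have h4 := hΦ (v * x.1⁻¹) x (by simpa using h1) (by simpa using h2)
      rw [inv_mul_cancel_right] at h4
      rw [← mul_assoc, ← h4, mul_inv_cancel_right, this]

/-- A homomorphism on an interval group is given by values on the generators for which some
function `Φ` on the interval is a potential. -/
noncomputable def lift : IntervalGroup X g →* H :=
  PresentedGroup.toGroup (f := f) (by
    rintro r ⟨l, hl, rfl⟩
    have := mul_lift_of_reads f Φ hΦ l 1 1 hl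
    exact mul_eq_left.1 this)

theorem lift_of (x : IntervalGen X g) : lift f Φ hΦ (PresentedGroup.of x) = f x :=
  PresentedGroup.toGroup.of _

end Lift

/-- The relation of a triangle `1 ≤ v ≤ w` in the interval. -/
theorem gen_mul (hX : ∀ a x, x ∈ X → a * x * a⁻¹ ∈ X) {v w : G} (h : AbsLE X v w)
    (hw : AbsLE X w g) : gen X g v * gen X g (v⁻¹ * w) = gen X g w := by
  rcases eq_or_ne v 1 with rfl | hv
  · simp
  rcases eq_or_ne v w with rfl | hne
  · simp
  have hx1 : v⁻¹ * w ≠ 1 := fun h0 => hne (inv_mul_eq_one.1 h0)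
  have hw1 : w ≠ 1 := by
    rintro rfl
    exact hv (h.antisymm h.one_le)
  have hxg : AbsLE X (v⁻¹ * w) g := (h.right_factor hX).trans hw
  let V : IntervalGen X g := ⟨v, h.trans hw, hv⟩
  let x : IntervalGen X g := ⟨v⁻¹ * w, hxg, hx1⟩
  let W : IntervalGen X g := ⟨w, hw, hw1⟩
  have hr : FreeGroup.mk [(V, true), (x, true), (W, false)] ∈ loopRelators X g := by
    refine ⟨_, ?_, rfl⟩
    simp only [Reads, V, x, W]
    rw [one_mul, mul_inv_cancel_left, mul_inv_cancel]
    exact ⟨h.one_le, h.trans hw, h, hw, one_le_of_mem hw.1, hw, rfl⟩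
  have h1 := PresentedGroup.one_of_mem hr
  have h2 : FreeGroup.mk [(V, true), (x, true), (W, false)] =
      FreeGroup.of V * FreeGroup.of x * (FreeGroup.of W)⁻¹ := rfl
  rw [h2, map_mul, map_mul, map_inv] at h1
  have h3 := mul_inv_eq_one.1 h1
  rw [show v = V.1 from rfl, show V.1⁻¹ * w = x.1 from rfl, show w = W.1 from rfl, gen_of, gen_of,
    gen_of]
  exact h3

/-- The canonical homomorphism to `G`. -/
noncomputable def toGroup (X : Set G) (g : G) : IntervalGroup X g →* G :=
  lift (fun x => x.1) id (fun _ _ _ _ => rfl)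

theorem toGroup_gen {x : G} (hx : AbsLE X x g) : toGroup X g (gen X g x) = x := by
  by_cases h : x = 1
  · simp [h]
  · exact (congrArg _ (gen_of ⟨x, hx, h⟩)).trans (lift_of _ _ _ _)

/-- The length homomorphism to the integers. -/
noncomputable def height (X : Set G) (g : G) : IntervalGroup X g →* Multiplicative ℤ :=
  lift (fun x => Multiplicative.ofAdd (len X x.1 : ℤ))
    (fun v => Multiplicative.ofAdd (len X v : ℤ)) (by
    intro v x h _
    have := h.2.2
    rw [inv_mul_cancel_left] at this
    rw [← ofAdd_add, ← this]
    push_cast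
    rfl)

theorem height_gen {x : G} (hx : AbsLE X x g) :
    height X g (gen X g x) = Multiplicative.ofAdd (len X x : ℤ) := by
  by_cases h : x = 1
  · simp [h, len_one]
  · exact (congrArg _ (gen_of ⟨x, hx, h⟩)).trans (lift_of _ _ _ _)

/-- A cocycle on the Cayley graph that is trivial on the triangles has a potential: the interval
group acts on pairs of a vertex and a value by moving along the edges. -/
theorem exists_potential (hX : ∀ a x, x ∈ X → a * x * a⁻¹ ∈ X) (hg : g ∈ Submonoid.closure X)
    {H : Type*} [Group H]
    (γ : IntervalGroup X g → IntervalGroup X g → H)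
    (hγ : ∀ a v w, AbsLE X v w → AbsLE X w g →
      γ (a * gen X g v) (a * gen X g w) * γ a (a * gen X g v) = γ a (a * gen X g w)) :
    ∃ u : IntervalGroup X g → H, ∀ a x, AbsLE X x g →
      γ a (a * gen X g x) * u a = u (a * gen X g x) := by
  let act (b : IntervalGroup X g) : Equiv.Perm (IntervalGroup X g × H) :=
    { toFun := fun p => (p.1 * b⁻¹, (γ (p.1 * b⁻¹) p.1)⁻¹ * p.2)
      invFun := fun p => (p.1 * b, γ p.1 (p.1 * b) * p.2)
      left_inv := fun p => by simp
      right_inv := fun p => by simp }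
  let ρ : IntervalGroup X g →* Equiv.Perm (IntervalGroup X g × H) :=
    lift (fun x => act (gen X g x.1)) (fun v => act (gen X g v)) (by
      intro v x h1 h2
      have h3 := gen_mul hX h1 h2
      rw [inv_mul_cancel_left] at h3
      ext1 p
      simp only [Equiv.Perm.mul_apply, act, Equiv.coe_fn_mk]
      have h4 := hγ (p.1 * (gen X g (v * x.1))⁻¹) v (v * x.1) h1 h2
      rw [← h3] at h4 ⊢
      simp only [mul_inv_rev, ← mul_assoc, inv_mul_cancel_right] at h4 ⊢
      rw [← h4]
      simp [mul_assoc])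
  have hρ : ∀ x, AbsLE X x g → ρ (gen X g x) = act (gen X g x) := by
    intro x hx
    by_cases h : x = 1
    · subst h
      ext1 p
      have h5 := hγ p.1 1 1 (AbsLE.refl (Submonoid.one_mem _)) (one_le_of_mem hg)
      rw [gen_one, mul_one, mul_eq_right] at h5
      simp [act, h5]
    · rw [gen_of ⟨x, hx, h⟩]
      refine (lift_of _ _ _ _).trans ?_
      rw [gen_of ⟨x, hx, h⟩]
  have hfst : ∀ b p, (ρ b p).1 = p.1 * b⁻¹ := by
    let S : Subgroup (IntervalGroup X g) :=
      { carrier := {b | ∀ p, (ρ b p).1 = p.1 * b⁻¹}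
        one_mem' := fun p => by simp
        mul_mem' := fun {a b} ha hb p => by
          rw [map_mul, Equiv.Perm.mul_apply, ha, hb]
          group
        inv_mem' := fun {a} ha p => by
          have := ha ((ρ a)⁻¹ p)
          rw [show ρ a ((ρ a)⁻¹ p) = p from Equiv.apply_symm_apply (ρ a) p] at this
          rw [map_inv, this]
          group }
    have hS := PresentedGroup.generated_by (loopRelators X g) S (fun x p => by
      rw [← gen_of, hρ _ x.2.1]
      rfl)
    intro b
    exact hS b
  refine ⟨fun a => ((ρ a)⁻¹ (1, 1)).2, fun a x hx => ?_⟩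
  have h1 : ((ρ a)⁻¹ (1, 1)).1 = a := by
    rw [← map_inv, hfst]
    simp
  have h2 : (ρ (a * gen X g x))⁻¹ (1, 1) = (act (gen X g x))⁻¹ ((ρ a)⁻¹ (1, 1)) := by
    rw [map_mul, mul_inv_rev, Equiv.Perm.mul_apply, hρ x hx]
  beta_reduce
  rw [h2]
  change _ = γ ((ρ a)⁻¹ (1, 1)).1 (((ρ a)⁻¹ (1, 1)).1 * gen X g x) * ((ρ a)⁻¹ (1, 1)).2
  rw [h1]

end IntervalGroup

end MarkedGroup

/-! ### The universal cover of the interval complex -/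

namespace MarkedGroup

open SimplexFamily IntervalGroup

variable {G : Type*} [Group G] {X : Set G} {g : G}

/-- A simplex of the universal cover: a group element and a chain in `[1, g]`. -/
abbrev CoverIndex (X : Set G) (g : G) : Type _ :=
  Σ k : ℕ, IntervalGroup X g × (Fin (k + 1) ↪o Interval X g)

/-- The vertices `a * x` of a simplex of the universal cover, for `x` in the chain. -/
noncomputable def coverVertex (j : CoverIndex X g) (i : Fin (j.1 + 1)) : IntervalGroup X g :=
  j.2.1 * gen X g (j.2.2 i).1

/-- The universal cover of the interval complex: the translates of the order complex of `[1, g]`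
along the Cayley graph of the interval group. -/
abbrev Cover (X : Set G) (g : G) : Type _ := Realization (coverVertex (X := X) (g := g))

/-- The height of an element of the interval group, as a real number. -/
noncomputable def htR (X : Set G) (g : G) (a : IntervalGroup X g) : ℝ :=
  ((height X g a).toAdd : ℝ)

theorem htR_mul (a b : IntervalGroup X g) : htR X g (a * b) = htR X g a + htR X g b := by
  simp [htR]

theorem htR_gen (x : Interval X g) : htR X g (gen X g x.1) = len X x.1 := by
  rw [htR, height_gen x.2]
  simp

theorem htR_coverVertex (j : CoverIndex X g) (i : Fin (j.1 + 1)) :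
    htR X g (coverVertex j i) = htR X g j.2.1 + len X (j.2.2 i).1 := by
  rw [coverVertex, htR_mul, htR_gen]

theorem htR_coverVertex_strictMono (j : CoverIndex X g) :
    StrictMono fun i => htR X g (coverVertex j i) := by
  intro i i' h
  simp only [htR_coverVertex]
  have h1 : j.2.2 i < j.2.2 i' := j.2.2.lt_iff_lt.2 h
  have h2 := len_lt_of_le_of_ne (X := X) h1.le (fun h0 => h1.ne (Subtype.ext h0))
  have h3 : (len X (j.2.2 i).1 : ℝ) < len X (j.2.2 i').1 := by exact_mod_cast h2
  linarith

theorem coverVertex_injective (j : CoverIndex X g) : Function.Injective (coverVertex j) :=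
  fun _ _ h => (htR_coverVertex_strictMono j).injective (congrArg (htR X g) h)

/-! ### The action of the interval group -/

theorem mapDomain_push {A : Type*} {V : Type*} {k : ℕ} (φ : V → A) (f : Fin (k + 1) → V)
    (w : Fin (k + 1) → ℝ) : Finsupp.mapDomain φ (push f w) = push (φ ∘ f) w := by
  simp [push, Finsupp.mapDomain_finsetSum, Finsupp.mapDomain_single]

theorem smul_coverVertex (b : IntervalGroup X g) (j : CoverIndex X g) :
    (fun a => b * a) ∘ coverVertex j = coverVertex (⟨j.1, b * j.2.1, j.2.2⟩ : CoverIndex X g) := by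
  funext i
  simp [coverVertex, mul_assoc]

/-- The interval group acts on its universal cover by translation of the vertices. -/
noncomputable instance : MulAction (IntervalGroup X g) (Cover X g) where
  smul b y := ⟨Finsupp.mapDomain (fun a => b * a) y.1, by
    obtain ⟨t, j, w, hw, rfl⟩ := y
    exact ⟨⟨j.1, b * j.2.1, j.2.2⟩, w, hw, by
      rw [mapDomain_push]
      exact congrArg (fun f => push f w) (smul_coverVertex b j).symm⟩⟩
  one_smul y := Subtype.ext (by
    change Finsupp.mapDomain (fun a => 1 * a) y.1 = y.1
    simp only [one_mul]
    exact Finsupp.mapDomain_id)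
  mul_smul b c y := Subtype.ext (by
    change Finsupp.mapDomain (fun a => b * c * a) y.1 =
      Finsupp.mapDomain (fun a => b * a) (Finsupp.mapDomain (fun a => c * a) y.1)
    rw [← Finsupp.mapDomain_comp]
    congr 1
    funext a
    exact mul_assoc _ _ _)

theorem smul_simplex (b : IntervalGroup X g) {k : ℕ} (a : IntervalGroup X g)
    (c : Fin (k + 1) ↪o Interval X g) (w : stdSimplex ℝ (Fin (k + 1))) :
    b • simplex (coverVertex (X := X) (g := g)) ⟨k, a, c⟩ w =
      simplex coverVertex ⟨k, b * a, c⟩ w := by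
  refine Subtype.ext ((mapDomain_push _ _ _).trans ?_)
  exact congrArg (fun f => push f w.1) (smul_coverVertex b ⟨k, a, c⟩)

instance : ContinuousConstSMul (IntervalGroup X g) (Cover X g) where
  continuous_const_smul b := by
    rw [continuous_dom_iff]
    rintro ⟨k, a, c⟩
    simp only [smul_simplex]
    exact continuous_simplex (e := coverVertex) (⟨k, b * a, c⟩ : CoverIndex X g)

/-- The mean height of a point of the universal cover. -/
noncomputable def meanHeight (y : Cover X g) : ℝ := y.1.sum fun a t => t * htR X g a

theorem meanHeight_simplex (j : CoverIndex X g) (w : stdSimplex ℝ (Fin (j.1 + 1))) :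
    meanHeight (simplex coverVertex j w) = ∑ i, w.1 i * htR X g (coverVertex j i) := by
  unfold meanHeight simplex push
  rw [← Finsupp.sum_finsetSum_index (fun a => zero_mul _) (fun a s t => add_mul _ _ _)]
  refine Finset.sum_congr rfl fun i _ => ?_
  rw [Finsupp.sum_single_index (zero_mul _)]

theorem continuous_meanHeight : Continuous (meanHeight (X := X) (g := g)) := by
  rw [continuous_dom_iff]
  intro j
  simp only [meanHeight_simplex]
  refine continuous_finsetSum _ fun i _ => ?_
  exact ((continuous_apply i).comp continuous_subtype_val).mul continuous_const

theorem meanHeight_smul (b : IntervalGroup X g) (y : Cover X g) :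
    meanHeight (b • y) = htR X g b + meanHeight y := by
  obtain ⟨⟨k, a, c⟩, w, rfl⟩ := exists_simplex y
  rw [smul_simplex, meanHeight_simplex, meanHeight_simplex]
  simp only [htR_coverVertex, htR_mul]
  have h : htR X g b = ∑ i, w.1 i * htR X g b := by rw [← Finset.sum_mul, w.2.2, one_mul]
  nth_rewrite 2 [h]
  rw [← Finset.sum_add_distrib]
  refine Finset.sum_congr rfl fun i _ => ?_
  ring

/-- Every point has a neighbourhood that is disjoint from its translates: a translation that
moves the mean height by less than `1` preserves heights, and a simplex has at most one vertex of
a given height. -/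
theorem exists_nhds_disjoint (y : Cover X g) :
    ∃ U ∈ nhds y, ∀ b : IntervalGroup X g, ((b • ·) '' U ∩ U).Nonempty → b = 1 := by
  obtain ⟨v, hv⟩ := exists_pos y
  refine ⟨star v ∩ {z | |meanHeight z - meanHeight y| < 1 / 2}, ?_, ?_⟩
  · have h1 : IsOpen {z : Cover X g | |meanHeight z - meanHeight y| < 1 / 2} :=
      isOpen_lt (continuous_meanHeight.sub continuous_const).abs continuous_const
    have h2 : |meanHeight y - meanHeight y| < 1 / 2 := by simp
    exact ((isOpen_star v).inter h1).mem_nhds ⟨hv, h2⟩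
  · rintro b ⟨-, ⟨z, ⟨hz, hz'⟩, rfl⟩, hbz, hbz'⟩
    have hb0 : htR X g b = 0 := by
      have hbz'' : |meanHeight (b • z) - meanHeight y| < 1 / 2 := hbz'
      rw [meanHeight_smul] at hbz''
      have hz'' : |meanHeight z - meanHeight y| < 1 / 2 := hz'
      have h1 : |htR X g b| < 1 := by
        rw [abs_lt] at *
        constructor <;> linarith [hz''.1, hz''.2, hbz''.1, hbz''.2]
      unfold htR at *
      have h2 : |(height X g b).toAdd| < 1 := by exact_mod_cast h1
      rw [Int.abs_lt_one_iff.1 h2]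
      simp
    obtain ⟨⟨k, a, c⟩, w, rfl⟩ := exists_simplex z
    have hbz2 : 0 < (b • simplex (coverVertex (X := X) (g := g)) ⟨k, a, c⟩ w).1 v := hbz
    rw [smul_simplex] at hbz2
    obtain ⟨i, hi, -⟩ := exists_of_push_pos hz
    obtain ⟨i', hi', -⟩ := exists_of_push_pos hbz2
    have h3 : coverVertex (⟨k, b * a, c⟩ : CoverIndex X g) i' =
        b * coverVertex (⟨k, a, c⟩ : CoverIndex X g) i' := by simp [coverVertex, mul_assoc]
    have h4 := hi.trans hi'.symm
    rw [h3] at h4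
    have h5 := congrArg (htR X g) h4
    rw [htR_mul, hb0, zero_add] at h5
    have h6 : i = i' := (htR_coverVertex_strictMono _).injective h5
    subst h6
    exact right_eq_mul.1 h4

/-! ### The projection to the interval complex -/

theorem orderSimplex_eq_push {P : Type*} [PartialOrder P] {k : ℕ} (c : Fin (k + 1) ↪o P)
    (w : stdSimplex ℝ (Fin (k + 1))) : (OrderComplex.simplex c w).1 = push c w.1 := by
  have h : (Finsupp.equivFunOnFinite.symm w.1 : Fin (k + 1) →₀ ℝ) =
      ∑ i, Finsupp.single i (w.1 i) := by
    ext i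
    simp [Finsupp.finsetSum_apply, Finsupp.single_apply]
  change Finsupp.embDomain _ _ = _
  rw [Finsupp.embDomain_eq_mapDomain, h, Finsupp.mapDomain_finsetSum]
  simp [push, Finsupp.mapDomain_single]

theorem isOpen_orderComplex_iff {P : Type*} [PartialOrder P] {s : Set (OrderComplex P)} :
    IsOpen s ↔ ∀ (k : ℕ) (c : Fin (k + 1) ↪o P), IsOpen (OrderComplex.simplex c ⁻¹' s) := by
  refine isOpen_iSup_iff.trans (forall_congr' fun k => ?_)
  exact isOpen_iSup_iff

/-- A nonempty finite chain is the set of vertices of a simplex of the order complex. -/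
theorem exists_orderEmbedding_of_isChain {P : Type*} [PartialOrder P] {s : Finset P}
    (hne : s.Nonempty) (hs : IsChain (· ≤ ·) (s : Set P)) :
    ∃ (k : ℕ) (c : Fin (k + 1) ↪o P), Finset.univ.map c.toEmbedding = s := by
  classical
  let _ : LinearOrder s :=
    { (inferInstance : PartialOrder s) with
      le_total := fun a b => hs.total a.2 b.2
      toDecidableLE := Classical.decRel _ }
  obtain ⟨k, hk⟩ : ∃ k, Fintype.card s = k + 1 :=
    Nat.exists_eq_succ_of_ne_zero (by
      have := hne.to_subtype
      exact Fintype.card_ne_zero)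
  let ι : Fin (k + 1) ≃o s := Fintype.orderIsoFinOfCardEq _ hk
  refine ⟨k, ι.toOrderEmbedding.trans (OrderEmbedding.subtype _), ?_⟩
  ext p
  simp only [Finset.mem_map, Finset.mem_univ, true_and]
  constructor
  · rintro ⟨i, rfl⟩
    exact (ι i).2
  · intro hp
    refine ⟨ι.symm ⟨p, hp⟩, ?_⟩
    change (ι (ι.symm ⟨p, hp⟩)).1 = p
    rw [OrderIso.apply_symm_apply]

theorem orderComplex_exists_simplex {P : Type*} [PartialOrder P] (t : OrderComplex P) :
    ∃ (k : ℕ) (c : Fin (k + 1) ↪o P) (w : stdSimplex ℝ (Fin (k + 1))),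
      OrderComplex.simplex c w = t := by
  obtain ⟨t, h0, h1, h2⟩ := t
  have hne : t.support.Nonempty := by
    rw [Finset.nonempty_iff_ne_empty]
    intro h
    rw [Finsupp.sum, h, Finset.sum_empty] at h1
    exact zero_ne_one h1
  obtain ⟨k, c, hc⟩ := exists_orderEmbedding_of_isChain hne h2
  have hs : ∑ i, t (c i) = 1 := by
    rw [← h1, Finsupp.sum, ← hc, Finset.sum_map]
    rfl
  refine ⟨k, c, ⟨fun i => t (c i), fun i => h0 _, hs⟩, Subtype.ext ?_⟩
  rw [orderSimplex_eq_push]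
  change ∑ i, Finsupp.single (c i) (t (c i)) = t
  conv_rhs => rw [← Finsupp.sum_single t, Finsupp.sum, ← hc, Finset.sum_map]
  rfl

theorem sum_eq_sum_face {k k' : ℕ} {w : Fin (k + 1) → ℝ} (ι : Fin (k' + 1) ↪o Fin (k + 1))
    (hι : ∀ i, i ∉ Set.range ι → w i = 0) {M : Type*} [AddCommMonoid M] (F : Fin (k + 1) → M)
    (hF : ∀ i, w i = 0 → F i = 0) : ∑ i, F i = ∑ i, F (ι i) := by
  have h1 : ∑ i, F (ι i) = ∑ i ∈ Finset.univ.map ι.toEmbedding, F i := by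
    rw [Finset.sum_map]
    rfl
  rw [h1]
  refine (Finset.sum_subset (Finset.subset_univ _) fun i _ hi => hF i (hι i ?_)).symm
  simpa using hi

/-- A point of a simplex lies in the interior of a face. -/
theorem exists_positive_face {k : ℕ} (w : stdSimplex ℝ (Fin (k + 1))) :
    ∃ (k' : ℕ) (ι : Fin (k' + 1) ↪o Fin (k + 1)) (w' : stdSimplex ℝ (Fin (k' + 1))),
      (∀ i, 0 < w'.1 i) ∧ ∀ {V : Type*} (f : Fin (k + 1) → V), push f w.1 = push (f ∘ ι) w'.1 := by
  classical
  let s : Finset (Fin (k + 1)) := Finset.univ.filter fun i => 0 < w.1 i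
  have hne : s.Nonempty := by
    by_contra! h
    have h1 : ∀ i, w.1 i ≤ 0 := by
      intro i
      by_contra! h2
      have : i ∈ s := by simpa [s] using h2
      simp [h] at this
    have := Finset.sum_nonpos fun i (_ : i ∈ Finset.univ) => h1 i
    rw [w.2.2] at this
    linarith
  obtain ⟨k', hk'⟩ := Nat.exists_eq_succ_of_ne_zero hne.card_ne_zero
  let ι := s.orderEmbOfFin hk'
  have hpos : ∀ i, 0 < w.1 (ι i) := fun i => (Finset.mem_filter.1 (s.orderEmbOfFin_mem hk' i)).2
  have hι : ∀ i, i ∉ Set.range ι → w.1 i = 0 := by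
    intro i hi
    rw [Finset.range_orderEmbOfFin] at hi
    have h2 : ¬ 0 < w.1 i := by simpa [s] using hi
    exact le_antisymm (not_lt.1 h2) (w.2.1 i)
  refine ⟨k', ι, ⟨fun i => w.1 (ι i), fun i => (hpos i).le, ?_⟩, hpos, fun f => ?_⟩
  · rw [← sum_eq_sum_face ι hι w.1 (fun _ h => h)]
    exact w.2.2
  · exact sum_eq_sum_face ι hι (fun i => Finsupp.single (f i) (w.1 i))
      (fun i hi => by rw [hi, Finsupp.single_zero])

theorem push_apply_self {V : Type*} {k : ℕ} {f : Fin (k + 1) → V} (hf : Function.Injective f)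
    (w : Fin (k + 1) → ℝ) (i : Fin (k + 1)) : push f w (f i) = w i := by
  classical
  rw [push_apply]
  simp only [Finsupp.single_apply, hf.eq_iff]
  simp

/-- A point of the universal cover determines the point of the interval complex below it. The
weights may be taken positive; then the point determines the set of vertices of the simplex, and
the heights determine their order. -/
theorem mk_simplex_eq_of_simplex_eq {j j' : CoverIndex X g} {w : stdSimplex ℝ (Fin (j.1 + 1))}
    {w' : stdSimplex ℝ (Fin (j'.1 + 1))}
    (h : simplex coverVertex j w = simplex coverVertex j' w') :
    Quot.mk (FaceGluing X g) (OrderComplex.simplex j.2.2 w) =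
      Quot.mk (FaceGluing X g) (OrderComplex.simplex j'.2.2 w') := by
  have key : ∀ (j : CoverIndex X g) (w : stdSimplex ℝ (Fin (j.1 + 1))),
      ∃ (j' : CoverIndex X g) (w' : stdSimplex ℝ (Fin (j'.1 + 1))), (∀ i, 0 < w'.1 i) ∧
        simplex coverVertex j w = simplex coverVertex j' w' ∧
        OrderComplex.simplex j.2.2 w = OrderComplex.simplex j'.2.2 w' := by
    rintro ⟨k, a, c⟩ w
    obtain ⟨k', ι, w', hpos, hw'⟩ := exists_positive_face w
    refine ⟨⟨k', a, ι.trans c⟩, w', hpos, Subtype.ext (hw' _), Subtype.ext ?_⟩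
    rw [orderSimplex_eq_push, orderSimplex_eq_push]
    exact hw' _
  obtain ⟨j₁, w₁, hp₁, he₁, ho₁⟩ := key j w
  obtain ⟨j₂, w₂, hp₂, he₂, ho₂⟩ := key j' w'
  rw [ho₁, ho₂]
  rw [he₁, he₂] at h
  clear he₁ he₂ ho₁ ho₂ w w' j j'
  have hh : push (coverVertex j₁) w₁.1 = push (coverVertex j₂) w₂.1 := congrArg Subtype.val h
  have hsub : ∀ {j₁ j₂ : CoverIndex X g} {w₁ : stdSimplex ℝ (Fin (j₁.1 + 1))}
      {w₂ : stdSimplex ℝ (Fin (j₂.1 + 1))}, (∀ i, 0 < w₁.1 i) →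
      push (coverVertex j₁) w₁.1 = push (coverVertex j₂) w₂.1 →
      Set.range (coverVertex j₁) ⊆ Set.range (coverVertex j₂) := by
    rintro j₁ j₂ w₁ w₂ hp hh _ ⟨i, rfl⟩
    have h1 := push_pos (f := coverVertex j₁) w₁.2.1 (hp i)
    rw [hh] at h1
    obtain ⟨i', hi', -⟩ := exists_of_push_pos h1
    exact ⟨i', hi'⟩
  have hr := (hsub hp₁ hh).antisymm (hsub hp₂ hh.symm)
  obtain ⟨k₁, a₁, c₁⟩ := j₁
  obtain ⟨k₂, a₂, c₂⟩ := j₂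
  obtain rfl : k₁ = k₂ := by
    have h1 := congrArg Set.ncard hr
    rw [← Set.image_univ, ← Set.image_univ,
      Set.ncard_image_of_injective _ (coverVertex_injective _),
      Set.ncard_image_of_injective _ (coverVertex_injective _), Set.ncard_univ, Set.ncard_univ,
      Nat.card_fin, Nat.card_fin] at h1
    simpa using h1
  have hv : coverVertex (⟨k₁, a₁, c₁⟩ : CoverIndex X g) = coverVertex ⟨k₁, a₂, c₂⟩ := by
    have h1 : (fun i => htR X g (coverVertex (⟨k₁, a₁, c₁⟩ : CoverIndex X g) i)) =
        fun i => htR X g (coverVertex (⟨k₁, a₂, c₂⟩ : CoverIndex X g) i) := by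
      refine (StrictMono.range_inj (htR_coverVertex_strictMono (X := X) (g := g) ⟨k₁, a₁, c₁⟩)
        (htR_coverVertex_strictMono (X := X) (g := g) ⟨k₁, a₂, c₂⟩)).1 ?_
      have := congrArg (fun s => htR X g '' s) hr
      beta_reduce at this
      rw [← Set.range_comp, ← Set.range_comp] at this
      exact this
    funext i
    obtain ⟨i', hi'⟩ : coverVertex (⟨k₁, a₁, c₁⟩ : CoverIndex X g) i ∈
        Set.range (coverVertex (⟨k₁, a₂, c₂⟩ : CoverIndex X g)) := hr ▸ ⟨i, rfl⟩
    have h2 := congrFun h1 i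
    beta_reduce at h2
    rw [← hi'] at h2
    rw [← hi', (htR_coverVertex_strictMono _).injective h2]
  have hw : w₁ = w₂ := by
    refine Subtype.ext (funext fun i => ?_)
    rw [← push_apply_self (coverVertex_injective (⟨k₁, a₁, c₁⟩ : CoverIndex X g)) w₁.1 i, hh, hv,
      push_apply_self (coverVertex_injective (⟨k₁, a₂, c₂⟩ : CoverIndex X g))]
  subst hw
  refine Quot.sound (FaceGluing.glue c₁ c₂ (fun i => ?_) w₁)
  have h1 : ∀ i, IntervalGroup.toGroup X g a₁ * (c₁ i).1 =
      IntervalGroup.toGroup X g a₂ * (c₂ i).1 := by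
    intro i
    have h2 := congrArg (IntervalGroup.toGroup X g) (congrFun hv i)
    unfold coverVertex at h2
    rwa [map_mul, map_mul, toGroup_gen (c₁ i).2, toGroup_gen (c₂ i).2] at h2
  have h3 : ∀ i, (c₁ i).1 = (IntervalGroup.toGroup X g a₁)⁻¹ *
      (IntervalGroup.toGroup X g a₂ * (c₂ i).1) := by
    intro i
    rw [← h1, inv_mul_cancel_left]
  rw [h3, h3]
  group

/-- The covering map from the universal cover to the interval complex. -/
noncomputable def coverProj (y : Cover X g) : IntervalComplex X g :=
  Quot.mk _ (OrderComplex.simplex (exists_simplex y).choose.2.2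
    (exists_simplex y).choose_spec.choose)

theorem coverProj_simplex (j : CoverIndex X g) (w : stdSimplex ℝ (Fin (j.1 + 1))) :
    coverProj (simplex coverVertex j w) = Quot.mk _ (OrderComplex.simplex j.2.2 w) :=
  mk_simplex_eq_of_simplex_eq (exists_simplex (simplex coverVertex j w)).choose_spec.choose_spec

/-- The orbit of the universal cover above a point of the order complex. -/
noncomputable def orbitOf (t : OrderComplex (Interval X g)) :
    MulAction.orbitRel.Quotient (IntervalGroup X g) (Cover X g) :=
  Quotient.mk _ (⟨Finsupp.mapDomain (fun h : Interval X g => gen X g h.1) t.1, by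
    obtain ⟨k, c, w, rfl⟩ := orderComplex_exists_simplex t
    refine ⟨⟨k, 1, c⟩, w.1, w.2, ?_⟩
    rw [orderSimplex_eq_push, mapDomain_push]
    congr 1
    funext i
    exact one_mul _⟩ : Cover X g)

theorem orbitOf_simplex {k : ℕ} (c : Fin (k + 1) ↪o Interval X g)
    (w : stdSimplex ℝ (Fin (k + 1))) (a : IntervalGroup X g) :
    orbitOf (OrderComplex.simplex c w) =
      Quotient.mk _ (simplex (coverVertex (X := X) (g := g)) ⟨k, a, c⟩ w) := by
  refine Quotient.sound ⟨a⁻¹, ?_⟩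
  beta_reduce
  rw [smul_simplex, inv_mul_cancel]
  refine Subtype.ext ?_
  change push _ _ = Finsupp.mapDomain _ _
  rw [orderSimplex_eq_push, mapDomain_push]
  congr 1
  funext i
  exact one_mul _

/-- Translated to begin with the identity, chains with equal successive quotients have the same
vertices in the interval group. -/
theorem orbitOf_eq_of_gluing (hX : ∀ a x, x ∈ X → a * x * a⁻¹ ∈ X)
    {t t' : OrderComplex (Interval X g)} (h : FaceGluing X g t t') : orbitOf t = orbitOf t' := by
  obtain ⟨x, y, hxy, w⟩ := h
  rename_i k
  rw [orbitOf_simplex x w (gen X g (x 0).1)⁻¹, orbitOf_simplex y w (gen X g (y 0).1)⁻¹]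
  congr 1
  refine Subtype.ext ?_
  change push _ _ = push _ _
  congr 1
  have hstep : ∀ (z : Fin (k + 1) ↪o Interval X g) (i : Fin k), gen X g (z i.succ).1 =
      gen X g (z i.castSucc).1 * gen X g ((z i.castSucc).1⁻¹ * (z i.succ).1) := by
    intro z i
    exact (gen_mul hX (z.monotone i.castSucc_lt_succ.le) (z i.succ).2).symm
  funext i
  induction i using Fin.induction with
  | zero => simp [coverVertex]
  | succ i ih =>
    simp only [coverVertex] at ih ⊢
    rw [hstep, hstep, ← mul_assoc, ih, hxy, mul_assoc]

theorem isQuotientMap_coverProj : Topology.IsQuotientMap (coverProj (X := X) (g := g)) := by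
  rw [Topology.isQuotientMap_iff, and_comm]
  refine ⟨fun y => ?_, ?_⟩
  · obtain ⟨t, rfl⟩ := Quot.exists_rep y
    obtain ⟨k, c, w, rfl⟩ := orderComplex_exists_simplex t
    exact ⟨simplex coverVertex ⟨k, 1, c⟩ w, coverProj_simplex _ _⟩
  · rw [Topology.isCoinducing_iff]
    intro s
    have h1 : IsOpen s ↔ IsOpen (Quot.mk (FaceGluing X g) ⁻¹' s) :=
      isQuotientMap_quot_mk.isOpen_preimage.symm
    rw [h1, isOpen_orderComplex_iff]
    refine isOpen_iSup_iff.trans ⟨fun h k c => ?_, fun h => ?_⟩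
    · have h2 := isOpen_coinduced.1 (h ⟨k, 1, c⟩)
      have h3 : (simplex (coverVertex (X := X) (g := g)) ⟨k, 1, c⟩) ⁻¹' (coverProj ⁻¹' s) =
          OrderComplex.simplex c ⁻¹' (Quot.mk (FaceGluing X g) ⁻¹' s) := by
        ext w
        simp only [Set.mem_preimage, coverProj_simplex]
        rfl
      rwa [h3] at h2
    · rintro ⟨k, a, c⟩
      rw [isOpen_coinduced]
      have h3 : (simplex (coverVertex (X := X) (g := g)) ⟨k, a, c⟩) ⁻¹' (coverProj ⁻¹' s) =
          OrderComplex.simplex c ⁻¹' (Quot.mk (FaceGluing X g) ⁻¹' s) := by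
        ext w
        simp only [Set.mem_preimage, coverProj_simplex]
        rfl
      rw [h3]
      exact h k c

/-- The interval group acts on the universal cover by deck transformations. -/
theorem isQuotientCoveringMap_coverProj (hX : ∀ a x, x ∈ X → a * x * a⁻¹ ∈ X) :
    IsQuotientCoveringMap (coverProj (X := X) (g := g)) (IntervalGroup X g) where
  __ := isQuotientMap_coverProj
  continuous_const_smul := continuous_const_smul
  apply_eq_iff_mem_orbit {y y'} := by
    constructor
    · intro h
      obtain ⟨⟨k, a, c⟩, w, rfl⟩ := exists_simplex y
      obtain ⟨⟨k', a', c'⟩, w', rfl⟩ := exists_simplex y'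
      rw [coverProj_simplex, coverProj_simplex] at h
      have h1 := congrArg (Quot.lift orbitOf fun _ _ => orbitOf_eq_of_gluing hX) h
      have h2 : orbitOf (OrderComplex.simplex c w) = orbitOf (OrderComplex.simplex c' w') := h1
      rw [orbitOf_simplex c w a, orbitOf_simplex c' w' a'] at h2
      exact MulAction.orbitRel_apply.1 (Quotient.exact h2)
    · rintro ⟨b, rfl⟩
      obtain ⟨⟨k, a, c⟩, w, rfl⟩ := exists_simplex y'
      beta_reduce
      rw [smul_simplex, coverProj_simplex, coverProj_simplex]
  disjoint := exists_nhds_disjoint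

/-! ### The universal cover is simply connected -/

/-- For `v ≤ w ≤ g`, the points `a`, `a * v` and `a * w` are vertices of a common simplex. -/
theorem exists_triangle (hg : g ∈ Submonoid.closure X) (a : IntervalGroup X g) {v w : G}
    (h : AbsLE X v w) (hw : AbsLE X w g) :
    ∃ (j : CoverIndex X g) (i₀ i₁ i₂ : Fin (j.1 + 1)), coverVertex j i₀ = a ∧
      coverVertex j i₁ = a * gen X g v ∧ coverVertex j i₂ = a * gen X g w := by
  classical
  let o : Interval X g := ⟨1, one_le_of_mem hg⟩
  let v' : Interval X g := ⟨v, h.trans hw⟩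
  let w' : Interval X g := ⟨w, hw⟩
  have h1 : o ≤ v' := h.one_le
  have h2 : v' ≤ w' := h
  have hs : IsChain (· ≤ ·) ((({o, v', w'} : Finset (Interval X g)) : Set (Interval X g))) := by
    rintro x hx y hy -
    simp only [Finset.coe_insert, Finset.coe_singleton, Set.mem_insert_iff,
      Set.mem_singleton_iff] at hx hy
    rcases hx with rfl | rfl | rfl <;> rcases hy with rfl | rfl | rfl <;>
      simp [h1, h2, h1.trans h2]
  obtain ⟨k, c, hc⟩ := exists_orderEmbedding_of_isChain (by simp) hs
  have hmem : ∀ x ∈ ({o, v', w'} : Finset (Interval X g)), ∃ i, c i = x := by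
    intro x hx
    rw [← hc] at hx
    simpa using hx
  obtain ⟨i₀, h₀⟩ := hmem o (by simp)
  obtain ⟨i₁, h₁⟩ := hmem v' (by simp)
  obtain ⟨i₂, h₂⟩ := hmem w' (by simp)
  refine ⟨⟨k, a, c⟩, i₀, i₁, i₂, ?_, ?_, ?_⟩ <;> simp [coverVertex, h₀, h₁, h₂, o, v', w']

theorem exists_coverVertex (hg : g ∈ Submonoid.closure X) (a : IntervalGroup X g) :
    ∃ (j : CoverIndex X g) (i : Fin (j.1 + 1)), coverVertex j i = a := by
  obtain ⟨j, i, -, -, h, -⟩ := exists_triangle hg a (AbsLE.refl (Submonoid.one_mem _))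
    (one_le_of_mem hg)
  exact ⟨j, i, h⟩

/-- All vertices of the universal cover are joined by paths, as the elements of `[1, g]` generate
the interval group. -/
theorem joined_vert (hg : g ∈ Submonoid.closure X) (a b : IntervalGroup X g) :
    Joined (vert (exists_coverVertex hg) a) (vert (exists_coverVertex hg) b) := by
  let S : Subgroup (IntervalGroup X g) :=
    { carrier := {b | ∀ a, Joined (vert (exists_coverVertex hg) a)
        (vert (exists_coverVertex hg) (a * b))}
      one_mem' := fun a => by
        rw [mul_one]
      mul_mem' := fun {b c} hb hc a => by
        rw [← mul_assoc]
        exact (hb a).trans (hc _)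
      inv_mem' := fun {b} hb a => by
        have := hb (a * b⁻¹)
        rw [inv_mul_cancel_right] at this
        exact this.symm }
  have hS := PresentedGroup.generated_by (loopRelators X g) S (fun x a => by
    obtain ⟨j, i₀, i₁, -, h₀, h₁, -⟩ := exists_triangle hg a (AbsLE.refl x.2.1.1) x.2.1
    rw [← gen_of, ← h₁]
    nth_rewrite 1 [← h₀]
    exact ⟨line (common_vert_vert (exists_coverVertex hg) j i₀ i₁)⟩)
  have := hS (a⁻¹ * b) a
  rwa [mul_inv_cancel_left] at this

/-- With a fixed path from the base point to each vertex, every edge becomes a loop; these loops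
form a cocycle that is trivial on triangles. Its potential corrects the fixed paths to a choice of
path classes to the vertices that is compatible with all edges. -/
theorem simplyConnectedSpace_cover (hX : ∀ a x, x ∈ X → a * x * a⁻¹ ∈ X)
    (hg : g ∈ Submonoid.closure X) : SimplyConnectedSpace (Cover X g) := by
  classical
  let V := vert (e := coverVertex (X := X) (g := g)) (exists_coverVertex hg)
  let r : ∀ a, Path.Homotopic.Quotient (V 1) (V a) := fun a =>
    Path.Homotopic.Quotient.mk (joined_vert hg 1 a).somePath
  let γ : IntervalGroup X g → IntervalGroup X g → FundamentalGroup (Cover X g) (V 1) :=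
    fun a b => if h : Common (V a) (V b) then ((r a).trans (lineClass h)).trans (r b).symm else
      (1 : FundamentalGroup (Cover X g) (V 1))
  have hγ : ∀ {a b} (h : Common (V a) (V b)),
      γ a b = ((r a).trans (lineClass h)).trans (r b).symm := fun h => dif_pos h
  have hV : ∀ {a} {j : CoverIndex X g} {i : Fin (j.1 + 1)}, coverVertex j i = a →
      V a = simplex coverVertex j ⟨Pi.single i 1, single_mem_stdSimplex ℝ i⟩ := by
    rintro _ j i rfl
    exact vert_eq _ j i
  have hVV : ∀ {a b} {j : CoverIndex X g} {i i' : Fin (j.1 + 1)}, coverVertex j i = a →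
      coverVertex j i' = b → Common (V a) (V b) := by
    rintro _ _ j i i' rfl rfl
    exact common_vert_vert _ j i i'
  obtain ⟨u, hu⟩ := exists_potential hX hg γ (by
    intro a v w hv hw
    obtain ⟨j, i₀, i₁, i₂, h₀, h₁, h₂⟩ := exists_triangle hg a hv hw
    rw [hγ (hVV h₁ h₂), hγ (hVV h₀ h₁), hγ (hVV h₀ h₂), FundamentalGroup.mul_def,
      ← lineClass_trans_of_mem (hV h₀) (hV h₁) (hV h₂) (hVV h₀ h₁) (hVV h₁ h₂)]
    simp only [Path.Homotopic.Quotient.trans_assoc]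
    congr 2
    rw [← Path.Homotopic.Quotient.trans_assoc (r _).symm, Path.Homotopic.Quotient.symm_trans,
      Path.Homotopic.Quotient.refl_trans])
  let u' : ∀ a, Path.Homotopic.Quotient (V 1) (V 1) := u
  have hup : ∀ {a b} (h : Common (V a) (V b)), (∃ x, AbsLE X x g ∧ b = a * gen X g x) →
      ((u' a).trans (r a)).trans (lineClass h) = (u' b).trans (r b) := by
    rintro a _ h ⟨x, hx, rfl⟩
    have h1 := hu a x hx
    rw [hγ h, FundamentalGroup.mul_def] at h1
    have h2 : (u' a).trans (((r a).trans (lineClass h)).trans (r (a * gen X g x)).symm) =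
        u' (a * gen X g x) := h1
    rw [← h2]
    simp only [Path.Homotopic.Quotient.trans_assoc, Path.Homotopic.Quotient.symm_trans,
      Path.Homotopic.Quotient.trans_refl]
  have hle : ∀ (j : CoverIndex X g) (i i' : Fin (j.1 + 1)), i ≤ i' →
      ∃ x, AbsLE X x g ∧ coverVertex j i' = coverVertex j i * gen X g x := by
    intro j i i' h
    have h1 : AbsLE X (j.2.2 i).1 (j.2.2 i').1 := j.2.2.monotone h
    refine ⟨_, (h1.right_factor hX).trans (j.2.2 i').2, ?_⟩
    rw [coverVertex, coverVertex, mul_assoc, gen_mul hX h1 (j.2.2 i').2]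
  refine simplyConnectedSpace_of_potential (exists_coverVertex hg) 1
    (fun a => (u' a).trans (r a)) fun j i i' => ?_
  rcases le_total i i' with h | h
  · exact hup _ (hle j i i' h)
  · rw [← hup (common_vert_vert (exists_coverVertex hg) j i' i) (hle j i' i h),
      Path.Homotopic.Quotient.trans_assoc,
      lineClass_trans_symm (common_vert_vert (exists_coverVertex hg) j i' i),
      Path.Homotopic.Quotient.trans_refl]

/-- The fundamental group of the interval complex is the interval group. -/
theorem hasFundamentalGroup_intervalComplex (hX : ∀ a x, x ∈ X → a * x * a⁻¹ ∈ X)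
    (hg : g ∈ Submonoid.closure X) :
    HasFundamentalGroup (IntervalComplex X g) (IntervalGroup X g) := by
  have := simplyConnectedSpace_cover hX hg
  have hq := isQuotientCoveringMap_coverProj (X := X) (g := g) hX
  refine ⟨hq.surjective.pathConnectedSpace hq.continuous, fun y => ?_⟩
  obtain ⟨y', hy'⟩ := hq.surjective y
  exact ⟨(hq.fundamentalGroupEquiv ⟨y', hy'⟩).trans (MulEquiv.inv' _).symm⟩

end MarkedGroup

/-! ### Maximal elements of the circular poset -/

namespace MarkedGroup

variable {G : Type*} [Group G] {X : Set G} {g : G}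

/-- The product of the values of `u` along a sorted list does not depend on the list, as long as
it contains the support of `u`. -/
theorem prod_map_eq_of_sorted {M : Type*} [Monoid M] (u : I → M) {R R' : List I}
    (hR : R.Pairwise (· < ·)) (hR' : R'.Pairwise (· < ·)) (h : ∀ r, r ∉ R → u r = 1)
    (h' : ∀ r, r ∉ R' → u r = 1) : (R.map u).prod = (R'.map u).prod := by
  classical
  have key : ∀ R : List I, (R.map u).prod = ((R.filter fun r => u r ≠ 1).map u).prod := by
    intro R
    induction R with
    | nil => simp
    | cons a R ih =>
      by_cases ha : u a = 1
      · simp only [List.map_cons, List.prod_cons, ha, one_mul, ih]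
        rw [List.filter_cons_of_neg (by simpa using ha)]
      · rw [List.filter_cons_of_pos (by simpa using ha)]
        simp only [List.map_cons, List.prod_cons, ih]
  have hs : R.filter (fun r => u r ≠ 1) = R'.filter (fun r => u r ≠ 1) := by
    refine List.Perm.eq_of_pairwise (le := (· < ·)) (fun a b _ _ h1 h2 => (lt_asymm h1 h2).elim)
      (hR.filter _) (hR'.filter _) ?_
    refine (List.perm_ext_iff_of_nodup ?_ ?_).2 fun r => ?_
    · exact (hR.imp ne_of_lt).filter _
    · exact (hR'.imp ne_of_lt).filter _
    · simp only [List.mem_filter, decide_eq_true_eq]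
      constructor
      · rintro ⟨-, h1⟩
        exact ⟨by_contra fun h2 => h1 (h' r h2), h1⟩
      · rintro ⟨-, h1⟩
        exact ⟨by_contra fun h2 => h1 (h r h2), h1⟩
  rw [key R, key R', hs]

/-- The product and the length of a weighted factorization can be computed along any increasing
list of positions that contains its support. -/
theorem IsWeightedFact.of_list {h : G} {u : I → G} (hu : IsWeightedFact X h u) {R : List I}
    (hR : R.Pairwise (· < ·)) (hs : ∀ r, r ∉ R → u r = 1) :
    (R.map u).prod = h ∧ (R.map fun r => len X (u r)).sum = len X h := by
  obtain ⟨-, R', hR', hs', hp, hl⟩ := hu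
  refine ⟨(prod_map_eq_of_sorted u hR hR' hs hs').trans hp, ?_⟩
  rw [← hl]
  have h1 := prod_map_eq_of_sorted (fun r => Multiplicative.ofAdd (len X (u r))) hR hR'
    (fun r hr => by rw [hs r hr, len_one]; rfl) (fun r hr => by rw [hs' r hr, len_one]; rfl)
  have h2 : ∀ L : List I, (L.map fun r => Multiplicative.ofAdd (len X (u r))).prod =
      Multiplicative.ofAdd (L.map fun r => len X (u r)).sum := by
    intro L
    rw [ofAdd_list_prod, List.map_map]
    rfl
  rw [h2, h2] at h1
  exact Multiplicative.ofAdd.injective h1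

theorem IsWeightedFact.exists_finset {h : G} {u : I → G} (hu : IsWeightedFact X h u) :
    ∃ F : Finset I, ∀ r, r ∉ F → u r = 1 := by
  classical
  obtain ⟨-, R, -, hs, -⟩ := hu
  exact ⟨R.toFinset, fun r hr => hs r (by simpa using hr)⟩

/-- The points of a finite set in the open interval, in increasing order. -/
noncomputable def innerList (F : Finset I) : List I :=
  (F.filter fun r => r ≠ 0 ∧ r ≠ 1).sort (· ≤ ·)

theorem mem_innerList {F : Finset I} {r : I} : r ∈ innerList F ↔ r ∈ F ∧ r ≠ 0 ∧ r ≠ 1 := by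
  simp [innerList]

theorem innerList_pairwise (F : Finset I) : (innerList F).Pairwise (· < ·) :=
  (Finset.sortedLT_sort _).pairwise

theorem pairwise_cons_inner (F : Finset I) :
    ((0 : I) :: (innerList F ++ [1])).Pairwise (· < ·) := by
  rw [List.pairwise_cons, List.pairwise_append]
  refine ⟨fun r hr => ?_, innerList_pairwise F, List.pairwise_singleton _ _, fun r hr s hs => ?_⟩
  · rcases List.mem_append.1 hr with h | h
    · exact unitInterval.pos_iff_ne_zero.2 (mem_innerList.1 h).2.1
    · rw [List.mem_singleton.1 h]
      exact zero_lt_one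
  · rw [List.mem_singleton.1 hs]
    exact unitInterval.lt_one_iff_ne_one.2 (mem_innerList.1 hr).2.2

theorem eq_one_of_notMem_cons_inner {u : I → G} {F : Finset I}
    (hF : ∀ r, r ≠ 0 → r ≠ 1 → r ∉ F → u r = 1) (r : I)
    (hr : r ∉ (0 : I) :: (innerList F ++ [1])) : u r = 1 := by
  simp only [List.mem_cons, List.mem_append, List.not_mem_nil, or_false, not_or] at hr
  exact hF r hr.1 hr.2.2 fun h => hr.2.1 (mem_innerList.2 ⟨h, hr.1, hr.2.2⟩)

theorem IsWeightedFact.inner {h : G} {u : I → G} (hu : IsWeightedFact X h u) {F : Finset I}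
    (hF : ∀ r, r ≠ 0 → r ≠ 1 → r ∉ F → u r = 1) :
    u 0 * ((innerList F).map u).prod * u 1 = h ∧
      len X (u 0) + ((innerList F).map fun r => len X (u r)).sum + len X (u 1) = len X h := by
  have := hu.of_list (pairwise_cons_inner F) (eq_one_of_notMem_cons_inner hF)
  simpa [mul_assoc, add_assoc] using this

theorem isWeightedFact_of_inner {h : G} {u : I → G} (hu : ∀ r, u r ∈ Submonoid.closure X)
    {F : Finset I} (hF : ∀ r, r ≠ 0 → r ≠ 1 → r ∉ F → u r = 1)
    (hp : u 0 * ((innerList F).map u).prod * u 1 = h)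
    (hl : len X (u 0) + ((innerList F).map fun r => len X (u r)).sum + len X (u 1) = len X h) :
    IsWeightedFact X h u := by
  refine ⟨hu, _, pairwise_cons_inner F, eq_one_of_notMem_cons_inner hF, ?_, ?_⟩
  · simpa [mul_assoc] using hp
  · simpa [add_assoc] using hl

theorem map_congr_inner {M : Type*} {u v : I → M} (h : ∀ r, r ≠ 0 → r ≠ 1 → u r = v r)
    (F : Finset I) : (innerList F).map u = (innerList F).map v :=
  List.map_congr_left fun r hr => h r (mem_innerList.1 hr).2.1 (mem_innerList.1 hr).2.2

/-- The class of a factorization of `g` contains factorizations of `g` only. -/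
theorem base_eq_of_equiv {u v : LinFactPoset X g} (h : CircFactPoset.mk u = CircFactPoset.mk v)
    (hu : u.1.1 = g) : v.1.1 = g := by
  obtain ⟨h1, h2⟩ := Quotient.exact h
  obtain ⟨F, hF⟩ := u.2.2.exists_finset
  have hu1 := (u.2.2.inner (F := F) fun r _ _ hr => hF r hr).1
  have hv1 := (v.2.2.inner (F := F) fun r h0 h0' hr => (h1 r h0 h0').symm.trans (hF r hr)).1
  change u.toFun 0 * ((innerList F).map u.toFun).prod * u.toFun 1 = _ at hu1
  change v.toFun 0 * ((innerList F).map v.toFun).prod * v.toFun 1 = _ at hv1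
  rw [map_congr_inner h1] at hu1
  rw [← hv1]
  rw [hu] at hu1
  generalize ((innerList F).map v.toFun).prod = m at *
  have h3 : u.toFun 0 = g * (u.toFun 1)⁻¹ * m⁻¹ :=
    eq_mul_inv_of_mul_eq (eq_mul_inv_of_mul_eq hu1)
  rw [h3] at h2
  have h4 : g * m⁻¹ = g * v.toFun 1 * g⁻¹ * v.toFun 0 := by rw [← h2]; group
  have h5 : v.toFun 0 = g * (v.toFun 1)⁻¹ * m⁻¹ := by
    rw [mul_assoc, mul_assoc] at h4
    have h6 := mul_left_cancel h4
    rw [h6]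
    group
  rw [h5]
  group

theorem AbsLE.eq_one {h : G} (H : AbsLE X h 1) : h = 1 := H.antisymm H.one_le

theorem len_base_le {u v : LinFactPoset X g} (h : v ≤ u) : len X v.1.1 ≤ len X u.1.1 := by
  obtain ⟨-, R, hR, hs, -, hl⟩ := u.2.2
  have hv := (v.2.2.of_list hR fun r hr => ?_).2
  · rw [← hl, ← hv]
    exact List.sum_le_sum fun r _ => (h r).len_le
  · have := h r
    unfold LinFactPoset.toFun at this
    rw [hs r hr] at this
    exact this.eq_one

theorem LinFactPoset.ext' {u v : LinFactPoset X g} (h1 : u.1.1 = v.1.1)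
    (hf : u.toFun = v.toFun) : u = v := by
  obtain ⟨⟨h, hh⟩, u, hu⟩ := u
  obtain ⟨⟨h', hh'⟩, v, hv⟩ := v
  obtain rfl : h = h' := h1
  obtain rfl : u = v := hf
  rfl

/-- A factorization of `g` itself has nothing above it, as the lengths of its entries already add
up to the maximal value. -/
theorem eq_of_le_of_base {u v : LinFactPoset X g} (h : v ≤ u) (hv : v.1.1 = g) : v = u := by
  have h1 := len_base_le h
  have h2 := u.1.2.len_le
  have hlen : len X v.1.1 = len X u.1.1 := by
    rw [hv] at h1 ⊢
    omega
  have hu : u.1.1 = g := by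
    by_contra hne
    have := len_lt_of_le_of_ne u.1.2 hne
    rw [hv] at hlen
    omega
  refine LinFactPoset.ext' (hv.trans hu.symm) (funext fun r => ?_)
  by_contra hne
  obtain ⟨-, R, hR, hs, -, hl⟩ := u.2.2
  have hs' : ∀ r, r ∉ R → v.2.1 r = 1 := fun r hr => by
    have := h r
    unfold LinFactPoset.toFun at this
    rw [hs r hr] at this
    exact this.eq_one
  have hv' := (v.2.2.of_list hR hs').2
  have hr : r ∈ R := by
    by_contra hr
    exact hne ((hs' r hr).trans (hs r hr).symm)
  have : (R.map fun r => len X (v.2.1 r)).sum < (R.map fun r => len X (u.2.1 r)).sum :=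
    List.sum_lt_sum _ _ (fun r _ => (h r).len_le) ⟨r, hr, len_lt_of_le_of_ne (h r) hne⟩
  omega

theorem linFactPoset_le_refl (u : LinFactPoset X g) : u ≤ u := fun r => AbsLE.refl (u.2.2.1 r)

/-- A proper prefix of `g` can be completed at the end point `1` of the interval. -/
theorem exists_completion (u : LinFactPoset X g) :
    ∃ v : LinFactPoset X g, v.1.1 = g ∧ u ≤ v := by
  classical
  obtain ⟨⟨h, hh⟩, u, hu⟩ := u
  obtain ⟨F, hF⟩ := hu.exists_finset
  obtain ⟨h1, h2⟩ := hu.inner (F := F) fun r _ _ hr => hF r hr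
  change _ = h at h1
  change _ = len X h at h2
  let v : I → G := fun r => if r = 1 then u 1 * (h⁻¹ * g) else u r
  have hv1 : v 1 = u 1 * (h⁻¹ * g) := if_pos rfl
  have hv : ∀ r, r ≠ 1 → v r = u r := fun r hr => if_neg hr
  have hv0 : v 0 = u 0 := hv 0 zero_ne_one
  have hvm : ∀ r, v r ∈ Submonoid.closure X := by
    intro r
    by_cases hr : r = 1
    · rw [hr, hv1]
      exact Submonoid.mul_mem _ (hu.1 1) hh.2.1
    · rw [hv r hr]
      exact hu.1 r
  have hmap := map_congr_inner (u := v) (v := u) (fun r _ h => hv r h) F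
  have hmapl := map_congr_inner (u := fun r => len X (v r)) (v := fun r => len X (u r))
    (fun r _ h => by rw [hv r h]) F
  have hprod : v 0 * ((innerList F).map v).prod * v 1 = g := by
    rw [hmap, hv0, hv1, ← mul_assoc, h1]
    group
  have hlen1 : len X (u 1 * (h⁻¹ * g)) = len X (u 1) + len X (h⁻¹ * g) := by
    refine le_antisymm (len_mul_le (hu.1 1) hh.2.1) ?_
    have h3 := len_prod_le (X := X) (v 0 :: ((innerList F).map v ++ [v 1])) (by
      intro x hx
      simp only [List.mem_cons, List.mem_append, List.mem_map, List.not_mem_nil, or_false] at hx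
      rcases hx with rfl | ⟨r, -, rfl⟩ | rfl <;> exact hvm _)
    simp only [List.prod_cons, List.prod_append, List.map_cons, List.map_append, List.prod_nil,
      List.map_nil, List.sum_cons, List.sum_append, List.sum_nil, mul_one, List.map_map] at h3
    rw [← mul_assoc, hprod] at h3
    change _ ≤ _ + (((innerList F).map fun r => len X (v r)).sum + _) at h3
    rw [hmapl, hv0, hv1] at h3
    have := hh.2.2
    omega
  refine ⟨⟨⟨g, AbsLE.refl hh.mem_right⟩, v, ?_⟩, rfl, fun r => ?_⟩
  · refine isWeightedFact_of_inner hvm (F := F)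
      (fun r _ h hr => (hv r h).trans (hF r hr)) hprod ?_
    rw [hmapl, hv0, hv1, hlen1]
    have := hh.2.2
    change _ = len X g
    omega
  · change AbsLE X (u r) (v r)
    by_cases hr : r = 1
    · rw [hr, hv1]
      refine ⟨hu.1 1, ?_, ?_⟩
      · rw [inv_mul_cancel_left]
        exact hh.2.1
      · rw [inv_mul_cancel_left, hlen1]
    · rw [hv r hr]
      exact AbsLE.refl (hu.1 r)

/-- The maximal elements are the classes of the factorizations of `g` itself. -/
theorem isMax_mk_iff (u : LinFactPoset X g) : IsMax (CircFactPoset.mk u) ↔ u.1.1 = g := by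
  constructor
  · intro h
    obtain ⟨v, hv, huv⟩ := exists_completion u
    obtain ⟨v', u', h1, h2, h3⟩ := h (⟨u, v, rfl, rfl, huv⟩ :
      CircFactPoset.mk u ≤ CircFactPoset.mk v)
    have hv' := base_eq_of_equiv h1.symm hv
    have := eq_of_le_of_base h3 hv'
    subst this
    exact base_eq_of_equiv h2 hv'
  · rintro hu b ⟨v, w, h1, rfl, h3⟩
    have hv := base_eq_of_equiv h1.symm hu
    have := eq_of_le_of_base h3 hv
    subst this
    exact ⟨v, v, rfl, h1, linFactPoset_le_refl v⟩

end MarkedGroup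

/-! ### Chains and linear factorizations -/

namespace MarkedGroup

open SimplexFamily

variable {G : Type*} [Group G] {X : Set G} {g : G}

/-- The product of the successive quotients of `C 0, C 1, …` over an initial segment. -/
theorem prod_ofFn_initial {m : ℕ} (x : Fin m → G) (C : Fin (m + 1) → G)
    (hx : ∀ i, x i = (C i.castSucc)⁻¹ * C i.succ) (p : Fin m → Prop) [DecidablePred p]
    (b : Fin (m + 1)) (hp : ∀ i, p i ↔ i.castSucc < b) :
    (List.ofFn fun i => if p i then x i else 1).prod = (C 0)⁻¹ * C b := by
  induction m with
  | zero =>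
    obtain rfl : b = 0 := Fin.fin_one_eq_zero b
    simp
  | succ m ih =>
    rw [List.ofFn_succ, List.prod_cons]
    induction b using Fin.cases with
    | zero =>
      rw [List.prod_eq_one, if_neg]
      · simp
      · rw [hp]
        simp
      · intro y hy
        obtain ⟨i, rfl⟩ := (List.mem_ofFn' _ _).1 hy
        dsimp only
        rw [if_neg]
        rw [hp]
        simp
    | succ b =>
      rw [if_pos ((hp 0).2 (by simp)), ih (fun i => x i.succ) (fun i => C i.succ)
        (fun i => hx i.succ) (fun i => p i.succ) b (fun i => by
          rw [hp, ← Fin.succ_castSucc, Fin.succ_lt_succ_iff]), hx 0]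
      simp [mul_assoc]

theorem sum_telescope {m : ℕ} (x : Fin m → ℕ) (C : Fin (m + 1) → ℕ)
    (hx : ∀ i, C i.castSucc + x i = C i.succ) : C 0 + ∑ i, x i = C (Fin.last m) := by
  induction m with
  | zero => simp
  | succ m ih =>
    have h := ih (fun i => x i.castSucc) (fun i => C i.castSucc) (fun i => hx i.castSucc)
    rw [Fin.castSucc_zero] at h
    rw [Fin.sum_univ_castSucc, ← add_assoc, h]
    exact hx (Fin.last m)

/-- The chain `1 ≤ c 0 < ⋯ < c k ≤ g`. -/
def extendChain {k : ℕ} (c : Fin (k + 1) ↪o Interval X g) : Fin (k + 3) → G :=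
  Fin.cons 1 (Fin.snoc (α := fun _ => G) (fun i => (c i).1) g)

theorem extendChain_zero {k : ℕ} (c : Fin (k + 1) ↪o Interval X g) : extendChain c 0 = 1 := rfl

theorem extendChain_mid {k : ℕ} (c : Fin (k + 1) ↪o Interval X g) (i : Fin (k + 1)) :
    extendChain c i.castSucc.succ = (c i).1 := by
  simp [extendChain]

theorem extendChain_last {k : ℕ} (c : Fin (k + 1) ↪o Interval X g) :
    extendChain c (Fin.last (k + 2)) = g := by
  rw [← Fin.succ_last, extendChain, Fin.cons_succ, Fin.snoc_last]

theorem extendChain_le_succ {k : ℕ} (c : Fin (k + 1) ↪o Interval X g) (i : Fin (k + 2)) :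
    AbsLE X (extendChain c i.castSucc) (extendChain c i.succ) := by
  induction i using Fin.cases with
  | zero =>
    have : (0 : Fin (k + 2)).succ = (0 : Fin (k + 1)).castSucc.succ := by simp
    rw [Fin.castSucc_zero, extendChain_zero, this, extendChain_mid]
    exact (c 0).2.one_le
  | succ i =>
    rw [← Fin.succ_castSucc, extendChain_mid]
    induction i using Fin.lastCases with
    | last =>
      rw [Fin.succ_last, Fin.succ_last, extendChain_last]
      exact (c _).2
    | cast i =>
      rw [Fin.succ_castSucc, extendChain_mid]
      exact c.monotone i.castSucc_lt_succ.le

/-- The linear factorization of `g` given by the successive quotients of a chain. -/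
def factOfChain {k : ℕ} (c : Fin (k + 1) ↪o Interval X g) : LinearFact X g k :=
  ⟨fun i => (extendChain c i.castSucc)⁻¹ * extendChain c i.succ, by
    refine ⟨fun i => (extendChain_le_succ c i).2.1, fun i h0 h1 => ?_, ?_, ?_⟩
    · induction i using Fin.cases with
      | zero => exact absurd rfl h0
      | succ i =>
        induction i using Fin.lastCases with
        | last => exact absurd rfl h1
        | cast i =>
          change (extendChain c _)⁻¹ * extendChain c _ ≠ 1
          rw [← Fin.succ_castSucc, extendChain_mid, Fin.succ_castSucc, extendChain_mid]
          intro h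
          have h2 := c.injective (Subtype.ext (inv_mul_eq_one.1 h))
          exact i.castSucc_lt_succ.ne h2
    · have h := sum_telescope
        (fun i => len X ((extendChain c i.castSucc)⁻¹ * extendChain c i.succ))
        (fun i => len X (extendChain c i)) (fun i => (extendChain_le_succ c i).2.2)
      rw [extendChain_zero, len_one, zero_add, extendChain_last] at h
      rw [List.sum_ofFn]
      exact h
    · have h := prod_ofFn_initial _ (extendChain c) (fun i => rfl) (fun _ => True)
        (Fin.last (k + 2)) (fun i => by simp [Fin.castSucc_lt_last])
      simp only [if_true] at h
      rw [h, extendChain_zero, extendChain_last]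
      simp⟩

theorem geodesic_append {l l' : List G} (hl : ∀ x ∈ l ++ l', x ∈ Submonoid.closure X)
    (h : ((l ++ l').map (len X)).sum = len X (l ++ l').prod) :
    AbsLE X l.prod (l ++ l').prod ∧ (l.map (len X)).sum = len X l.prod := by
  have h1 : ∀ x ∈ l, x ∈ Submonoid.closure X := fun x hx => hl x (List.mem_append_left _ hx)
  have h2 : ∀ x ∈ l', x ∈ Submonoid.closure X := fun x hx => hl x (List.mem_append_right _ hx)
  have h3 := len_prod_le l h1
  have h4 := len_prod_le l' h2
  have h5 := len_mul_le (Submonoid.list_prod_mem _ h1) (Submonoid.list_prod_mem _ h2)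
  rw [List.map_append, List.sum_append, List.prod_append] at h
  rw [List.prod_append]
  refine ⟨⟨Submonoid.list_prod_mem _ h1, ?_, ?_⟩, ?_⟩
  · rw [inv_mul_cancel_left]
    exact Submonoid.list_prod_mem _ h2
  · rw [inv_mul_cancel_left]
    omega
  · omega

/-- Every linear factorization comes from the chain of its prefixes. -/
theorem exists_factOfChain {k : ℕ} (y : LinearFact X g k) :
    ∃ c : Fin (k + 1) ↪o Interval X g, factOfChain c = y := by
  obtain ⟨y, hy, hne, hlen, hprod⟩ := y
  have hmem : ∀ x ∈ List.ofFn y, x ∈ Submonoid.closure X := by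
    intro x hx
    obtain ⟨i, rfl⟩ := (List.mem_ofFn' _ _).1 hx
    exact hy i
  have hlen' : ((List.ofFn y).map (len X)).sum = len X (List.ofFn y).prod := by
    rw [hprod, ← hlen, List.map_ofFn]
    rfl
  have htake : ∀ n, AbsLE X ((List.ofFn y).take n).prod g ∧
      (((List.ofFn y).take n).map (len X)).sum = len X ((List.ofFn y).take n).prod := by
    intro n
    have := geodesic_append (X := X) (l := (List.ofFn y).take n) (l' := (List.ofFn y).drop n)
    rw [List.take_append_drop, hprod] at this
    exact this hmem (by rw [hlen', hprod])
  have hstep : ∀ n (hn : n < k + 2), ((List.ofFn y).take (n + 1)).prod =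
      ((List.ofFn y).take n).prod * y ⟨n, hn⟩ := by
    intro n hn
    rw [List.take_succ_eq_append_getElem (by rw [List.length_ofFn]; exact hn), List.prod_append,
      List.getElem_ofFn, List.prod_singleton]
  let C : Fin (k + 1) → Interval X g := fun i => ⟨((List.ofFn y).take (i.1 + 1)).prod,
    (htake _).1⟩
  have hC : StrictMono C := by
    rw [Fin.strictMono_iff_lt_succ]
    intro i
    have h1 := (htake (i.1 + 1 + 1)).2
    have h2 : C i.castSucc ≤ C i.succ := by
      change AbsLE X ((List.ofFn y).take (i.1 + 1)).prod ((List.ofFn y).take (i.1 + 1 + 1)).prod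
      have h3 := geodesic_append (X := X) (l := (List.ofFn y).take (i.1 + 1))
        (l' := [y ⟨i.1 + 1, by omega⟩])
      have h4 : (List.ofFn y).take (i.1 + 1 + 1) =
          (List.ofFn y).take (i.1 + 1) ++ [y ⟨i.1 + 1, by omega⟩] := by
        rw [List.take_succ_eq_append_getElem (by rw [List.length_ofFn]; omega),
          List.getElem_ofFn]
      rw [h4] at h1 ⊢
      refine (h3 ?_ h1).1
      intro x hx
      rcases List.mem_append.1 hx with hx | hx
      · exact hmem x (List.mem_of_mem_take hx)
      · rw [List.mem_singleton.1 hx]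
        exact hy _
    refine lt_of_le_of_ne h2 fun h3 => ?_
    have h4 : ((List.ofFn y).take (i.1 + 1)).prod = ((List.ofFn y).take (i.1 + 1 + 1)).prod :=
      congrArg Subtype.val h3
    rw [hstep (i.1 + 1) (by omega), left_eq_mul] at h4
    refine hne _ ?_ ?_ h4
    · simp [Fin.ext_iff]
    · simp only [ne_eq, Fin.ext_iff, Fin.val_last]
      omega
  refine ⟨OrderEmbedding.ofStrictMono C hC, Subtype.ext (funext fun i => ?_)⟩
  have hext : ∀ i, extendChain (OrderEmbedding.ofStrictMono C hC) i =
      ((List.ofFn y).take i.1).prod := by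
    intro i
    induction i using Fin.cases with
    | zero => simp [extendChain_zero]
    | succ i =>
      induction i using Fin.lastCases with
      | last =>
        rw [Fin.succ_last, extendChain_last, List.take_of_length_le (by simp), hprod]
      | cast i =>
        rw [extendChain_mid]
        rfl
  change (extendChain _ i.castSucc)⁻¹ * extendChain _ i.succ = y i
  rw [hext, hext, Fin.val_succ, hstep _ i.2, Fin.val_castSucc, inv_mul_cancel_left]

/-! ### Barycentric coordinates and positions -/

/-- The partial sums of the barycentric coordinates. -/
noncomputable def partialSum {k : ℕ} (w : Fin (k + 1) → ℝ) (i : Fin (k + 2)) : ℝ :=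
  ∑ l : Fin (k + 1), if l.castSucc < i then w l else 0

theorem partialSum_zero {k : ℕ} (w : Fin (k + 1) → ℝ) : partialSum w 0 = 0 := by
  simp [partialSum]

theorem partialSum_last {k : ℕ} (w : Fin (k + 1) → ℝ) :
    partialSum w (Fin.last (k + 1)) = ∑ l, w l := by
  simp [partialSum, Fin.castSucc_lt_last]

theorem partialSum_succ {k : ℕ} (w : Fin (k + 1) → ℝ) (i : Fin (k + 1)) :
    partialSum w i.succ = partialSum w i.castSucc + w i := by
  have h : ∀ l : Fin (k + 1), (if l.castSucc < i.succ then w l else 0) =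
      (if l.castSucc < i.castSucc then w l else 0) + if l = i then w l else 0 := by
    intro l
    simp only [Fin.lt_def, Fin.val_castSucc, Fin.val_succ, Fin.ext_iff]
    rcases lt_trichotomy l.1 i.1 with h | h | h
    · rw [if_pos (by omega), if_pos h, if_neg (by omega), add_zero]
    · rw [if_pos (by omega), if_neg (by omega), if_pos h, zero_add]
    · rw [if_neg (by omega), if_neg (by omega), if_neg (by omega), add_zero]
  unfold partialSum
  simp_rw [h]
  rw [Finset.sum_add_distrib, Finset.sum_ite_eq' Finset.univ i, if_pos (Finset.mem_univ _)]

theorem partialSum_mono {k : ℕ} {w : Fin (k + 1) → ℝ} (hw : ∀ i, 0 ≤ w i) :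
    Monotone (partialSum w) := by
  rw [Fin.monotone_iff_le_succ]
  intro i
  rw [partialSum_succ]
  linarith [hw i]

theorem partialSum_mem {k : ℕ} (w : stdSimplex ℝ (Fin (k + 1))) (i : Fin (k + 2)) :
    partialSum w.1 i ∈ Set.Icc (0 : ℝ) 1 := by
  constructor
  · rw [← partialSum_zero w.1]
    exact partialSum_mono w.2.1 (Fin.zero_le _)
  · rw [← w.2.2, ← partialSum_last]
    exact partialSum_mono w.2.1 (Fin.le_last _)

/-- A point of the standard simplex is an increasing sequence in the unit interval, by taking
partial sums. -/
noncomputable def positionsHomeo (k : ℕ) : stdSimplex ℝ (Fin (k + 1)) ≃ₜ Positions k where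
  toFun w := ⟨fun i => ⟨partialSum w.1 i, partialSum_mem w i⟩,
    fun _ _ h => partialSum_mono w.2.1 h, Subtype.ext (partialSum_zero _),
    Subtype.ext ((partialSum_last _).trans w.2.2)⟩
  invFun s := ⟨fun l => (s.1 l.succ : ℝ) - s.1 l.castSucc, by
    refine ⟨fun l => sub_nonneg.2 (s.2.1 l.castSucc_lt_succ.le), ?_⟩
    have h : ∀ i, partialSum (fun l => (s.1 l.succ : ℝ) - s.1 l.castSucc) i = s.1 i := by
      intro i
      induction i using Fin.induction with
      | zero => rw [partialSum_zero, s.2.2.1]; rfl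
      | succ i ih => rw [partialSum_succ, ih]; ring
    rw [← partialSum_last, h, s.2.2.2]
    rfl⟩
  left_inv w := by
    refine Subtype.ext (funext fun l => ?_)
    change partialSum w.1 l.succ - partialSum w.1 l.castSucc = w.1 l
    rw [partialSum_succ]
    ring
  right_inv s := by
    refine Subtype.ext (funext fun i => Subtype.ext ?_)
    change partialSum (fun l => (s.1 l.succ : ℝ) - s.1 l.castSucc) i = s.1 i
    induction i using Fin.induction with
    | zero => rw [partialSum_zero, s.2.2.1]; rfl
    | succ i ih => rw [partialSum_succ, ih]; ring
  continuous_toFun := by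
    refine Continuous.subtype_mk (continuous_pi fun i => Continuous.subtype_mk ?_ _) _
    unfold partialSum
    refine continuous_finsetSum _ fun l _ => ?_
    split_ifs
    · exact (continuous_apply l).comp continuous_subtype_val
    · exact continuous_const
  continuous_invFun := by
    refine Continuous.subtype_mk (continuous_pi fun l => ?_) _
    exact (continuous_subtype_val.comp ((continuous_apply _).comp continuous_subtype_val)).sub
      (continuous_subtype_val.comp ((continuous_apply _).comp continuous_subtype_val))

/-! ### The step function of a point of the order complex -/

/-- The product of the entries up to position `r`. -/
noncomputable def upTo {m : ℕ} (x : Fin m → G) (s : Fin m → I) (r : I) : G :=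
  (List.ofFn fun i => if s i ≤ r then x i else 1).prod

/-- The product of the entries before position `r`. -/
noncomputable def before {m : ℕ} (x : Fin m → G) (s : Fin m → I) (r : I) : G :=
  (List.ofFn fun i => if s i < r then x i else 1).prod

theorem before_mul_place {m : ℕ} (x : Fin m → G) (s : Fin m → I) (hs : Monotone s) (r : I) :
    before x s r * place x s r = upTo x s r := by
  unfold before place upTo
  induction m with
  | zero => simp
  | succ m ih =>
    have ih := ih (fun i => x i.succ) (fun i => s i.succ)
      (fun i j h => hs (Fin.succ_le_succ_iff.2 h))
    rw [List.ofFn_succ, List.ofFn_succ, List.ofFn_succ, List.prod_cons, List.prod_cons,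
      List.prod_cons, ← ih]
    rcases lt_or_ge (s 0) r with h | h
    · rw [if_pos h, if_neg h.ne, if_pos h.le, one_mul, mul_assoc]
    · have h1 : (List.ofFn fun i : Fin m => if s i.succ < r then x i.succ else 1).prod = 1 := by
        refine List.prod_eq_one fun y hy => ?_
        obtain ⟨i, rfl⟩ := (List.mem_ofFn' _ _).1 hy
        dsimp only
        rw [if_neg (not_lt.2 (h.trans (hs (Fin.zero_le _))))]
      rw [h1, if_neg (not_lt.2 h), one_mul, one_mul, one_mul]
      congr 1
      by_cases h2 : s 0 = r
      · rw [if_pos h2, if_pos h2.le]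
      · rw [if_neg h2, if_neg fun h3 => h2 (le_antisymm h3 h)]

theorem upTo_eq_prod {m : ℕ} (x : Fin m → G) (s : Fin m → I) (hs : Monotone s) (r : I)
    (R : List I) (hR : R.Pairwise (· < ·)) (hsR : ∀ i, s i ∈ R) :
    upTo x s r = (R.map fun r' => if r' ≤ r then place x s r' else 1).prod := by
  have h := prod_place (List.ofFn fun i => (s i, if s i ≤ r then x i else 1)) (by
    rw [List.pairwise_ofFn]
    exact fun i j hij => hs hij.le) R hR (by
    intro p hp
    obtain ⟨i, rfl⟩ := (List.mem_ofFn' _ _).1 hp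
    exact hsR i)
  rw [List.map_ofFn] at h
  refine Eq.trans ?_ (h.symm.trans ?_)
  · rfl
  · congr 1
    refine List.map_congr_left fun r' _ => ?_
    rw [List.map_ofFn]
    split_ifs with hr
    · unfold place
      congr 2
      funext i
      dsimp only [Function.comp]
      by_cases h1 : s i = r'
      · rw [if_pos h1, if_pos h1, if_pos (h1.trans_le hr)]
      · rw [if_neg h1, if_neg h1]
    · refine List.prod_eq_one fun y hy => ?_
      obtain ⟨i, rfl⟩ := (List.mem_ofFn' _ _).1 hy
      change (if s i = r' then (if s i ≤ r then x i else 1) else 1) = 1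
      split_ifs with h1 h2
      · exact absurd (h1.symm.trans_le h2) hr
      · rfl
      · rfl

theorem upTo_eq_of_place_eq {m m' : ℕ} {x : Fin m → G} {s : Fin m → I} (hs : Monotone s)
    {x' : Fin m' → G} {s' : Fin m' → I} (hs' : Monotone s') (h : place x s = place x' s') :
    upTo x s = upTo x' s' := by
  classical
  funext r
  let F : Finset I := Finset.univ.image s ∪ Finset.univ.image s'
  have hF : (F.sort (· ≤ ·)).Pairwise (· < ·) := (Finset.sortedLT_sort _).pairwise
  rw [upTo_eq_prod x s hs r _ hF, upTo_eq_prod x' s' hs' r _ hF, h]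
  · intro i
    simp [F]
  · intro i
    simp [F]

theorem place_eq_of_upTo_eq {k k' : ℕ} {x : LinearFact X g k} {s : Positions k}
    {x' : LinearFact X g k'} {s' : Positions k'}
    (h : ∀ r, r < 1 → upTo x.1 s.1 r = upTo x'.1 s'.1 r) : place x.1 s.1 = place x'.1 s'.1 := by
  classical
  have h1 : ∀ r, upTo x.1 s.1 r = upTo x'.1 s'.1 r := by
    intro r
    rcases lt_or_eq_of_le (unitInterval.le_one' (t := r)) with hr | rfl
    · exact h r hr
    · have : ∀ {k : ℕ} (x : LinearFact X g k) (s : Positions k), upTo x.1 s.1 1 = g := by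
        intro k x s
        unfold upTo
        simp only [unitInterval.le_one', if_true]
        exact x.2.2.2.2
      rw [this, this]
  have h2 : ∀ r, before x.1 s.1 r = before x'.1 s'.1 r := by
    intro r
    rcases eq_or_lt_of_le (unitInterval.nonneg' (t := r)) with rfl | hr
    · have : ∀ {k : ℕ} (x : LinearFact X g k) (s : Positions k), before x.1 s.1 0 = 1 := by
        intro k x s
        refine List.prod_eq_one fun y hy => ?_
        obtain ⟨i, rfl⟩ := (List.mem_ofFn' _ _).1 hy
        exact if_neg (not_lt.2 unitInterval.nonneg')
      rw [this, this]
    -- No position lies strictly between the largest position `r'` below `r` and `r`.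
    · let F : Finset I := (Finset.univ.image s.1 ∪ Finset.univ.image s'.1).filter fun q => q < r
      have hF : F.Nonempty := by
        refine ⟨0, ?_⟩
        simp only [F, Finset.mem_filter, Finset.mem_union, Finset.mem_image, Finset.mem_univ,
          true_and]
        exact ⟨Or.inl ⟨0, s.2.2.1⟩, hr⟩
      have hmax := F.max'_mem hF
      have hlt : F.max' hF < r := (Finset.mem_filter.1 hmax).2
      have hb : ∀ q, q ∈ Finset.univ.image s.1 ∪ Finset.univ.image s'.1 →
          (q < r ↔ q ≤ F.max' hF) := fun q hq =>
        ⟨fun h => F.le_max' q (Finset.mem_filter.2 ⟨hq, h⟩), fun h => h.trans_lt hlt⟩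
      have h3 : before x.1 s.1 r = upTo x.1 s.1 (F.max' hF) := by
        unfold before upTo
        simp only [hb (s.1 _) (Finset.mem_union_left _ (Finset.mem_image_of_mem _
          (Finset.mem_univ _)))]
      have h4 : before x'.1 s'.1 r = upTo x'.1 s'.1 (F.max' hF) := by
        unfold before upTo
        simp only [hb (s'.1 _) (Finset.mem_union_right _ (Finset.mem_image_of_mem _
          (Finset.mem_univ _)))]
      rw [h3, h4, h1]
  funext r
  have h5 := before_mul_place x.1 s.1 s.2.1 r
  have h6 := before_mul_place x'.1 s'.1 s'.2.1 r
  rw [h1, h2, ← h6] at h5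
  exact mul_left_cancel h5

end MarkedGroup

/-! ### Maximal elements and the interval complex -/

namespace MarkedGroup

open SimplexFamily

variable {G : Type*} [Group G] {X : Set G} {g : G}

theorem simplex_apply_self {k : ℕ} (c : Fin (k + 1) ↪o Interval X g)
    (w : stdSimplex ℝ (Fin (k + 1))) (i : Fin (k + 1)) :
    (OrderComplex.simplex c w).1 (c i) = w.1 i :=
  Finsupp.embDomain_apply_self c.toEmbedding (Finsupp.equivFunOnFinite.symm w.1) i

theorem exists_of_simplex_apply_ne {k : ℕ} (c : Fin (k + 1) ↪o Interval X g)
    (w : stdSimplex ℝ (Fin (k + 1))) {x : Interval X g}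
    (h : (OrderComplex.simplex c w).1 x ≠ 0) : ∃ i, c i = x := by
  by_contra h1
  exact h (Finsupp.embDomain_of_notMem_range _ _ _ (by simpa using h1))

/-- The total weight below `x` of a point of the order complex. -/
noncomputable def weightBelow (t : OrderComplex (Interval X g)) (x : Interval X g) : ℝ :=
  open scoped Classical in t.1.sum fun y a => if y < x then a else 0

theorem weightBelow_simplex {k : ℕ} (c : Fin (k + 1) ↪o Interval X g)
    (w : stdSimplex ℝ (Fin (k + 1))) (i : Fin (k + 1)) :
    weightBelow (OrderComplex.simplex c w) (c i) = partialSum w.1 i.castSucc := by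
  classical
  unfold weightBelow OrderComplex.simplex partialSum
  rw [Finsupp.sum_embDomain, Finsupp.sum_fintype _ _ (fun _ => by simp)]
  refine Finset.sum_congr rfl fun l _ => ?_
  simp [OrderEmbedding.lt_iff_lt]

theorem exists_partialSum {k : ℕ} (w : stdSimplex ℝ (Fin (k + 1))) (r : I) (hr : r < 1) :
    ∃ i : Fin (k + 1), partialSum w.1 i.castSucc ≤ r ∧ (r : ℝ) < partialSum w.1 i.succ := by
  by_contra! h
  have h1 : ∀ i : Fin (k + 2), partialSum w.1 i ≤ r := by
    intro i
    induction i using Fin.induction with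
    | zero => rw [partialSum_zero]; exact r.2.1
    | succ i ih => exact h i ih
  have h2 := h1 (Fin.last _)
  rw [partialSum_last, w.2.2] at h2
  exact absurd (show (r : ℝ) < 1 from hr) (not_lt.2 h2)

/-- Between two successive positions, the product of the entries up to there is the corresponding
element of the chain. -/
theorem upTo_factOfChain {k : ℕ} (c : Fin (k + 1) ↪o Interval X g)
    (w : stdSimplex ℝ (Fin (k + 1))) (r : I) (i : Fin (k + 1))
    (h1 : partialSum w.1 i.castSucc ≤ r) (h2 : (r : ℝ) < partialSum w.1 i.succ) :
    upTo (factOfChain c).1 (positionsHomeo k w).1 r = (c i).1 := by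
  have h := prod_ofFn_initial (factOfChain c).1 (extendChain c) (fun i => rfl)
    (fun l => (positionsHomeo k w).1 l ≤ r) i.castSucc.succ (fun l => by
      rw [Fin.succ_castSucc, Fin.castSucc_lt_castSucc_iff]
      constructor
      · intro h3
        by_contra h4
        have h5 : (positionsHomeo k w).1 i.succ ≤ (positionsHomeo k w).1 l :=
          (positionsHomeo k w).2.1 (not_lt.1 h4)
        exact absurd h2 (not_lt.2 (h5.trans h3))
      · intro h3
        have h4 : l ≤ i.castSucc := by
          rw [Fin.le_def]
          rw [Fin.lt_def] at h3
          simp only [Fin.val_succ, Fin.val_castSucc] at h3 ⊢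
          omega
        have h5 : (positionsHomeo k w).1 l ≤ (positionsHomeo k w).1 i.castSucc :=
          (positionsHomeo k w).2.1 h4
        exact h5.trans h1)
  rw [extendChain_zero, extendChain_mid, inv_one, one_mul] at h
  unfold upTo
  rw [← h]

theorem place_eq_of_simplex_eq {k k' : ℕ} {c : Fin (k + 1) ↪o Interval X g}
    {w : stdSimplex ℝ (Fin (k + 1))} {c' : Fin (k' + 1) ↪o Interval X g}
    {w' : stdSimplex ℝ (Fin (k' + 1))}
    (h : OrderComplex.simplex c w = OrderComplex.simplex c' w') :
    place (factOfChain c).1 (positionsHomeo k w).1 =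
      place (factOfChain c').1 (positionsHomeo k' w').1 := by
  refine place_eq_of_upTo_eq fun r hr => ?_
  obtain ⟨i, h1, h2⟩ := exists_partialSum w r hr
  have hw : w.1 i ≠ 0 := by
    rw [partialSum_succ] at h2
    intro h0
    rw [h0] at h2
    linarith
  obtain ⟨j, hj⟩ := exists_of_simplex_apply_ne c' w' (x := c i) (by
    rw [← h, simplex_apply_self]
    exact hw)
  have h3 : partialSum w'.1 j.castSucc = partialSum w.1 i.castSucc := by
    rw [← weightBelow_simplex c' w' j, ← weightBelow_simplex c w i, h, hj]
  have h4 : w'.1 j = w.1 i := by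
    rw [← simplex_apply_self c' w' j, ← simplex_apply_self c w i, h, hj]
  rw [upTo_factOfChain c w r i h1 h2, upTo_factOfChain c' w' r j (by rw [h3]; exact h1) (by
    rw [partialSum_succ, h3, h4, ← partialSum_succ]
    exact h2), hj]

theorem simplex_le_of_place_eq {k k' : ℕ} {c : Fin (k + 1) ↪o Interval X g}
    {w : stdSimplex ℝ (Fin (k + 1))} {c' : Fin (k' + 1) ↪o Interval X g}
    {w' : stdSimplex ℝ (Fin (k' + 1))}
    (h : place (factOfChain c).1 (positionsHomeo k w).1 =
      place (factOfChain c').1 (positionsHomeo k' w').1) (x : Interval X g) :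
    (OrderComplex.simplex c w).1 x ≤ (OrderComplex.simplex c' w').1 x := by
  have hU := upTo_eq_of_place_eq (positionsHomeo k w).2.1 (positionsHomeo k' w').2.1 h
  by_cases h0 : (OrderComplex.simplex c w).1 x = 0
  · rw [h0]
    exact (OrderComplex.simplex c' w').2.1 x
  obtain ⟨i, rfl⟩ := exists_of_simplex_apply_ne c w h0
  rw [simplex_apply_self] at h0 ⊢
  have hpos : 0 < w.1 i := lt_of_le_of_ne (w.2.1 i) (Ne.symm h0)
  -- All positions in the half-open interval of `c i` lie in the interval of the same element
  -- for `c'`.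
  have key : ∀ r : ℝ, r ∈ Set.Ico (partialSum w.1 i.castSucc) (partialSum w.1 i.succ) →
      ∃ j, c' j = c i ∧ r ∈ Set.Ico (partialSum w'.1 j.castSucc) (partialSum w'.1 j.succ) := by
    intro r hr
    let r' : I := ⟨r, (partialSum_mem w _).1.trans hr.1, hr.2.le.trans (partialSum_mem w _).2⟩
    have hr' : r' < 1 := hr.2.trans_le (partialSum_mem w _).2
    obtain ⟨j, h1, h2⟩ := exists_partialSum w' r' hr'
    refine ⟨j, Subtype.ext ?_, h1, h2⟩
    rw [← upTo_factOfChain c' w' r' j h1 h2, ← upTo_factOfChain c w r' i hr.1 hr.2, hU]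
  have hlt : partialSum w.1 i.castSucc < partialSum w.1 i.succ := by
    rw [partialSum_succ]
    linarith
  obtain ⟨j, hj, -⟩ := key _ ⟨le_rfl, hlt⟩
  rw [← hj, simplex_apply_self]
  have hsub : Set.Ico (partialSum w.1 i.castSucc) (partialSum w.1 i.succ) ⊆
      Set.Ico (partialSum w'.1 j.castSucc) (partialSum w'.1 j.succ) := by
    intro r hr
    obtain ⟨j', hj', h⟩ := key r hr
    rwa [c'.injective (hj'.trans hj.symm)] at h
  rw [Set.Ico_subset_Ico_iff hlt, partialSum_succ, partialSum_succ] at hsub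
  linarith [hsub.1, hsub.2]

/-- A point of the order complex of `[1, g]` is determined by its weighted factorization of `g`. -/
theorem simplex_eq_of_place_eq {k k' : ℕ} {c : Fin (k + 1) ↪o Interval X g}
    {w : stdSimplex ℝ (Fin (k + 1))} {c' : Fin (k' + 1) ↪o Interval X g}
    {w' : stdSimplex ℝ (Fin (k' + 1))}
    (h : place (factOfChain c).1 (positionsHomeo k w).1 =
      place (factOfChain c').1 (positionsHomeo k' w').1) :
    OrderComplex.simplex c w = OrderComplex.simplex c' w' :=
  Subtype.ext (Finsupp.ext fun x =>
    le_antisymm (simplex_le_of_place_eq h x) (simplex_le_of_place_eq h.symm x))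

theorem factOfChain_inner {k : ℕ} (c : Fin (k + 1) ↪o Interval X g) (i : Fin k) :
    (factOfChain c).1 i.castSucc.succ = (c i.castSucc).1⁻¹ * (c i.succ).1 := by
  change (extendChain c _)⁻¹ * extendChain c _ = _
  rw [← Fin.succ_castSucc, extendChain_mid, Fin.succ_castSucc, extendChain_mid]

/-- Gluing the faces of the order complex changes a factorization at the end points only. -/
theorem place_eq_of_inner_eq {k : ℕ} {x y : Fin (k + 1) ↪o Interval X g}
    (hxy : ∀ i : Fin k, (x i.castSucc).1⁻¹ * (x i.succ).1 = (y i.castSucc).1⁻¹ * (y i.succ).1)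
    (s : Positions k) {r : I} (h0 : r ≠ 0) (h1 : r ≠ 1) :
    place (factOfChain x).1 s.1 r = place (factOfChain y).1 s.1 r := by
  unfold place
  congr 2
  funext i
  by_cases h : s.1 i = r
  · rw [if_pos h, if_pos h]
    induction i using Fin.cases with
    | zero => exact absurd (h.symm.trans s.2.2.1) h0
    | succ i =>
      induction i using Fin.lastCases with
      | last => exact absurd (h.symm.trans s.2.2.2) h1
      | cast i => rw [factOfChain_inner, factOfChain_inner, hxy]
  · rw [if_neg h, if_neg h]

theorem map_ofFn_getElem {A M : Type*} (L : List A) {n : ℕ} (hn : L.length = n) (f : A → M) :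
    List.ofFn (fun i : Fin n => f (L[i.1]'(by omega))) = L.map f := by
  subst hn
  refine List.ext_getElem (by simp) fun m h1 h2 => ?_
  rw [List.getElem_ofFn, List.getElem_map]

/-- Two factorizations of `g` with the same inner values lie in two cells with the same inner
entries, at the same positions. -/
theorem exists_common_positions {u v : I → G} (hu : IsWeightedFact X g u)
    (hv : IsWeightedFact X g v) (huv : ∀ r, r ≠ 0 → r ≠ 1 → u r = v r) :
    ∃ (k : ℕ) (c c' : Fin (k + 1) ↪o Interval X g) (s : Positions k),
      (∀ i : Fin k, (c i.castSucc).1⁻¹ * (c i.succ).1 =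
        (c' i.castSucc).1⁻¹ * (c' i.succ).1) ∧
      place (factOfChain c).1 s.1 = u ∧ place (factOfChain c').1 s.1 = v := by
  classical
  obtain ⟨F₀, hF₀⟩ := hu.exists_finset
  let F := F₀.filter fun r => r ≠ 0 ∧ r ≠ 1 ∧ u r ≠ 1
  have hF : ∀ r, r ≠ 0 → r ≠ 1 → r ∉ F → u r = 1 := by
    intro r h0 h1 hr
    by_contra h
    exact hr (Finset.mem_filter.2 ⟨by_contra fun h' => h (hF₀ r h'), h0, h1, h⟩)
  let L : List I := 0 :: (innerList F ++ [1])
  let k := (innerList F).length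
  have hL : L.length = k + 2 := by simp [L, k]
  have hsort : L.Pairwise (· < ·) := pairwise_cons_inner F
  let s : Fin (k + 2) → I := fun i => L[i.1]'(by omega)
  have hs : StrictMono s := fun i j hij => List.pairwise_iff_getElem.1 hsort _ _ _ _ hij
  have hs0 : s 0 = 0 := rfl
  have hs1 : s (Fin.last (k + 1)) = 1 := by
    simp [s, L, k]
  have build : ∀ {u : I → G}, IsWeightedFact X g u →
      (∀ r, r ≠ 0 → r ≠ 1 → r ∉ F → u r = 1) → (∀ r ∈ F, u r ≠ 1) →
      ∃ y : LinearFact X g k, y.1 = u ∘ s ∧ place y.1 s = u := by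
    intro u hu hF hF'
    have hout := eq_one_of_notMem_cons_inner (u := u) hF
    obtain ⟨h1, h2⟩ := hu.of_list hsort hout
    refine ⟨⟨u ∘ s, fun i => hu.1 _, fun i hi0 hi1 => hF' _ ?_, ?_, ?_⟩, rfl, ?_⟩
    · have h3 : s i ∈ L := List.getElem_mem _
      simp only [L, List.mem_cons, List.mem_append, List.not_mem_nil, or_false] at h3
      rcases h3 with h3 | h3 | h3
      · exact absurd (hs.injective (h3.trans hs0.symm)) hi0
      · exact (mem_innerList.1 h3).1
      · exact absurd (hs.injective (h3.trans hs1.symm)) hi1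
    · rw [← h2]
      exact congrArg List.sum (map_ofFn_getElem L hL fun r => len X (u r))
    · rw [← h1]
      exact congrArg List.prod (map_ofFn_getElem L hL u)
    · funext r
      have h3 := map_ofFn_getElem L hL fun q => if q = r then u q else 1
      refine (congrArg List.prod h3).trans ?_
      rw [prod_map_eq_of_sorted (R' := [r]) _ hsort (List.pairwise_singleton _ _)]
      · simp
      · intro q hq
        rw [hout q hq]
        simp
      · intro q hq
        rw [if_neg (by simpa using hq)]
  have hF' : ∀ r ∈ F, r ≠ 0 ∧ r ≠ 1 ∧ u r ≠ 1 := fun r hr => (Finset.mem_filter.1 hr).2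
  obtain ⟨y, hy, hyu⟩ := build hu hF fun r hr => (hF' r hr).2.2
  obtain ⟨y', hy', hyv⟩ := build hv (fun r h0 h1 hr => (huv r h0 h1) ▸ hF r h0 h1 hr)
    (fun r hr => huv r (hF' r hr).1 (hF' r hr).2.1 ▸ (hF' r hr).2.2)
  obtain ⟨c, rfl⟩ := exists_factOfChain y
  obtain ⟨c', rfl⟩ := exists_factOfChain y'
  refine ⟨k, c, c', ⟨s, hs.monotone, hs0, hs1⟩, fun i => ?_, hyu, hyv⟩
  rw [← factOfChain_inner, ← factOfChain_inner, hy, hy']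
  have h0 : s i.castSucc.succ ≠ s 0 := hs.injective.ne (Fin.succ_ne_zero _)
  have h1 : s i.castSucc.succ ≠ s (Fin.last _) := hs.injective.ne (by
    rw [Fin.succ_castSucc]
    exact (Fin.castSucc_lt_last _).ne)
  rw [hs0] at h0
  rw [hs1] at h1
  exact huv _ h0 h1

/-- The maximal element of `F(G, g, S)` that is represented by a factorization of `g`. -/
noncomputable def maxOfWFact (hg : g ∈ Submonoid.closure X) (u : WFact X g) :
    {a : CircFactPoset X g // IsMax a} :=
  ⟨CircFactPoset.mk ⟨⟨g, AbsLE.refl hg⟩, u⟩, (isMax_mk_iff _).2 rfl⟩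

theorem maxOfWFact_eq_iff (hg : g ∈ Submonoid.closure X) (u v : WFact X g) :
    maxOfWFact hg u = maxOfWFact hg v ↔ ∀ r, r ≠ 0 → r ≠ 1 → u.1 r = v.1 r := by
  rw [Subtype.ext_iff]
  refine (Quotient.eq (r := circularSetoid X g)).trans ⟨fun h => h.1, fun h => ⟨h, ?_⟩⟩
  -- The values at the end points satisfy `u 0 * m * u 1 = g` for the same inner product `m`.
  obtain ⟨F, hF⟩ := u.2.exists_finset
  have h1 := (u.2.inner (F := F) fun r _ _ hr => hF r hr).1
  have h2 := (v.2.inner (F := F) fun r h0 h1 hr => (h r h0 h1) ▸ hF r hr).1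
  rw [← map_congr_inner h] at h2
  change g * u.1 1 * g⁻¹ * u.1 0 = g * v.1 1 * g⁻¹ * v.1 0
  have key : ∀ a m b : G, a * m * b = g → g * b * g⁻¹ * a = g * m⁻¹ := by
    rintro a m b rfl
    group
  rw [key _ _ _ h1, key _ _ _ h2]

theorem exists_maxOfWFact (hg : g ∈ Submonoid.closure X)
    (a : {a : CircFactPoset X g // IsMax a}) : ∃ u, maxOfWFact hg u = a := by
  obtain ⟨a, ha⟩ := a
  obtain ⟨u, rfl⟩ := Quotient.exists_rep a
  have h : u.1.1 = g := (isMax_mk_iff u).1 ha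
  obtain ⟨⟨g', hg'⟩, u⟩ := u
  obtain rfl : g' = g := h
  exact ⟨u, rfl⟩

theorem isOpen_max_iff (hg : g ∈ Submonoid.closure X)
    (V : Set {a : CircFactPoset X g // IsMax a}) :
    IsOpen V ↔ ∀ (k : ℕ) (x : LinearFact X g k),
      IsOpen ((fun s => maxOfWFact hg (WFact.cell x s)) ⁻¹' V) := by
  have h1 : IsOpen (maxOfWFact hg ⁻¹' V) ↔ ∀ (k : ℕ) (x : LinearFact X g k),
      IsOpen ((fun s => maxOfWFact hg (WFact.cell x s)) ⁻¹' V) := by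
    refine isOpen_iSup_iff.trans (forall_congr' fun k => ?_)
    exact isOpen_iSup_iff
  rw [← h1]
  constructor
  · intro h
    refine h.preimage (Continuous.subtype_mk ?_ _)
    have h2 : Continuous (Sigma.mk (β := fun h : Interval X g => WFact X h.1)
      ⟨g, AbsLE.refl hg⟩) := continuous_sigmaMk
    exact continuous_quot_mk.comp h2
  · intro h
    refine ⟨Subtype.val '' V, ?_, Set.preimage_image_eq _ Subtype.val_injective⟩
    have h2 : IsOpen ((Quotient.mk (circularSetoid X g)) ⁻¹' (Subtype.val '' V)) := by
      refine isOpen_sigma_iff.2 fun p => ?_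
      obtain ⟨g', hg'⟩ := p
      by_cases hp : g' = g
      · subst hp
        convert h using 1
        ext u
        constructor
        · rintro ⟨a, ha, hau⟩
          have : maxOfWFact hg u = a := Subtype.ext hau.symm
          change maxOfWFact hg u ∈ V
          rwa [this]
        · intro hu
          exact ⟨_, hu, rfl⟩
      · convert isOpen_empty
        rw [Set.eq_empty_iff_forall_notMem]
        rintro u ⟨a, -, hau⟩
        have ha := a.2
        rw [hau] at ha
        exact hp ((isMax_mk_iff _).1 ha)
    exact h2

/-- The maximal element of `F(G, g, S)` that belongs to a point of the order complex. -/
noncomputable def maxOfOrderComplex (hg : g ∈ Submonoid.closure X)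
    (t : OrderComplex (Interval X g)) : {a : CircFactPoset X g // IsMax a} :=
  maxOfWFact hg (WFact.cell (factOfChain (orderComplex_exists_simplex t).choose_spec.choose)
    (positionsHomeo _ (orderComplex_exists_simplex t).choose_spec.choose_spec.choose))

theorem maxOfOrderComplex_simplex (hg : g ∈ Submonoid.closure X) {k : ℕ}
    (c : Fin (k + 1) ↪o Interval X g) (w : stdSimplex ℝ (Fin (k + 1))) :
    maxOfOrderComplex hg (OrderComplex.simplex c w) =
      maxOfWFact hg (WFact.cell (factOfChain c) (positionsHomeo k w)) :=
  congrArg (maxOfWFact hg) (Subtype.ext (place_eq_of_simplex_eq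
    (orderComplex_exists_simplex (OrderComplex.simplex c w)).choose_spec.choose_spec.choose_spec))

/-- The bijection from the interval complex to the set of maximal elements of `F(G, g, S)`. -/
noncomputable def maxOfIntervalComplex (hg : g ∈ Submonoid.closure X) :
    IntervalComplex X g → {a : CircFactPoset X g // IsMax a} :=
  Quot.lift (maxOfOrderComplex hg) (by
    rintro _ _ ⟨x, y, hxy, w⟩
    rw [maxOfOrderComplex_simplex, maxOfOrderComplex_simplex, maxOfWFact_eq_iff]
    exact fun r h0 h1 => place_eq_of_inner_eq hxy _ h0 h1)

theorem maxOfIntervalComplex_bijective (hg : g ∈ Submonoid.closure X) :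
    Function.Bijective (maxOfIntervalComplex hg) := by
  constructor
  · rintro ⟨t⟩ ⟨t'⟩ h
    obtain ⟨k, c, w, rfl⟩ := orderComplex_exists_simplex t
    obtain ⟨k', c', w', rfl⟩ := orderComplex_exists_simplex t'
    change maxOfOrderComplex hg _ = maxOfOrderComplex hg _ at h
    rw [maxOfOrderComplex_simplex, maxOfOrderComplex_simplex, maxOfWFact_eq_iff] at h
    obtain ⟨m, e, e', s, hee, h1, h2⟩ := exists_common_positions
      (WFact.cell (factOfChain c) (positionsHomeo k w)).2
      (WFact.cell (factOfChain c') (positionsHomeo k' w')).2 h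
    obtain ⟨v, rfl⟩ := (positionsHomeo m).surjective s
    have h3 : OrderComplex.simplex e v = OrderComplex.simplex c w := simplex_eq_of_place_eq h1
    have h4 : OrderComplex.simplex e' v = OrderComplex.simplex c' w' := simplex_eq_of_place_eq h2
    rw [← h3, ← h4]
    exact Quot.sound (FaceGluing.glue e e' hee v)
  · intro a
    obtain ⟨u, rfl⟩ := exists_maxOfWFact hg a
    obtain ⟨m, e, -, s, -, h1, -⟩ := exists_common_positions u.2 u.2 fun _ _ _ => rfl
    obtain ⟨v, rfl⟩ := (positionsHomeo m).surjective s
    refine ⟨Quot.mk _ (OrderComplex.simplex e v), ?_⟩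
    change maxOfOrderComplex hg _ = _
    rw [maxOfOrderComplex_simplex]
    exact congrArg _ (Subtype.ext h1)

/-- The maximal elements of `F(G, g, S)` form a space homeomorphic to the interval complex. -/
theorem nonempty_max_homeomorph (hg : g ∈ Submonoid.closure X) :
    Nonempty ({a : CircFactPoset X g // IsMax a} ≃ₜ IntervalComplex X g) := by
  refine ⟨((Equiv.ofBijective _ (maxOfIntervalComplex_bijective hg)).toHomeomorph
    fun V => ?_).symm⟩
  rw [isOpen_max_iff hg]
  refine isOpen_coinduced.trans (isOpen_orderComplex_iff.trans (forall_congr' fun k => ?_))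
  have h : ∀ c : Fin (k + 1) ↪o Interval X g,
      IsOpen (OrderComplex.simplex c ⁻¹' (Quot.mk (FaceGluing X g) ⁻¹'
        (maxOfIntervalComplex hg ⁻¹' V))) ↔
      IsOpen ((fun s => maxOfWFact hg (WFact.cell (factOfChain c) s)) ⁻¹' V) := by
    intro c
    rw [← (positionsHomeo k).isOpen_preimage]
    refine iff_of_eq (congrArg IsOpen ?_)
    ext w
    exact iff_of_eq (congrArg (· ∈ V) (maxOfOrderComplex_simplex hg c w))
  refine (forall_congr' h).trans ⟨fun h1 x => ?_, fun h1 c => h1 _⟩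
  obtain ⟨c, rfl⟩ := exists_factOfChain x
  exact h1 c

end MarkedGroup

/-! ### Cycles and transpositions -/

namespace Equiv.Perm

section Cycles

variable {α : Type*}

/-- The cycles of `f` are contained in the classes of every equivalence relation that relates each
point to its image. -/
theorem SameCycle.rel [Finite α] {f : Perm α} (r : Setoid α) (h : ∀ a, r a (f a)) {a b : α}
    (hab : SameCycle f a b) : r a b := by
  obtain ⟨n, rfl⟩ := hab.exists_nat_pow_eq
  induction n with
  | zero => exact r.refl a
  | succ n ih =>
    rw [pow_succ', mul_apply]
    exact r.trans (ih ⟨n, by simp⟩) (h _)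

theorem SameCycle.mem_of_mapsTo [Finite α] {f : Perm α} {A : Set α} (h : ∀ a ∈ A, f a ∈ A) {a b : α}
    (hab : SameCycle f a b) (ha : a ∈ A) : b ∈ A := by
  obtain ⟨n, rfl⟩ := hab.exists_nat_pow_eq
  induction n with
  | zero => exact ha
  | succ n ih =>
    rw [pow_succ', mul_apply]
    exact h _ (ih ⟨n, by simp⟩)

/-- The number of cycles of a permutation, fixed points included. -/
noncomputable def numCycles (x : Perm α) : ℕ := Nat.card (Quotient (SameCycle.setoid x))

theorem numCycles_one : numCycles (1 : Perm α) = Nat.card α := by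
  refine Nat.card_congr
    (Equiv.ofBijective (Quotient.mk (SameCycle.setoid (1 : Perm α))) ⟨?_, ?_⟩).symm
  · intro a b hab
    have : SameCycle (1 : Perm α) a b := Quotient.exact hab
    simpa using this
  · exact Quotient.mk_surjective

variable [Finite α] [DecidableEq α]

/-- Multiplication by a transposition of two points of a cycle splits this cycle. -/
theorem not_sameCycle_swap_mul {x : Perm α} {i j : α} (hne : i ≠ j) (h : SameCycle x i j) :
    ¬ SameCycle (swap i j * x) i j := by
  classical
  have hex : ∃ n, (x ^ n) i = j := h.exists_nat_pow_eq
  let n := Nat.find hex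
  have hn : (x ^ n) i = j := Nat.find_spec hex
  have hmin : ∀ m < n, (x ^ m) i ≠ j := fun m hm => Nat.find_min hex hm
  have hn0 : n ≠ 0 := by
    intro h0
    rw [h0] at hn
    exact hne hn
  -- The points before `j` on the way from `i` to `j` form an invariant set.
  let A : Set α := {a | ∃ m < n, (x ^ m) i = a}
  have hA : ∀ a ∈ A, (swap i j * x) a ∈ A := by
    rintro _ ⟨m, hm, rfl⟩
    rw [mul_apply, ← mul_apply x, ← pow_succ']
    rcases eq_or_lt_of_le (Nat.succ_le_of_lt hm) with h1 | h1
    · rw [show m + 1 = n from h1, hn, swap_apply_right]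
      exact ⟨0, Nat.pos_of_ne_zero hn0, rfl⟩
    · have h2 : (x ^ (m + 1)) i ≠ i := by
        intro h3
        refine hmin (n - (m + 1)) (by omega) ?_
        rw [← hn]
        conv_lhs => rw [← h3]
        rw [← mul_apply, ← pow_add]
        congr 2
        omega
      rw [swap_apply_of_ne_of_ne h2 (hmin _ h1)]
      exact ⟨m + 1, h1, rfl⟩
  intro h1
  obtain ⟨m, hm, hmj⟩ := h1.mem_of_mapsTo hA ⟨0, Nat.pos_of_ne_zero hn0, rfl⟩
  exact hmin m hm hmj

theorem sameCycle_swap_mul_self {y : Perm α} {i j : α} (h : ¬ SameCycle y i j) :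
    SameCycle (swap i j * y) i j := by
  classical
  have hex : ∃ n, (y ^ (n + 1)) i = i := by
    have := Fintype.ofFinite α
    refine ⟨orderOf y - 1, ?_⟩
    rw [Nat.sub_add_cancel (orderOf_pos y), pow_orderOf_eq_one, one_apply]
  let n := Nat.find hex
  have hn : (y ^ (n + 1)) i = i := Nat.find_spec hex
  have key : ∀ m ≤ n, ((swap i j * y) ^ m) i = (y ^ m) i := by
    intro m hm
    induction m with
    | zero => rfl
    | succ m ih =>
      rw [pow_succ', mul_apply, ih (by omega), mul_apply, ← mul_apply y, ← pow_succ']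
      exact swap_apply_of_ne_of_ne (Nat.find_min hex (m := m) (by omega))
        fun h1 => h ⟨((m + 1 : ℕ) : ℤ), by rw [zpow_natCast]; exact h1⟩
  refine ⟨n + 1, ?_⟩
  rw [show ((n : ℤ) + 1) = ((n + 1 : ℕ) : ℤ) by push_cast; rfl, zpow_natCast, pow_succ', mul_apply,
    key n le_rfl, mul_apply, ← mul_apply y, ← pow_succ', hn, swap_apply_left]

/-- Multiplication by a transposition of points of different cycles merges these cycles. -/
theorem sameCycle_swap_mul_iff {y : Perm α} {i j : α} (h : ¬ SameCycle y i j) {a b : α} :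
    SameCycle (swap i j * y) a b ↔ SameCycle y a b ∨
      ((SameCycle y i a ∨ SameCycle y j a) ∧ (SameCycle y i b ∨ SameCycle y j b)) := by
  constructor
  · let r : Setoid α :=
      { r := fun a b => SameCycle y a b ∨
          ((SameCycle y i a ∨ SameCycle y j a) ∧ (SameCycle y i b ∨ SameCycle y j b))
        iseqv := by
          refine ⟨fun a => Or.inl (SameCycle.refl _ _), ?_, ?_⟩
          · rintro a b (h1 | ⟨h1, h2⟩)
            exacts [Or.inl h1.symm, Or.inr ⟨h2, h1⟩]
          · rintro a b c (h1 | ⟨h1, h2⟩) (h3 | ⟨h3, h4⟩)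
            · exact Or.inl (h1.trans h3)
            · exact Or.inr ⟨h3.imp (·.trans h1.symm) (·.trans h1.symm), h4⟩
            · exact Or.inr ⟨h1, h2.imp (·.trans h3) (·.trans h3)⟩
            · exact Or.inr ⟨h1, h4⟩ }
    refine SameCycle.rel r fun a => ?_
    rw [mul_apply]
    have ha : SameCycle y a (y a) := ⟨1, by simp⟩
    by_cases h1 : y a = i
    · rw [h1, swap_apply_left]
      rw [h1] at ha
      exact Or.inr ⟨Or.inl ha.symm, Or.inr (SameCycle.refl _ _)⟩
    · by_cases h2 : y a = j
      · rw [h2, swap_apply_right]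
        rw [h2] at ha
        exact Or.inr ⟨Or.inr ha.symm, Or.inl (SameCycle.refl _ _)⟩
      · rw [swap_apply_of_ne_of_ne h1 h2]
        exact Or.inl ha
  · have hij := sameCycle_swap_mul_self h
    have key : ∀ {a b}, SameCycle y a b → SameCycle (swap i j * y) a b := by
      refine fun hab => SameCycle.rel (SameCycle.setoid (swap i j * y)) (fun a => ?_) hab
      change SameCycle (swap i j * y) a (y a)
      have ha : SameCycle (swap i j * y) a ((swap i j * y) a) := ⟨1, by simp⟩
      rw [mul_apply] at ha
      by_cases h1 : y a = i
      · rw [h1, swap_apply_left] at ha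
        rw [h1]
        exact ha.trans hij.symm
      · by_cases h2 : y a = j
        · rw [h2, swap_apply_right] at ha
          rw [h2]
          exact ha.trans hij
        · rwa [swap_apply_of_ne_of_ne h1 h2] at ha
    rintro (h1 | ⟨h1, h2⟩)
    · exact key h1
    · have h3 : ∀ {a}, SameCycle y i a ∨ SameCycle y j a → SameCycle (swap i j * y) i a :=
        fun h => h.elim key fun h => hij.trans (key h)
      exact (h3 h1).symm.trans (h3 h2)

theorem numCycles_swap_mul {y : Perm α} {i j : α} (h : ¬ SameCycle y i j) :
    numCycles (swap i j * y) + 1 = numCycles y := by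
  classical
  have hfin := Fintype.ofFinite α
  let q : Quotient (SameCycle.setoid y) → Quotient (SameCycle.setoid (swap i j * y)) :=
    Quotient.map' id fun a b hab => (sameCycle_swap_mul_iff h).2 (Or.inl hab)
  let j' : Quotient (SameCycle.setoid y) := Quotient.mk _ j
  -- The quotient map is a bijection away from the cycle of `j`.
  have hbij : Function.Bijective fun c : {c // c ≠ j'} => q c.1 := by
    constructor
    · rintro ⟨⟨a⟩, ha⟩ ⟨⟨b⟩, hb⟩ hab
      have ha' : ¬ SameCycle y j a := fun h0 => ha (Quotient.sound h0.symm)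
      have hb' : ¬ SameCycle y j b := fun h0 => hb (Quotient.sound h0.symm)
      have hab' : SameCycle (swap i j * y) a b := Quotient.exact hab
      refine Subtype.ext (Quotient.sound ?_)
      rcases (sameCycle_swap_mul_iff h).1 hab' with h1 | ⟨h1, h2⟩
      · exact h1
      · exact (h1.resolve_right ha').symm.trans (h2.resolve_right hb')
    · rintro ⟨a⟩
      by_cases ha : SameCycle y j a
      · refine ⟨⟨Quotient.mk _ i, fun h0 => h (Quotient.exact h0)⟩, Quotient.sound ?_⟩
        exact (sameCycle_swap_mul_iff h).2 (Or.inr ⟨Or.inl (SameCycle.refl _ _), Or.inr ha⟩)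
      · exact ⟨⟨Quotient.mk _ a, fun h0 => ha (Quotient.exact h0).symm⟩, rfl⟩
  unfold numCycles
  rw [← Nat.card_congr (Equiv.ofBijective _ hbij), Nat.card_eq_fintype_card,
    Nat.card_eq_fintype_card, Fintype.card_subtype_compl, Fintype.card_subtype_eq]
  have : 0 < Fintype.card (Quotient (SameCycle.setoid y)) := Fintype.card_pos_iff.2 ⟨j'⟩
  omega

theorem numCycles_swap_mul_of_sameCycle {x : Perm α} {i j : α} (hne : i ≠ j)
    (h : SameCycle x i j) : numCycles (swap i j * x) = numCycles x + 1 := by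
  have := numCycles_swap_mul (not_sameCycle_swap_mul hne h)
  rw [← mul_assoc, swap_mul_self, one_mul] at this
  exact this.symm

end Cycles

end Equiv.Perm

/-! ### The absolute order on the symmetric group -/

open Equiv Equiv.Perm MarkedGroup in
theorem mem_closure_transpositions {d : ℕ} (x : Perm (Fin d)) :
    x ∈ Submonoid.closure (transpositions d) := by
  have h : Submonoid.closure (transpositions d) = ⊤ := mclosure_isSwap
  rw [h]
  exact Submonoid.mem_top x

namespace MarkedGroup

open Equiv Equiv.Perm

variable {d : ℕ}

theorem transpositions_conj (a x : Perm (Fin d)) (hx : x ∈ transpositions d) :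
    a * x * a⁻¹ ∈ transpositions d := by
  obtain ⟨i, j, hij, rfl⟩ := hx
  exact ⟨a i, a j, a.injective.ne hij, by rw [Equiv.swap_apply_apply]⟩

theorem swap_mem_transpositions {i j : Fin d} (h : i ≠ j) : swap i j ∈ transpositions d :=
  ⟨i, j, h, rfl⟩

/-- The absolute length of a permutation is the number of points minus the number of cycles. -/
theorem len_add_numCycles (x : Perm (Fin d)) : len (transpositions d) x + numCycles x = d := by
  apply le_antisymm
  · have key : ∀ n, ∀ x : Perm (Fin d), numCycles x + n = d →
        ∃ l : List (Perm (Fin d)), l.length = n ∧ (∀ t ∈ l, t ∈ transpositions d) ∧ l.prod = x := by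
      intro n
      induction n with
      | zero =>
        intro x hx
        refine ⟨[], rfl, by simp, ?_⟩
        by_contra h
        obtain ⟨i, hi⟩ : ∃ i, x i ≠ i := by
          by_contra! h0
          exact h (Equiv.ext fun i => (h0 i).symm)
        have h1 := numCycles_swap_mul_of_sameCycle hi.symm (⟨1, by simp⟩ : SameCycle x i (x i))
        have h2 : numCycles (swap i (x i) * x) ≤ Nat.card (Fin d) :=
          Nat.card_le_card_of_surjective _ Quotient.mk_surjective
        rw [Nat.card_eq_fintype_card, Fintype.card_fin] at h2
        omega
      | succ n ih =>
        intro x hx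
        obtain ⟨i, hi⟩ : ∃ i, x i ≠ i := by
          by_contra! h0
          have h1 : x = 1 := Equiv.ext h0
          rw [h1, numCycles_one, Nat.card_eq_fintype_card, Fintype.card_fin] at hx
          omega
        have h1 := numCycles_swap_mul_of_sameCycle hi.symm (⟨1, by simp⟩ : SameCycle x i (x i))
        obtain ⟨l, h2, h3, h4⟩ := ih (swap i (x i) * x) (by omega)
        refine ⟨swap i (x i) :: l, by simp [h2], ?_, ?_⟩
        · intro t ht
          rcases List.mem_cons.1 ht with rfl | ht
          exacts [swap_mem_transpositions hi.symm, h3 t ht]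
        · rw [List.prod_cons, h4, ← mul_assoc, swap_mul_self, one_mul]
    have h2 : numCycles x ≤ Nat.card (Fin d) :=
      Nat.card_le_card_of_surjective _ Quotient.mk_surjective
    rw [Nat.card_eq_fintype_card, Fintype.card_fin] at h2
    obtain ⟨l, h3, h4, rfl⟩ := key (d - numCycles x) x (by omega)
    have := len_le h4
    omega
  · obtain ⟨l, h1, h2, rfl⟩ := exists_word (mem_closure_transpositions x)
    rw [← h1]
    clear h1
    induction l with
    | nil => simp [numCycles_one]
    | cons t l ih =>
      have ih := ih fun t ht => h2 t (List.mem_cons_of_mem _ ht)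
      obtain ⟨i, j, hij, rfl⟩ := h2 t List.mem_cons_self
      rw [List.prod_cons, List.length_cons]
      by_cases h : SameCycle l.prod i j
      · have := numCycles_swap_mul_of_sameCycle hij h
        omega
      · have := numCycles_swap_mul h
        omega

theorem len_swap {i j : Fin d} (h : i ≠ j) : len (transpositions d) (swap i j) = 1 := by
  have h1 := len_add_numCycles (swap i j)
  have h2 := numCycles_swap_mul (y := (1 : Perm (Fin d))) (i := i) (j := j) (by simpa using h)
  rw [mul_one, numCycles_one, Nat.card_eq_fintype_card, Fintype.card_fin] at h2
  omega

theorem absLE_iff {x y : Perm (Fin d)} : AbsLE (transpositions d) x y ↔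
    len (transpositions d) x + len (transpositions d) (x⁻¹ * y) = len (transpositions d) y :=
  ⟨fun h => h.2.2, fun h => ⟨mem_closure_transpositions _, mem_closure_transpositions _, h⟩⟩

theorem swap_le_iff {x : Perm (Fin d)} {i j : Fin d} (h : i ≠ j) :
    AbsLE (transpositions d) (swap i j) x ↔ SameCycle x i j := by
  rw [absLE_iff, len_swap h, swap_inv]
  have h1 := len_add_numCycles x
  have h2 := len_add_numCycles (swap i j * x)
  by_cases h3 : SameCycle x i j
  · have := numCycles_swap_mul_of_sameCycle h h3
    exact iff_of_true (by omega) h3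
  · have := numCycles_swap_mul h3
    exact iff_of_false (by omega) h3

theorem swap_mul_le {x c : Perm (Fin d)} {i j : Fin d} (h : i ≠ j) (hx : SameCycle x i j)
    (hxc : AbsLE (transpositions d) x c) :
    AbsLE (transpositions d) (swap i j * x) (swap i j * c) := by
  have h1 := (swap_le_iff h).2 hx
  have := AbsLE.inv_mul_le h1 (h1.trans hxc) hxc
  rwa [swap_inv] at this

/-- If `x ≤ c`, then each cycle of `x` is contained in a cycle of `c`. -/
theorem AbsLE.sameCycle {x c : Perm (Fin d)} (hxc : AbsLE (transpositions d) x c) {a b : Fin d}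
    (hab : SameCycle x a b) : SameCycle c a b := by
  rcases eq_or_ne a b with rfl | h
  · exact SameCycle.refl _ _
  · exact (swap_le_iff h).1 (((swap_le_iff h).2 hab).trans hxc)

/-- Below a common upper bound, the absolute order is the refinement order of the cycles. -/
theorem absLE_of_sameCycle {x y c : Perm (Fin d)} (hxc : AbsLE (transpositions d) x c)
    (hyc : AbsLE (transpositions d) y c) (h : ∀ a b, SameCycle x a b → SameCycle y a b) :
    AbsLE (transpositions d) x y := by
  induction hn : len (transpositions d) x generalizing x y c with
  | zero =>
    rw [eq_one_of_len (mem_closure_transpositions x) hn]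
    exact one_le_of_mem (mem_closure_transpositions y)
  | succ n ih =>
    obtain ⟨i, hi⟩ : ∃ i, i ≠ x i := by
      by_contra! h0
      have h1 : x = 1 := Equiv.ext fun i => (h0 i).symm
      rw [h1, len_one] at hn
      omega
    have hx : SameCycle x i (x i) := ⟨1, by simp⟩
    generalize x i = j at hi hx
    have hy := h _ _ hx
    have hx1 := (swap_le_iff hi).2 hx
    have hy1 := (swap_le_iff hi).2 hy
    have hc := hyc.sameCycle hy
    have hxc' := swap_mul_le hi hx hxc
    have hyc' := swap_mul_le hi hy hyc
    have hlx := hx1.2.2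
    have hly := hy1.2.2
    rw [swap_inv, len_swap hi] at hlx hly
    have h1 := ih hxc' hyc' (fun a b hab => by
      by_contra h2
      have h3 : SameCycle x a b := by
        have := (sameCycle_swap_mul_iff (not_sameCycle_swap_mul hi hx)).2 (Or.inl hab)
        rwa [← mul_assoc, swap_mul_self, one_mul] at this
      have h4 := h _ _ h3
      have h5 := (sameCycle_swap_mul_iff (not_sameCycle_swap_mul hi hy) (a := a) (b := b)).1
        (by rwa [← mul_assoc, swap_mul_self, one_mul])
      -- Otherwise the cycle of `x` through `a` and `b` would join `i` and `j` in `swap i j * c`.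
      have h6 := hxc'.sameCycle hab
      refine not_sameCycle_swap_mul hi hc ?_
      rcases h5.resolve_left h2 with ⟨ha | ha, hb | hb⟩
      · exact absurd (ha.symm.trans hb) h2
      · exact ((hyc'.sameCycle ha).trans h6).trans (hyc'.sameCycle hb).symm
      · exact ((hyc'.sameCycle hb).trans h6.symm).trans (hyc'.sameCycle ha).symm
      · exact absurd (ha.symm.trans hb) h2) (by omega)
    rw [absLE_iff] at h1 ⊢
    rw [show (swap i j * x)⁻¹ * (swap i j * y) = x⁻¹ * y by group] at h1
    omega

/-! ### Noncrossing transpositions -/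

theorem swap_mul_finRotate_mem {i i' a : Fin d} (ha : a ∈ Set.Ico i i') :
    (swap i i' * finRotate d) a ∈ Set.Ico i i' := by
  obtain ⟨h1, h2⟩ := ha
  have h3 : a.1 + 1 < d := lt_of_le_of_lt (Nat.succ_le_of_lt h2) i'.2
  have h4 : finRotate d a = ⟨a.1 + 1, h3⟩ := by
    obtain ⟨n, rfl⟩ : ∃ n, d = n + 1 := ⟨d - 1, by omega⟩
    exact finRotate_of_lt (by omega)
  rw [mul_apply, h4]
  rw [Fin.le_def] at h1
  rw [Fin.lt_def] at h2
  rcases eq_or_lt_of_le (Nat.succ_le_of_lt h2) with h5 | h5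
  · have h6 : (⟨a.1 + 1, h3⟩ : Fin d) = i' := Fin.ext h5
    rw [h6, swap_apply_right]
    exact ⟨le_rfl, Fin.lt_def.2 (by omega)⟩
  · rw [swap_apply_of_ne_of_ne]
    · exact ⟨Fin.le_def.2 (by simp; omega), Fin.lt_def.2 h5⟩
    · intro h; rw [Fin.ext_iff] at h; simp at h; omega
    · intro h; rw [Fin.ext_iff] at h; simp at h; omega

theorem sameCycle_finRotate (a b : Fin d) : SameCycle (finRotate d) a b := by
  rcases lt_or_ge d 2 with h | h
  · have : a = b := Fin.ext (by omega)
    rw [this]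
  · obtain ⟨c, hc, hc'⟩ := isCycle_finRotate_of_le h
    have h1 : ∀ a, finRotate d a ≠ a := fun a => by
      rw [← mem_support, support_finRotate_of_le h]
      exact Finset.mem_univ a
    exact (hc' (h1 a)).symm.trans (hc' (h1 b))

theorem swap_le_finRotate {i j : Fin d} (h : i ≠ j) :
    AbsLE (transpositions d) (swap i j) (finRotate d) :=
  (swap_le_iff h).2 (sameCycle_finRotate i j)

/-- If `c` is below the `d`-cycle, then the transposition of `i < i'` splits the cycle of `c`
through `i` and `i'` into its parts inside and outside of the half-open interval from `i` to
`i'`. -/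
theorem sameCycle_swap_mul_iff_side {c : Perm (Fin d)}
    (hc : AbsLE (transpositions d) c (finRotate d)) {i i' : Fin d} (hi : i < i')
    (h : SameCycle c i i') {a b : Fin d} :
    SameCycle (swap i i' * c) a b ↔
      SameCycle c a b ∧ (a ∈ Set.Ico i i' ↔ b ∈ Set.Ico i i') := by
  have hle := swap_mul_le hi.ne h hc
  have hside : ∀ {a b}, SameCycle (swap i i' * c) a b → (a ∈ Set.Ico i i' ↔ b ∈ Set.Ico i i') :=
    fun hab => ⟨(hle.sameCycle hab).mem_of_mapsTo fun _ => swap_mul_finRotate_mem,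
      (hle.sameCycle hab.symm).mem_of_mapsTo fun _ => swap_mul_finRotate_mem⟩
  have hm := sameCycle_swap_mul_iff (not_sameCycle_swap_mul hi.ne h) (a := a) (b := b)
  rw [← mul_assoc, swap_mul_self, one_mul] at hm
  have hi1 : i ∈ Set.Ico i i' := ⟨le_rfl, hi⟩
  have hi2 : i' ∉ Set.Ico i i' := fun h => h.2.false
  constructor
  · exact fun hab => ⟨hm.2 (Or.inl hab), hside hab⟩
  · rintro ⟨h1, h2⟩
    rcases hm.1 h1 with h3 | ⟨h3 | h3, h4 | h4⟩
    · exact h3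
    · exact h3.symm.trans h4
    · exact absurd ((hside h4).2 (h2.1 ((hside h3).1 hi1))) hi2
    · exact absurd ((hside h3).2 (h2.2 ((hside h4).1 hi1))) hi2
    · exact h3.symm.trans h4

/-- The product of two transpositions is below the `d`-cycle if and only if the second
one does not separate the points inside and outside of the interval of the first one. -/
theorem swap_mul_swap_le_iff {p q r s : Fin d} (hpq : p < q) (hrs : r ≠ s) :
    (AbsLE (transpositions d) (swap p q * swap r s) (finRotate d) ∧
      len (transpositions d) (swap p q * swap r s) = 2) ↔
      (r ∈ Set.Ico p q ↔ s ∈ Set.Ico p q) := by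
  have h1 := sameCycle_swap_mul_iff_side (AbsLE.refl (mem_closure_transpositions _)) hpq
    (sameCycle_finRotate p q) (a := r) (b := s)
  rw [← swap_le_iff hrs] at h1
  simp only [sameCycle_finRotate, true_and] at h1
  rw [← h1, absLE_iff, absLE_iff, len_swap hrs, swap_inv,
    show (swap p q * swap r s)⁻¹ * finRotate d = swap r s * (swap p q * finRotate d) by
      rw [mul_inv_rev, swap_inv, swap_inv, mul_assoc]]
  have h2 := (swap_le_finRotate hpq.ne).2.2
  rw [swap_inv, len_swap hpq.ne] at h2
  have h3 := len_mul_le (X := transpositions d) (mem_closure_transpositions (swap p q))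
    (mem_closure_transpositions (swap r s))
  have h4 := len_mul_le (X := transpositions d) (mem_closure_transpositions (swap p q * swap r s))
    (mem_closure_transpositions (swap r s * (swap p q * finRotate d)))
  rw [show swap p q * swap r s * (swap r s * (swap p q * finRotate d)) = finRotate d by
    rw [mul_assoc, ← mul_assoc (swap r s), swap_mul_self, one_mul, ← mul_assoc, swap_mul_self,
      one_mul]] at h4
  rw [len_swap hpq.ne, len_swap hrs] at h3
  constructor
  · rintro ⟨h5, h6⟩
    omega
  · intro h5
    exact ⟨by omega, by omega⟩

end MarkedGroup

/-! ### The band generators of the braid group -/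

section Band

variable {H : Type*} [Group H] {s : ℕ → H} {N : ℕ}

/-- The band generator `a_{i, i + 1 + n}`: the conjugate of `s i` by `s (i + 1) ⋯ s (i + n)`. -/
def band (s : ℕ → H) (i : ℕ) : ℕ → H
  | 0 => s i
  | n + 1 => (s (i + n + 1))⁻¹ * band s i n * s (i + n + 1)

/-- The braid relations for `s 0, …, s (N - 1)`. -/
structure BraidRel (s : ℕ → H) (N : ℕ) : Prop where
  comm : ∀ m n, m + 1 < n → n < N → Commute (s m) (s n)
  braid : ∀ n, n + 1 < N → s n * s (n + 1) * s n = s (n + 1) * s n * s (n + 1)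

/-- The band generator of `i < j`. -/
def bandGen (s : ℕ → H) (i j : ℕ) : H := band s i (j - i - 1)

theorem bandGen_self (s : ℕ → H) (i : ℕ) : bandGen s i (i + 1) = s i := by
  rw [bandGen, show i + 1 - i - 1 = 0 by omega, band]

theorem bandGen_succ (s : ℕ → H) {i j : ℕ} (h : i < j) :
    bandGen s i (j + 1) = (s j)⁻¹ * bandGen s i j * s j := by
  rw [bandGen, show j + 1 - i - 1 = (j - i - 1) + 1 by omega, band, bandGen,
    show i + (j - i - 1) + 1 = j by omega]

/-- Conjugation by `s j` preserves commutation with elements that commute with `s j`. -/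
theorem commute_bandGen_succ {i j : ℕ} (h : i < j) {x : H} (h1 : Commute x (bandGen s i j))
    (h2 : Commute x (s j)) : Commute x (bandGen s i (j + 1)) := by
  rw [bandGen_succ s h]
  exact (h2.inv_right.mul_right h1).mul_right h2

namespace BraidRel

theorem commute_far (hs : BraidRel s N) {m i j : ℕ} (hij : i < j) (hj : j ≤ N)
    (hm : m < N) (h : m + 1 < i ∨ j < m) : Commute (s m) (bandGen s i j) := by
  have h0 : ∀ l, i ≤ l → l < j → Commute (s m) (s l) := by
    intro l h1 h2
    rcases h with h | h
    · exact hs.comm m l (by omega) (by omega)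
    · exact (hs.comm l m (by omega) (by omega)).symm
  induction j, hij using Nat.le_induction with
  | base =>
    rw [Nat.succ_eq_add_one, bandGen_self]
    exact h0 i le_rfl (by omega)
  | succ j hij ih =>
    exact commute_bandGen_succ hij (ih (by omega) (by omega) fun l h1 h2 => h0 l h1 (by omega))
      (h0 j (by omega) (by omega))

theorem commute_inside (hs : BraidRel s N) {m i j : ℕ} (him : i < m) (hmj : m + 1 < j)
    (hj : j ≤ N) : Commute (s m) (bandGen s i j) := by
  induction j, hmj using Nat.le_induction with
  | base =>
    rw [Nat.succ_eq_add_one, bandGen_succ s (by omega), bandGen_succ s him]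
    have h1 := hs.braid m (by omega)
    have h2 : Commute (s (m + 1)) (bandGen s i m) :=
      hs.commute_far him (by omega) (by omega) (Or.inr (by omega))
    generalize bandGen s i m = b at h2
    generalize s m = x at h1
    generalize s (m + 1) = y at h1 h2
    -- Conjugation by `x * y` takes `x` to `y` and the band generator to `b`.
    have h3 : x = (x * y)⁻¹ * y * (x * y)⁻¹⁻¹ := by
      rw [mul_assoc, eq_inv_mul_iff_mul_eq, inv_inv, h1, mul_assoc]
    have h4 : y⁻¹ * (x⁻¹ * b * x) * y = (x * y)⁻¹ * b * (x * y)⁻¹⁻¹ := by group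
    rw [h4]
    nth_rewrite 1 [h3]
    exact (Commute.conj_iff _).2 h2
  | succ j hj' ih =>
    exact commute_bandGen_succ (by omega) (ih (by omega)) (hs.comm m j (by omega) (by omega))

/-- The band generator of `i < j` and `s j` satisfy the braid relation. -/
theorem braid_bandGen (hs : BraidRel s N) {i j : ℕ} (hij : i < j) (hj : j < N) :
    bandGen s i j * s j * bandGen s i j = s j * bandGen s i j * s j := by
  induction j, hij using Nat.le_induction with
  | base =>
    rw [Nat.succ_eq_add_one, bandGen_self]
    exact hs.braid i hj
  | succ j hij ih =>
    have h1 := ih (by omega)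
    have h2 := hs.braid j hj
    have h3 : Commute (s (j + 1)) (bandGen s i j) :=
      hs.commute_far hij (by omega) (by omega) (Or.inr (by omega))
    rw [bandGen_succ s hij]
    generalize bandGen s i j = b at h1 h3
    generalize s j = x at h1 h2
    generalize s (j + 1) = y at h2 h3
    have h4 : x⁻¹ * b * x = b * x * b⁻¹ := by
      rw [eq_mul_inv_iff_mul_eq, mul_assoc, mul_assoc, inv_mul_eq_iff_eq_mul, ← mul_assoc, h1,
        mul_assoc]
    have h5 : y = b * y * b⁻¹ := by rw [← h3.eq, mul_inv_cancel_right]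
    rw [h4]
    calc b * x * b⁻¹ * y * (b * x * b⁻¹)
        = b * x * b⁻¹ * (b * y * b⁻¹) * (b * x * b⁻¹) := by
          rw [← h5]
      _ = b * (x * y * x) * b⁻¹ := by group
      _ = b * (y * x * y) * b⁻¹ := by rw [h2]
      _ = (b * y * b⁻¹) * (b * x * b⁻¹) * (b * y * b⁻¹) := by group
      _ = y * (b * x * b⁻¹) * y := by rw [← h5]

theorem triangle_left (hs : BraidRel s N) {i j k : ℕ} (hij : i < j) (hjk : j < k)
    (hk : k ≤ N) : bandGen s i j * bandGen s j k = bandGen s j k * bandGen s i k := by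
  induction k, hjk using Nat.le_induction with
  | base =>
    rw [Nat.succ_eq_add_one, bandGen_self, bandGen_succ s hij]
    group
  | succ k hjk ih =>
    have h1 := ih (by omega)
    have h2 : Commute (s k) (bandGen s i j) :=
      hs.commute_far hij (by omega) (by omega) (Or.inr (by omega))
    rw [bandGen_succ s hjk, bandGen_succ s (hij.trans hjk)]
    calc bandGen s i j * ((s k)⁻¹ * bandGen s j k * s k)
        = (s k)⁻¹ * (bandGen s i j * bandGen s j k) * s k := by
          rw [← mul_assoc, ← mul_assoc, h2.symm.inv_right.eq]
          group
      _ = _ := by rw [h1]; group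

theorem triangle_right (hs : BraidRel s N) {i j k : ℕ} (hij : i < j) (hjk : j < k)
    (hk : k ≤ N) : bandGen s i k * bandGen s i j = bandGen s j k * bandGen s i k := by
  induction k, hjk using Nat.le_induction with
  | base =>
    have h1 := hs.braid_bandGen hij (by omega)
    rw [Nat.succ_eq_add_one, bandGen_self, bandGen_succ s hij]
    rw [mul_assoc, mul_assoc, inv_mul_eq_iff_eq_mul, ← mul_assoc, h1]
    group
  | succ k hjk ih =>
    have h1 := ih (by omega)
    have h2 : Commute (s k) (bandGen s i j) :=
      hs.commute_far hij (by omega) (by omega) (Or.inr (by omega))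
    rw [bandGen_succ s hjk, bandGen_succ s (hij.trans hjk)]
    calc (s k)⁻¹ * bandGen s i k * s k * bandGen s i j
        = (s k)⁻¹ * (bandGen s i k * bandGen s i j) * s k := by
          rw [mul_assoc, h2.eq]
          group
      _ = _ := by rw [h1]; group

theorem commute_disjoint (hs : BraidRel s N) {p q r t : ℕ} (hpq : p < q) (hqr : q < r)
    (hrt : r < t) (ht : t ≤ N) : Commute (bandGen s p q) (bandGen s r t) := by
  induction t, hrt using Nat.le_induction with
  | base =>
    rw [Nat.succ_eq_add_one, bandGen_self]
    exact (hs.commute_far hpq (by omega) (by omega) (Or.inr hqr)).symm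
  | succ t hrt ih =>
    exact commute_bandGen_succ hrt (ih (by omega))
      (hs.commute_far hpq (by omega) (by omega) (Or.inr (by omega))).symm

theorem commute_nested (hs : BraidRel s N) {p q r t : ℕ} (hpr : p < r) (hrt : r < t)
    (htq : t < q) (hq : q ≤ N) : Commute (bandGen s p q) (bandGen s r t) := by
  induction t, hrt using Nat.le_induction with
  | base =>
    rw [Nat.succ_eq_add_one, bandGen_self]
    exact (hs.commute_inside hpr htq hq).symm
  | succ t hrt ih =>
    exact commute_bandGen_succ hrt (ih (by omega))
      (hs.commute_inside (by omega) htq hq).symm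

end BraidRel

end Band

/-! ### Reduced factorizations and the braid group -/

namespace MarkedGroup

open Equiv Equiv.Perm IntervalGroup

section General

variable {G : Type*} [Group G] {X : Set G} {g : G}

theorem AbsLE.mul_le {t y x : G} (h : AbsLE X t x) (hy : AbsLE X y (t⁻¹ * x)) :
    AbsLE X (t * y) x ∧ len X (t * y) = len X t + len X y := by
  have h1 := len_mul_le h.1 hy.1
  have h2 := h.2.2
  have h3 := hy.2.2
  have e : (t * y)⁻¹ * x = y⁻¹ * (t⁻¹ * x) := by group
  have m : t * y ∈ Submonoid.closure X := Submonoid.mul_mem _ h.1 hy.1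
  have h4 := len_mul_le m hy.2.1
  rw [show t * y * (y⁻¹ * (t⁻¹ * x)) = x by group] at h4
  exact ⟨⟨m, by rw [e]; exact hy.2.1, by rw [e]; omega⟩, by omega⟩

end General

variable {d : ℕ}

theorem absLE_left {t t' : Perm (Fin d)} (ht : t ∈ transpositions d) (ht' : t' ∈ transpositions d)
    (h : len (transpositions d) (t * t') = 2) : AbsLE (transpositions d) t (t * t') := by
  obtain ⟨p, q, hpq, rfl⟩ := ht
  obtain ⟨r, s, hrs, rfl⟩ := ht'
  rw [absLE_iff, inv_mul_cancel_left, h]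
  exact congrArg₂ (· + ·) (len_swap hpq) (len_swap hrs)

theorem inv_of_mem_transpositions {t : Perm (Fin d)} (ht : t ∈ transpositions d) : t⁻¹ = t := by
  obtain ⟨p, q, -, rfl⟩ := ht
  exact swap_inv _ _

theorem len_of_mem_transpositions {t : Perm (Fin d)} (ht : t ∈ transpositions d) :
    len (transpositions d) t = 1 := by
  obtain ⟨p, q, hpq, rfl⟩ := ht
  exact len_swap hpq

theorem conj_mem_transpositions {t t' : Perm (Fin d)} (ht : t ∈ transpositions d)
    (ht' : t' ∈ transpositions d) : t * t' * t ∈ transpositions d := by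
  have := transpositions_conj t t' ht'
  rwa [inv_of_mem_transpositions ht] at this

theorem mul_self_of_mem {t : Perm (Fin d)} (ht : t ∈ transpositions d) : t * t = 1 := by
  nth_rewrite 1 [← inv_of_mem_transpositions ht]
  exact inv_mul_cancel t

/-- The relation between the three transpositions, or two commuting transpositions, below an
element of rank two in the interval below the `d`-cycle. -/
def DualRelations {H : Type*} [Group H] (a : Perm (Fin d) → H) : Prop :=
  ∀ t ∈ transpositions d, ∀ t' ∈ transpositions d,
    AbsLE (transpositions d) (t * t') (finRotate d) → len (transpositions d) (t * t') = 2 →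
    a t * a t' = a (t * t' * t) * a t

section WellDefined

variable {H : Type*} [Group H] {a : Perm (Fin d) → H}

/-- The product of the images of the factors in a reduced factorization of `x` into
transpositions. -/
noncomputable def wordImage (a : Perm (Fin d) → H) (x : Perm (Fin d)) : H :=
  ((exists_word (mem_closure_transpositions x)).choose.map a).prod

/-- All reduced factorizations of `x` have the same image. -/
def WellDefinedAt (a : Perm (Fin d) → H) (x : Perm (Fin d)) : Prop :=
  ∀ l : List (Perm (Fin d)), l.length = len (transpositions d) x →
    (∀ t ∈ l, t ∈ transpositions d) → l.prod = x → (l.map a).prod = wordImage a x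

theorem WellDefinedAt.eq_mul {x : Perm (Fin d)} (h : WellDefinedAt a x) {t : Perm (Fin d)}
    (ht : t ∈ transpositions d) (htx : AbsLE (transpositions d) t x) :
    wordImage a x = a t * wordImage a (t * x) := by
  obtain ⟨h1, h2, h3⟩ := (exists_word (mem_closure_transpositions (t * x))).choose_spec
  have h4 := htx.2.2
  rw [inv_of_mem_transpositions ht, len_of_mem_transpositions ht] at h4
  rw [← h (t :: (exists_word (mem_closure_transpositions (t * x))).choose), List.map_cons,
    List.prod_cons]
  · rfl
  · rw [List.length_cons, h1]
    omega
  · intro t' ht'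
    rcases List.mem_cons.1 ht' with rfl | ht'
    exacts [ht, h2 t' ht']
  · rw [List.prod_cons, h3, ← mul_assoc, mul_self_of_mem ht, one_mul]

/-- The first factors of reduced factorizations can be exchanged within an element of rank two. -/
theorem mul_wordImage_eq (ha : DualRelations a) {x : Perm (Fin d)}
    (hx : AbsLE (transpositions d) x (finRotate d))
    (hlow : ∀ t ∈ transpositions d, AbsLE (transpositions d) t x → WellDefinedAt a (t * x))
    {t t' : Perm (Fin d)} (ht : t ∈ transpositions d) (ht' : t' ∈ transpositions d)
    (hz : AbsLE (transpositions d) (t * t') x) (h2 : len (transpositions d) (t * t') = 2) :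
    a t * wordImage a (t * x) = a (t * t' * t) * wordImage a (t * t' * t * x) := by
  have key : ∀ {t t' : Perm (Fin d)}, t ∈ transpositions d → t' ∈ transpositions d →
      AbsLE (transpositions d) (t * t') x → len (transpositions d) (t * t') = 2 →
      a t * wordImage a (t * x) = a t * a t' * wordImage a (t' * (t * x)) := by
    intro t t' ht ht' hz h2
    have h1 := absLE_left ht ht' h2
    have h3 := AbsLE.inv_mul_le h1 (h1.trans hz) hz
    rw [inv_mul_cancel_left, inv_of_mem_transpositions ht] at h3
    rw [(hlow t ht (h1.trans hz)).eq_mul ht' h3, mul_assoc]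
  have e : t * t' * t * t = t * t' := by rw [mul_assoc, mul_self_of_mem ht, mul_one]
  have e' : t * (t * t' * t * x) = t' * (t * x) := by
    rw [← mul_assoc, ← mul_assoc, ← mul_assoc, mul_self_of_mem ht, one_mul, mul_assoc]
  rw [key ht ht' hz h2, key (conj_mem_transpositions ht ht') ht (by rwa [e]) (by rwa [e]), e',
    ha t ht t' ht' (hz.trans hx) h2]

theorem mul_wordImage_eq_of_le (ha : DualRelations a) {x : Perm (Fin d)}
    (hx : AbsLE (transpositions d) x (finRotate d))
    (hlow : ∀ t ∈ transpositions d, AbsLE (transpositions d) t x → WellDefinedAt a (t * x))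
    {t t' : Perm (Fin d)} (ht : t ∈ transpositions d) (ht' : t' ∈ transpositions d)
    (htx : AbsLE (transpositions d) t x) (h : AbsLE (transpositions d) t' (t * x)) :
    a t * wordImage a (t * x) = a t' * wordImage a (t' * x) ∧
      a t * wordImage a (t * x) = a (t * t' * t) * wordImage a (t * t' * t * x) := by
  obtain ⟨h1, h2⟩ := htx.mul_le (by rwa [inv_of_mem_transpositions ht])
  rw [len_of_mem_transpositions ht, len_of_mem_transpositions ht'] at h2
  refine ⟨?_, mul_wordImage_eq ha hx hlow ht ht' h1 h2⟩
  have e : t' * (t' * t * t') = t * t' := by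
    rw [← mul_assoc, ← mul_assoc, mul_self_of_mem ht', one_mul]
  have e' : t' * (t' * t * t') * t' = t := by
    rw [e, mul_assoc, mul_self_of_mem ht', mul_one]
  have := mul_wordImage_eq ha hx hlow ht' (conj_mem_transpositions ht' ht) (by rwa [e])
    (by rwa [e])
  rw [e'] at this
  exact this.symm

/-- The reduced factorizations of `x` below the `d`-cycle are connected by the relations of rank
two. -/
theorem mul_wordImage_eq_mul_wordImage (ha : DualRelations a) {x : Perm (Fin d)}
    (hx : AbsLE (transpositions d) x (finRotate d))
    (hlow : ∀ t ∈ transpositions d, AbsLE (transpositions d) t x → WellDefinedAt a (t * x))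
    {t t' : Perm (Fin d)} (ht : t ∈ transpositions d) (ht' : t' ∈ transpositions d)
    (htx : AbsLE (transpositions d) t x) (htx' : AbsLE (transpositions d) t' x) :
    a t * wordImage a (t * x) = a t' * wordImage a (t' * x) := by
  have shared : ∀ {p q r : Fin d}, p ≠ q → p ≠ r → SameCycle x p q → SameCycle x p r →
      a (swap p q) * wordImage a (swap p q * x) = a (swap p r) * wordImage a (swap p r * x) := by
    intro p q r hpq hpr h1 h2
    rcases eq_or_ne q r with rfl | hqr
    · rfl
    have ht := swap_mem_transpositions hpq
    have htx := (swap_le_iff hpq).2 h1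
    have hm := sameCycle_swap_mul_iff (not_sameCycle_swap_mul hpq h1) (a := p) (b := r)
    rw [← mul_assoc, swap_mul_self, one_mul] at hm
    have h3 : SameCycle (swap p q * x) p r ∨ SameCycle (swap p q * x) q r := by
      rcases hm.1 h2 with h | h
      exacts [Or.inl h, h.2]
    rcases h3 with h3 | h3
    · exact (mul_wordImage_eq_of_le ha hx hlow ht (swap_mem_transpositions hpr) htx
        ((swap_le_iff hpr).2 h3)).1
    · have h4 := (mul_wordImage_eq_of_le ha hx hlow ht (swap_mem_transpositions hqr) htx
        ((swap_le_iff hqr).2 h3)).2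
      have e : swap p q * swap q r * swap p q = swap p r := by
        have := Equiv.swap_apply_apply (swap p q) q r
        rw [swap_inv, swap_apply_right, swap_apply_of_ne_of_ne hpr.symm hqr.symm] at this
        exact this.symm
      rwa [e] at h4
  obtain ⟨p, q, hpq, rfl⟩ := ht
  obtain ⟨r, s, hrs, rfl⟩ := ht'
  have h1 := (swap_le_iff hpq).1 htx
  have h2 := (swap_le_iff hrs).1 htx'
  by_cases hpr : SameCycle x p r
  · rcases eq_or_ne p r with rfl | hne
    · exact shared hpq hrs h1 h2
    · refine (shared hpq hne h1 hpr).trans ?_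
      rw [swap_comm p r]
      exact shared hne.symm hrs hpr.symm h2
  · have hm := sameCycle_swap_mul_iff (not_sameCycle_swap_mul hpq h1) (a := r) (b := s)
    have hm' := fun c => sameCycle_swap_mul_iff (not_sameCycle_swap_mul hpq h1) (a := c) (b := r)
    rw [← mul_assoc, swap_mul_self, one_mul] at hm
    have h3 : SameCycle (swap p q * x) r s := by
      refine (hm.1 h2).resolve_right fun h => hpr ?_
      have h4 := hm' p
      rw [← mul_assoc, swap_mul_self, one_mul] at h4
      exact h4.2 (Or.inr ⟨Or.inl (SameCycle.refl _ _), h.1⟩)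
    exact (mul_wordImage_eq_of_le ha hx hlow (swap_mem_transpositions hpq)
      (swap_mem_transpositions hrs) htx ((swap_le_iff hrs).2 h3)).1

theorem wellDefinedAt (ha : DualRelations a) {x : Perm (Fin d)}
    (hx : AbsLE (transpositions d) x (finRotate d)) : WellDefinedAt a x := by
  induction hn : len (transpositions d) x generalizing x with
  | zero =>
    intro l hl _ _
    have h1 := (exists_word (mem_closure_transpositions x)).choose_spec.1.trans hn
    rw [hn] at hl
    rw [List.length_eq_zero_iff] at hl h1
    rw [wordImage, h1, hl]
  | succ n ih =>
    have hlow : ∀ t ∈ transpositions d, AbsLE (transpositions d) t x →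
        len (transpositions d) (t * x) = n ∧ WellDefinedAt a (t * x) := by
      intro t ht htx
      have h1 := htx.right_factor transpositions_conj
      have h2 := htx.2.2
      rw [inv_of_mem_transpositions ht] at h1 h2
      rw [len_of_mem_transpositions ht] at h2
      exact ⟨by omega, ih (h1.trans hx) (by omega)⟩
    have key : ∀ l : List (Perm (Fin d)), l.length = len (transpositions d) x →
        (∀ t ∈ l, t ∈ transpositions d) → l.prod = x → ∃ t ∈ transpositions d,
          AbsLE (transpositions d) t x ∧ (l.map a).prod = a t * wordImage a (t * x) := by
      rintro (_ | ⟨t, m⟩) h1 h2 h3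
      · rw [hn] at h1
        simp at h1
      have ht := h2 t List.mem_cons_self
      have hm : ∀ t ∈ m, t ∈ transpositions d := fun u hu => h2 u (List.mem_cons_of_mem _ hu)
      have h4 : t * x = m.prod := by
        rw [← h3, List.prod_cons, ← mul_assoc, mul_self_of_mem ht, one_mul]
      have h5 : AbsLE (transpositions d) t x := by
        have h6 := len_le hm
        have h7 := len_mul_le (X := transpositions d) (mem_closure_transpositions t)
          (mem_closure_transpositions (t * x))
        rw [← mul_assoc, mul_self_of_mem ht, one_mul, len_of_mem_transpositions ht] at h7
        rw [absLE_iff, inv_of_mem_transpositions ht, len_of_mem_transpositions ht]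
        rw [List.length_cons] at h1
        rw [← h4] at h6
        omega
      refine ⟨t, ht, h5, ?_⟩
      obtain ⟨h6, h7⟩ := hlow t ht h5
      rw [List.map_cons, List.prod_cons, h7 m (by rw [h6]; simpa [hn] using h1) hm h4.symm]
    intro l h1 h2 h3
    obtain ⟨t, ht, htx, h4⟩ := key l h1 h2 h3
    obtain ⟨h5, h6, h7⟩ := (exists_word (mem_closure_transpositions x)).choose_spec
    obtain ⟨t', ht', htx', h8⟩ := key _ h5 h6 h7
    change wordImage a x = _ at h8
    rw [h4, h8]
    exact mul_wordImage_eq_mul_wordImage ha hx (fun t ht htx => (hlow t ht htx).2) ht ht' htx htx'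

theorem wordImage_mul (ha : DualRelations a) {v w : Perm (Fin d)}
    (hvw : AbsLE (transpositions d) v w) (hw : AbsLE (transpositions d) w (finRotate d)) :
    wordImage a v * wordImage a (v⁻¹ * w) = wordImage a w := by
  obtain ⟨h1, h2, h3⟩ := (exists_word (mem_closure_transpositions v)).choose_spec
  obtain ⟨h4, h5, h6⟩ := (exists_word (mem_closure_transpositions (v⁻¹ * w))).choose_spec
  rw [← wellDefinedAt ha hw ((exists_word (mem_closure_transpositions v)).choose ++
    (exists_word (mem_closure_transpositions (v⁻¹ * w))).choose), List.map_append,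
    List.prod_append]
  · rfl
  · rw [List.length_append, h1, h4, hvw.2.2]
  · intro t ht
    rcases List.mem_append.1 ht with ht | ht
    exacts [h2 t ht, h5 t ht]
  · rw [List.prod_append, h3, h6, mul_inv_cancel_left]

theorem wordImage_of_mem (ha : DualRelations a) {t : Perm (Fin d)} (ht : t ∈ transpositions d) :
    wordImage a t = a t := by
  have h : AbsLE (transpositions d) t (finRotate d) := by
    obtain ⟨p, q, hpq, rfl⟩ := ht
    exact swap_le_finRotate hpq
  rw [← wellDefinedAt ha h [t] (by rw [len_of_mem_transpositions ht]; rfl) (by simpa using ht)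
    (by simp)]
  simp

end WellDefined

end MarkedGroup

/-! ### The interval group of the `d`-cycle -/

namespace MarkedGroup

open Equiv Equiv.Perm IntervalGroup

variable {d : ℕ}

/-- The element of a group with braid generators `s 0, s 1, …` that belongs to a transposition. -/
noncomputable def swapGen {H : Type*} [Group H] (s : ℕ → H) (t : Perm (Fin d)) : H :=
  open scoped Classical in
  if h : ∃ p : Fin d × Fin d, p.1 < p.2 ∧ t = swap p.1 p.2 then
    bandGen s h.choose.1.1 h.choose.2.1 else 1

theorem swap_injective_of_lt {i j k l : Fin d} (hij : i < j) (hkl : k < l)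
    (h : swap i j = swap k l) : i = k ∧ j = l := by
  have h1 : swap k l i = j := by rw [← h, swap_apply_left]
  by_cases hik : i = k
  · subst hik
    rw [swap_apply_left] at h1
    exact ⟨rfl, h1.symm⟩
  · by_cases hil : i = l
    · subst hil
      rw [swap_apply_right] at h1
      exact absurd (hkl.trans hij) (by rw [h1]; exact lt_irrefl _)
    · rw [swap_apply_of_ne_of_ne hik hil] at h1
      exact absurd h1 hij.ne

theorem swapGen_swap {H : Type*} [Group H] (s : ℕ → H) {i j : Fin d} (h : i < j) :
    swapGen s (swap i j) = bandGen s i.1 j.1 := by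
  have hex : ∃ p : Fin d × Fin d, p.1 < p.2 ∧ swap i j = swap p.1 p.2 := ⟨(i, j), h, rfl⟩
  rw [swapGen, dif_pos hex]
  obtain ⟨h1, h2⟩ := swap_injective_of_lt h hex.choose_spec.1 hex.choose_spec.2
  rw [← h1, ← h2]

theorem exists_lt_of_mem {t : Perm (Fin d)} (ht : t ∈ transpositions d) :
    ∃ i j, i < j ∧ t = swap i j := by
  obtain ⟨i, j, hij, rfl⟩ := ht
  rcases lt_or_gt_of_ne hij with h | h
  · exact ⟨i, j, h, rfl⟩
  · exact ⟨j, i, h, swap_comm i j⟩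

/-- The band generators satisfy the dual relations. -/
theorem dualRelations_swapGen {H : Type*} [Group H] {s : ℕ → H} (hs : BraidRel s (d - 1)) :
    DualRelations (swapGen s : Perm (Fin d) → H) := by
  intro t ht t' ht' hle hlen
  obtain ⟨p, q, hpq, rfl⟩ := exists_lt_of_mem ht
  obtain ⟨r, u, hru, rfl⟩ := exists_lt_of_mem ht'
  have hside := (swap_mul_swap_le_iff hpq hru.ne).1 ⟨hle, hlen⟩
  have hconj : swap p q * swap r u * swap p q = swap (swap p q r) (swap p q u) := by
    rw [Equiv.swap_apply_apply, swap_inv]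
  rw [hconj]
  clear hconj hle hlen ht ht'
  have hp1 := p.2
  have hq1 := q.2
  have hr1 := r.2
  have hu1 := u.2
  rw [Set.mem_Ico, Set.mem_Ico] at hside
  rcases eq_or_ne p r with rfl | hpr
  · have huq : u < q := (hside.1 ⟨le_rfl, hpq⟩).2
    rw [swap_apply_left, swap_apply_of_ne_of_ne hru.ne' huq.ne, swap_comm q u, swapGen_swap s hpq,
      swapGen_swap s hru, swapGen_swap s huq]
    exact hs.triangle_right hru huq (by omega)
  rcases eq_or_ne u q with rfl | huq
  · have hrp : r < p := by
      by_contra h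
      exact (hside.1 ⟨not_lt.1 h, hru⟩).2.false
    rw [swap_apply_right, swap_apply_of_ne_of_ne hrp.ne hru.ne, swapGen_swap s hpq,
      swapGen_swap s hru, swapGen_swap s hrp]
    exact (hs.triangle_left hrp hpq (by omega)).symm
  rcases eq_or_ne q r with rfl | hqr
  · rw [swap_apply_right, swap_apply_of_ne_of_ne (hpq.trans hru).ne' hru.ne', swapGen_swap s hpq,
      swapGen_swap s hru, swapGen_swap s (hpq.trans hru)]
    exact (hs.triangle_left hpq hru (by omega)).trans
      (hs.triangle_right hpq hru (by omega)).symm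
  rcases eq_or_ne p u with rfl | hpu
  · exact absurd (hside.2 ⟨le_rfl, hpq⟩).1 (not_le.2 hru)
  rw [swap_apply_of_ne_of_ne hpr.symm hqr.symm, swap_apply_of_ne_of_ne hpu.symm huq,
    swapGen_swap s hpq, swapGen_swap s hru]
  by_cases hin : p ≤ r ∧ r < q
  · exact hs.commute_nested (lt_of_le_of_ne hin.1 fun h => hpr (Fin.ext h)) hru
      (hside.1 hin).2 (by omega)
  · have hout : ¬ (p ≤ u ∧ u < q) := fun h => hin (hside.2 h)
    simp only [Fin.lt_def, Fin.le_def, ne_eq, Fin.ext_iff] at *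
    by_cases h1 : r.1 < p.1
    · by_cases h2 : u.1 < p.1
      · exact (hs.commute_disjoint hru h2 hpq (by omega)).symm
      · exact (hs.commute_nested h1 hpq (by omega) (by omega)).symm
    · exact hs.commute_disjoint hpq (by omega) hru (by omega)

theorem gen_mul_of_le {v x : Perm (Fin d)} (h : AbsLE (transpositions d) v (v * x))
    (hx : AbsLE (transpositions d) (v * x) (finRotate d)) :
    gen (transpositions d) (finRotate d) v * gen (transpositions d) (finRotate d) x =
      gen (transpositions d) (finRotate d) (v * x) := by
  have := gen_mul transpositions_conj h hx
  rwa [inv_mul_cancel_left] at this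

theorem dualRelations_gen : DualRelations (gen (transpositions d) (finRotate d)) := by
  intro t ht t' ht' hle hlen
  have e : t * t' * t * t = t * t' := by rw [mul_assoc, mul_self_of_mem ht, mul_one]
  have h1 := absLE_left (conj_mem_transpositions ht ht') ht (by rwa [e])
  rw [gen_mul_of_le (absLE_left ht ht' hlen) hle, gen_mul_of_le h1 (by rwa [e]), e]

theorem DualRelations.mul_eq {H : Type*} [Group H] {a : Perm (Fin d) → H} (ha : DualRelations a)
    {t t' : Perm (Fin d)} (ht : t ∈ transpositions d) (ht' : t' ∈ transpositions d)
    (hle : AbsLE (transpositions d) (t * t') (finRotate d))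
    (hlen : len (transpositions d) (t * t') = 2) : a t * a t' = a t' * a (t' * t * t') := by
  have e : t' * (t' * t * t') = t * t' := by
    rw [← mul_assoc, ← mul_assoc, mul_self_of_mem ht', one_mul]
  have := ha t' ht' _ (conj_mem_transpositions ht' ht) (by rwa [e]) (by rwa [e])
  rw [this, e, mul_assoc, mul_self_of_mem ht', mul_one]

/-- The simple generators of the interval group of the `d`-cycle. -/
noncomputable def simpleGen (d n : ℕ) : IntervalGroup (transpositions d) (finRotate d) :=
  if h : n + 1 < d then
    gen (transpositions d) (finRotate d) (swap ⟨n, by omega⟩ ⟨n + 1, h⟩) else 1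

theorem bandGen_simpleGen {i j : Fin d} (h : i < j) :
    bandGen (simpleGen d) i.1 j.1 = gen (transpositions d) (finRotate d) (swap i j) := by
  obtain ⟨i, hi⟩ := i
  obtain ⟨j, hj⟩ := j
  rw [Fin.lt_def] at h
  simp only at h ⊢
  induction j, h using Nat.le_induction with
  | base => exact (bandGen_self (simpleGen d) i).trans (dif_pos hj)
  | succ j h ih =>
    rw [bandGen_succ _ h, ih (by omega), simpleGen, dif_pos hj, mul_assoc, inv_mul_eq_iff_eq_mul]
    have hlt : (⟨i, hi⟩ : Fin d) < ⟨j, by omega⟩ := h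
    have hlt' : (⟨j, by omega⟩ : Fin d) < ⟨j + 1, hj⟩ := Fin.lt_def.2 (by simp)
    obtain ⟨h1, h2⟩ := (swap_mul_swap_le_iff hlt hlt'.ne).2 (by
      simp only [Set.mem_Ico, Fin.le_def, Fin.lt_def]
      omega)
    rw [dualRelations_gen.mul_eq (swap_mem_transpositions hlt.ne)
      (swap_mem_transpositions hlt'.ne) h1 h2]
    congr 2
    have := Equiv.swap_apply_apply (swap (⟨j, by omega⟩ : Fin d) ⟨j + 1, hj⟩) ⟨i, hi⟩ ⟨j, by omega⟩
    rw [swap_inv, swap_apply_left, swap_apply_of_ne_of_ne hlt.ne (hlt.trans hlt').ne] at this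
    exact this.symm

theorem braidRel_simpleGen : BraidRel (simpleGen d) (d - 1) where
  comm m n h1 h2 := by
    rw [simpleGen, simpleGen, dif_pos (by omega), dif_pos (by omega)]
    have hm : (⟨m, by omega⟩ : Fin d) < ⟨m + 1, by omega⟩ := Fin.lt_def.2 (by simp)
    have hn : (⟨n, by omega⟩ : Fin d) < ⟨n + 1, by omega⟩ := Fin.lt_def.2 (by simp)
    obtain ⟨h3, h4⟩ := (swap_mul_swap_le_iff hm hn.ne).2 (by
      simp only [Set.mem_Ico, Fin.le_def, Fin.lt_def]
      omega)
    have h5 := dualRelations_gen _ (swap_mem_transpositions hm.ne) _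
      (swap_mem_transpositions hn.ne) h3 h4
    have h6 := Equiv.swap_apply_apply (swap (⟨m, by omega⟩ : Fin d) ⟨m + 1, by omega⟩)
      ⟨n, by omega⟩ ⟨n + 1, by omega⟩
    rw [swap_inv, swap_apply_of_ne_of_ne (by simp; omega) (by simp; omega),
      swap_apply_of_ne_of_ne (by simp; omega) (by simp; omega)] at h6
    rw [← h6] at h5
    exact h5
  braid n h := by
    rw [simpleGen, simpleGen, dif_pos (by omega), dif_pos (by omega)]
    have hm : (⟨n, by omega⟩ : Fin d) < ⟨n + 1, by omega⟩ := Fin.lt_def.2 (by simp)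
    have hn : (⟨n + 1, by omega⟩ : Fin d) < ⟨n + 1 + 1, by omega⟩ := Fin.lt_def.2 (by simp)
    obtain ⟨h3, h4⟩ := (swap_mul_swap_le_iff hm hn.ne).2 (by
      simp only [Set.mem_Ico, Fin.le_def, Fin.lt_def]
      omega)
    have ht := swap_mem_transpositions hm.ne
    have ht' := swap_mem_transpositions hn.ne
    have h5 := dualRelations_gen _ ht _ ht' h3 h4
    have h6 := dualRelations_gen.mul_eq ht ht' h3 h4
    have e : ∀ {x y : Perm (Fin d)}, x = swap (⟨n, by omega⟩ : Fin d) ⟨n + 1, by omega⟩ →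
        y = swap (⟨n + 1, by omega⟩ : Fin d) ⟨n + 1 + 1, by omega⟩ → y * x * y = x * y * x := by
      rintro x y rfl rfl
      have e1 := Equiv.swap_apply_apply (swap (⟨n, by omega⟩ : Fin d) ⟨n + 1, by omega⟩)
        ⟨n + 1, by omega⟩ ⟨n + 1 + 1, by omega⟩
      have e2 := Equiv.swap_apply_apply (swap (⟨n + 1, by omega⟩ : Fin d) ⟨n + 1 + 1, by omega⟩)
        ⟨n, by omega⟩ ⟨n + 1, by omega⟩
      rw [swap_inv, swap_apply_right,
        swap_apply_of_ne_of_ne (by simp; omega) (by simp)] at e1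
      rw [swap_inv, swap_apply_left,
        swap_apply_of_ne_of_ne (by simp) (by simp; omega)] at e2
      rw [← e1, ← e2]
    rw [e rfl rfl] at h6
    rw [h6, mul_assoc, ← h5, ← mul_assoc]

/-- The product of the generators along a reduced factorization of an element of `[1, δ]` is the
generator of this element. -/
theorem prod_map_gen (l : List (Perm (Fin d))) (hl : ∀ t ∈ l, t ∈ transpositions d)
    (hle : AbsLE (transpositions d) l.prod (finRotate d))
    (hlen : l.length = len (transpositions d) l.prod) :
    (l.map (gen (transpositions d) (finRotate d))).prod =
      gen (transpositions d) (finRotate d) l.prod := by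
  have h1 : ∀ x : Perm (Fin d), AbsLE (transpositions d) x (finRotate d) →
      wordImage (gen (transpositions d) (finRotate d)) x =
        gen (transpositions d) (finRotate d) x := by
    intro x hx
    induction hn : len (transpositions d) x generalizing x with
    | zero =>
      rw [eq_one_of_len hx.1 hn, ← wellDefinedAt dualRelations_gen (one_le_of_mem hx.mem_right) []
        (by rw [len_one]; rfl) (by simp) rfl]
      simp
    | succ n ih =>
      obtain ⟨i, hi⟩ : ∃ i, i ≠ x i := by
        by_contra! h0
        rw [show x = 1 from Equiv.ext fun i => (h0 i).symm, len_one] at hn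
        omega
      have ht := swap_mem_transpositions hi
      have htx := (swap_le_iff hi).2 (⟨1, by simp⟩ : SameCycle x i (x i))
      generalize swap i (x i) = t at ht htx
      have h2 := htx.right_factor transpositions_conj
      have h3 := htx.2.2
      rw [len_of_mem_transpositions ht, inv_of_mem_transpositions ht] at h3
      rw [inv_of_mem_transpositions ht] at h2
      rw [(wellDefinedAt dualRelations_gen hx).eq_mul ht htx, ih _ (h2.trans hx) (by omega),
        gen_mul_of_le] <;> rw [← mul_assoc, mul_self_of_mem ht, one_mul]
      exacts [htx, hx]
  rw [wellDefinedAt dualRelations_gen hle l hlen hl rfl, h1 _ hle]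

/-- Artin's generators, indexed by all natural numbers. -/
noncomputable def artinGen (d n : ℕ) : BraidGroup d :=
  if h : n < d - 1 then PresentedGroup.of ⟨n, h⟩ else 1

theorem braidRel_artinGen : BraidRel (artinGen d) (d - 1) where
  comm m n h1 h2 := by
    rw [artinGen, artinGen, dif_pos (by omega), dif_pos h2]
    refine mul_inv_eq_one.1 ?_
    exact (PresentedGroup.mk_eq_one_iff (rels := braidRelators d)).2
      (Subgroup.subset_normalClosure (Or.inl ⟨⟨m, by omega⟩, ⟨n, h2⟩, h1, rfl⟩))
  braid n h := by
    rw [artinGen, artinGen, dif_pos (by omega), dif_pos h]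
    refine mul_inv_eq_one.1 ?_
    exact (PresentedGroup.mk_eq_one_iff (rels := braidRelators d)).2
      (Subgroup.subset_normalClosure (Or.inr ⟨⟨n, by omega⟩, ⟨n + 1, h⟩, rfl, rfl⟩))

/-- The homomorphism from the interval group of the `d`-cycle to the braid group. -/
noncomputable def toBraid (d : ℕ) :
    IntervalGroup (transpositions d) (finRotate d) →* BraidGroup d :=
  lift (fun x => wordImage (swapGen (artinGen d)) x.1) (wordImage (swapGen (artinGen d)))
    (fun v x h hx => by
      have := wordImage_mul (dualRelations_swapGen braidRel_artinGen) h hx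
      rwa [inv_mul_cancel_left] at this)

/-- The homomorphism from the braid group to the interval group of the `d`-cycle. -/
noncomputable def ofBraid (d : ℕ) :
    BraidGroup d →* IntervalGroup (transpositions d) (finRotate d) :=
  PresentedGroup.toGroup (f := fun n => simpleGen d n.1) (by
    rintro r (⟨i, j, hij, rfl⟩ | ⟨i, j, hij, rfl⟩)
    · simp only [map_mul, map_inv, FreeGroup.lift_apply_of]
      exact mul_inv_eq_one.2 (braidRel_simpleGen.comm _ _ hij j.2)
    · simp only [map_mul, map_inv, FreeGroup.lift_apply_of, ← hij]
      exact mul_inv_eq_one.2 (braidRel_simpleGen.braid _ (by rw [hij]; exact j.2)))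

theorem ofBraid_artinGen (n : ℕ) : ofBraid d (artinGen d n) = simpleGen d n := by
  by_cases h : n < d - 1
  · rw [artinGen, dif_pos h]
    exact PresentedGroup.toGroup.of _
  · rw [artinGen, dif_neg h, map_one, simpleGen, dif_neg (by omega)]

theorem map_bandGen {H K : Type*} [Group H] [Group K] (f : H →* K) (s : ℕ → H) (i j : ℕ) :
    f (bandGen s i j) = bandGen (fun n => f (s n)) i j := by
  unfold bandGen
  induction j - i - 1 with
  | zero => rfl
  | succ n ih => rw [band, band, map_mul, map_mul, map_inv, ih]

theorem ofBraid_swapGen {t : Perm (Fin d)} (ht : t ∈ transpositions d) :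
    ofBraid d (swapGen (artinGen d) t) = gen (transpositions d) (finRotate d) t := by
  obtain ⟨i, j, hij, rfl⟩ := exists_lt_of_mem ht
  rw [swapGen_swap _ hij, map_bandGen]
  simp only [ofBraid_artinGen]
  exact bandGen_simpleGen hij

theorem toBraid_gen {x : Perm (Fin d)} (hx : AbsLE (transpositions d) x (finRotate d)) :
    toBraid d (gen (transpositions d) (finRotate d) x) = wordImage (swapGen (artinGen d)) x := by
  by_cases h : x = 1
  · subst h
    rw [gen_one, map_one, ← wellDefinedAt (dualRelations_swapGen braidRel_artinGen) hx []
      (by rw [len_one]; rfl) (by simp) rfl]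
    simp
  · exact (congrArg _ (gen_of ⟨x, hx, h⟩)).trans (lift_of _ _ _ _)

/-- The interval group of the `d`-cycle in the symmetric group is the braid group. -/
noncomputable def intervalGroupEquivBraid (d : ℕ) :
    IntervalGroup (transpositions d) (finRotate d) ≃* BraidGroup d :=
  MonoidHom.toMulEquiv (toBraid d) (ofBraid d)
    (by
      refine PresentedGroup.ext fun x => ?_
      rw [← gen_of x]
      simp only [MonoidHom.comp_apply, MonoidHom.id_apply]
      rw [toBraid_gen x.2.1]
      obtain ⟨h1, h2, h3⟩ := (exists_word (mem_closure_transpositions x.1)).choose_spec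
      rw [wordImage, map_list_prod, List.map_map]
      refine (congrArg List.prod (List.map_congr_left
        (g := gen (transpositions d) (finRotate d))
        fun t ht => ofBraid_swapGen (h2 t ht))).trans ?_
      rw [prod_map_gen _ h2 (by rw [h3]; exact x.2.1) (by rw [h3]; exact h1), h3])
    (by
      refine PresentedGroup.ext fun n => ?_
      simp only [MonoidHom.comp_apply, MonoidHom.id_apply]
      have h1 : ofBraid d (PresentedGroup.of n) = simpleGen d n.1 := PresentedGroup.toGroup.of _
      have hlt : (⟨n.1, by omega⟩ : Fin d) < ⟨n.1 + 1, by omega⟩ := Fin.lt_def.2 (by simp)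
      rw [h1, simpleGen, dif_pos (by omega), toBraid_gen (swap_le_finRotate hlt.ne),
        wordImage_of_mem (dualRelations_swapGen braidRel_artinGen)
          (swap_mem_transpositions hlt.ne), swapGen_swap _ hlt, bandGen_self, artinGen,
        dif_pos n.2])

end MarkedGroup

/-! ### Geodesic factorizations and normal forms -/

namespace MarkedGroup

variable {G : Type*} [Group G] {X : Set G} {g : G}

/-- The lengths of the factors add up to the length of the product. -/
def Geodesic (X : Set G) (l : List G) : Prop :=
  (∀ x ∈ l, x ∈ Submonoid.closure X) ∧ (l.map (len X)).sum = len X l.prod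

theorem Geodesic.of_cons {a : G} {l : List G} (h : Geodesic X (a :: l)) :
    Geodesic X l ∧ AbsLE X a (a * l.prod) := by
  have ha := h.1 a List.mem_cons_self
  have hl : ∀ x ∈ l, x ∈ Submonoid.closure X := fun x hx => h.1 x (List.mem_cons_of_mem _ hx)
  have hm := Submonoid.list_prod_mem _ hl
  have h1 := h.2
  have h2 := len_prod_le l hl
  have h3 := len_mul_le ha hm
  rw [List.map_cons, List.sum_cons, List.prod_cons] at h1
  exact ⟨⟨hl, by omega⟩, ha, by rwa [inv_mul_cancel_left], by rw [inv_mul_cancel_left]; omega⟩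

theorem Geodesic.cons {a : G} {l : List G} (ha : a ∈ Submonoid.closure X) (hl : Geodesic X l)
    (h : len X (a * l.prod) = len X a + len X l.prod) : Geodesic X (a :: l) := by
  refine ⟨fun x hx => ?_, ?_⟩
  · rcases List.mem_cons.1 hx with rfl | hx
    exacts [ha, hl.1 x hx]
  · rw [List.map_cons, List.sum_cons, List.prod_cons, hl.2, h]

/-- With a conjugation-invariant generating set, factors of a geodesic factorization may be
omitted. -/
theorem Geodesic.sublist (hX : ∀ a x, x ∈ X → a * x * a⁻¹ ∈ X) {m l : List G} (hml : m.Sublist l)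
    (hl : Geodesic X l) : Geodesic X m ∧ AbsLE X m.prod l.prod := by
  induction hml with
  | slnil => exact ⟨hl, AbsLE.refl (Submonoid.one_mem _)⟩
  | cons a _ ih =>
    obtain ⟨h1, h2⟩ := hl.of_cons
    obtain ⟨h3, h4⟩ := ih h1
    refine ⟨h3, h4.trans ?_⟩
    have := h2.right_factor hX
    rwa [inv_mul_cancel_left] at this
  | cons_cons a _ ih =>
    obtain ⟨h1, h2⟩ := hl.of_cons
    obtain ⟨h3, h4⟩ := ih h1
    obtain ⟨h5, h6⟩ := h2.mul_le (by rwa [inv_mul_cancel_left])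
    exact ⟨h3.cons h2.1 h6, h5⟩

theorem IsWeightedFact.exists_geodesic {h : G} {u : I → G} (hu : IsWeightedFact X h u) :
    ∃ R : List I, R.Pairwise (· < ·) ∧ (∀ r, r ∉ R → u r = 1) ∧ (R.map u).prod = h ∧
      Geodesic X (R.map u) := by
  obtain ⟨h1, R, h2, h3, h4, h5⟩ := hu
  refine ⟨R, h2, h3, h4, fun x hx => ?_, ?_⟩
  · obtain ⟨r, -, rfl⟩ := List.mem_map.1 hx
    exact h1 r
  · rw [h4, ← h5, List.map_map]
    rfl

theorem IsWeightedFact.absLE (hX : ∀ a x, x ∈ X → a * x * a⁻¹ ∈ X) {h : G} {u : I → G}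
    (hu : IsWeightedFact X h u) (r : I) : AbsLE X (u r) h := by
  obtain ⟨R, -, h1, rfl, h2⟩ := hu.exists_geodesic
  by_cases hr : r ∈ R
  · have h3 : [u r].Sublist (R.map u) := (List.singleton_sublist.2 hr).map u
    simpa using (h2.sublist hX h3).2
  · rw [h1 r hr]
    exact one_le_of_mem (Submonoid.list_prod_mem _ h2.1)

theorem IsWeightedFact.mul_absLE (hX : ∀ a x, x ∈ X → a * x * a⁻¹ ∈ X) {h : G} {u : I → G}
    (hu : IsWeightedFact X h u) {r r' : I} (hr : r < r') :
    AbsLE X (u r * u r') h ∧ AbsLE X (u r) (u r * u r') := by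
  by_cases h0 : u r = 1
  · rw [h0, one_mul]
    exact ⟨hu.absLE hX r', one_le_of_mem (hu.1 r')⟩
  by_cases h0' : u r' = 1
  · rw [h0', mul_one]
    exact ⟨hu.absLE hX r, AbsLE.refl (hu.1 r)⟩
  obtain ⟨R, hR, h1, rfl, h2⟩ := hu.exists_geodesic
  have hr1 : r ∈ R := by_contra fun h => h0 (h1 r h)
  have hr2 : r' ∈ R := by_contra fun h => h0' (h1 r' h)
  have h3 : [r, r'].Sublist R := by
    refine List.sublist_of_subperm_of_pairwise (r := (· < ·)) ?_ ?_ hR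
    · refine List.subperm_of_subset (by simpa using hr.ne) fun q hq => ?_
      rcases List.mem_cons.1 hq with rfl | hq
      · exact hr1
      · rw [List.mem_singleton.1 hq]
        exact hr2
    · simpa using hr
  obtain ⟨h4, h5⟩ := h2.sublist hX (h3.map u)
  simp only [List.map_cons, List.map_nil] at h4 h5
  have h6 := h4.of_cons.2
  simp only [List.prod_cons, List.prod_nil, mul_one] at h5 h6
  exact ⟨h5, h6⟩

theorem AbsLE.conj (hX : ∀ a x, x ∈ X → a * x * a⁻¹ ∈ X) (a : G) {x y : G} (h : AbsLE X x y) :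
    AbsLE X (a * x * a⁻¹) (a * y * a⁻¹) := by
  have e : (a * x * a⁻¹)⁻¹ * (a * y * a⁻¹) = a * (x⁻¹ * y) * a⁻¹ := by group
  refine ⟨mem_closure_conj hX a h.1, ?_, ?_⟩
  · rw [e]
    exact mem_closure_conj hX a h.2.1
  · rw [e, len_conj hX, len_conj hX, len_conj hX]
    exact h.2.2

theorem AbsLE.mul_mul (hX : ∀ a x, x ∈ X → a * x * a⁻¹ ∈ X) {a a' b b' : G} (ha : AbsLE X a' a)
    (hb : AbsLE X b' b) (h : AbsLE X a (a * b)) : AbsLE X (a' * b') (a * b) := by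
  have h1 := AbsLE.inv_mul_le ha (ha.trans h) h
  have h2 := h1.right_factor hX
  rw [show (a'⁻¹ * a)⁻¹ * (a'⁻¹ * (a * b)) = b by group] at h2
  exact ((ha.trans h).mul_le (hb.trans h2)).1

/-- Moving the value at `1` to `0` does not change the lengths, and gives a factorization of
another element of the interval. -/
theorem LinFactPoset.normalForm_prod (hX : ∀ a x, x ∈ X → a * x * a⁻¹ ∈ X) (v : LinFactPoset X g)
    {F : Finset I} (hF : ∀ r, r ≠ 0 → r ≠ 1 → r ∉ F → v.toFun r = 1) :
    AbsLE X (v.normalForm 0 * ((innerList F).map v.toFun).prod) g ∧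
    len X (v.normalForm 0) + ((innerList F).map fun r => len X (v.toFun r)).sum =
      len X (v.normalForm 0 * ((innerList F).map v.toFun).prod) ∧
    AbsLE X (g * v.toFun 1 * g⁻¹) (v.normalForm 0) := by
  obtain ⟨⟨h, hh⟩, v, hv⟩ := v
  obtain ⟨h1, h2⟩ := hv.inner hF
  simp only [LinFactPoset.toFun, LinFactPoset.normalForm, if_true] at *
  have hm : ∀ x ∈ (innerList F).map v, x ∈ Submonoid.closure X := fun x hx => by
    obtain ⟨r, -, rfl⟩ := List.mem_map.1 hx
    exact hv.1 r
  have h3 := len_prod_le _ hm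
  rw [List.map_map] at h3
  change _ ≤ ((innerList F).map fun r => len X (v r)).sum at h3
  have hM := Submonoid.list_prod_mem _ hm
  generalize ((innerList F).map v).prod = m at *
  generalize ((innerList F).map fun r => len X (v r)).sum = n at *
  have hc := mem_closure_conj hX g (hv.1 1)
  have hlc := len_conj hX g (v 1)
  generalize hb : g * v 1 * g⁻¹ = b at *
  -- `b * v 0 * m` times a conjugate of the complement of `h` is `g`.
  have he : (b * v 0 * m)⁻¹ * g = v 1 * (h⁻¹ * g) * (v 1)⁻¹ := by
    have : g = v 0 * m * v 1 * (h⁻¹ * g) := by rw [h1]; group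
    have h4 : b * v 0 * m = g * (v 1 * (h⁻¹ * g) * (v 1)⁻¹)⁻¹ := by
      rw [← hb]
      rw [← h1]
      group
    rw [h4]
    group
  have h5 := mem_closure_conj hX (v 1) hh.2.1
  have h6 := len_conj hX (v 1) (h⁻¹ * g)
  rw [← he] at h5 h6
  have hw := Submonoid.mul_mem _ hc (hv.1 0)
  have h7 := len_mul_le hc (hv.1 0)
  have h8 := len_mul_le hw hM
  have h9 := len_mul_le (Submonoid.mul_mem _ hw hM) h5
  rw [mul_inv_cancel_left] at h9
  have h10 := hh.2.2
  refine ⟨⟨Submonoid.mul_mem _ hw hM, h5, by omega⟩, by omega, hc, ?_, ?_⟩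
  · rw [inv_mul_cancel_left]
    exact hv.1 0
  · rw [inv_mul_cancel_left]
    omega

namespace CircFactPoset

theorem normalForm_mk (v : LinFactPoset X g) : (mk v).normalForm = v.normalForm := rfl

/-- Every class has a representative that is equal to its normal form. -/
theorem exists_toFun_eq (hX : ∀ a x, x ∈ X → a * x * a⁻¹ ∈ X) (a : CircFactPoset X g) :
    ∃ u : LinFactPoset X g, mk u = a ∧ u.toFun = a.normalForm := by
  obtain ⟨v, rfl⟩ := Quotient.exists_rep a
  obtain ⟨F, hF⟩ := v.2.2.exists_finset
  have hF : ∀ r, r ≠ 0 → r ≠ 1 → r ∉ F → v.toFun r = 1 := fun r _ _ hr => hF r hr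
  obtain ⟨h1, h2, h3⟩ := v.normalForm_prod hX hF
  have e1 : v.normalForm 1 = 1 := by simp [LinFactPoset.normalForm]
  have hin : ∀ r, r ≠ 0 → r ≠ 1 → v.normalForm r = v.toFun r := by
    intro r h0 h1
    rw [LinFactPoset.normalForm, if_neg h0, if_neg h1]
  have hfact : IsWeightedFact X (v.normalForm 0 * ((innerList F).map v.toFun).prod)
      v.normalForm := by
    refine isWeightedFact_of_inner (F := F) (fun r => ?_) (fun r h0 h1 hr => ?_) ?_ ?_
    · rcases eq_or_ne r 0 with rfl | h0
      · exact h3.mem_right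
      rcases eq_or_ne r 1 with rfl | h1
      · rw [e1]
        exact Submonoid.one_mem _
      · rw [hin r h0 h1]
        exact v.2.2.1 r
    · rw [hin r h0 h1, hF r h0 h1 hr]
    · rw [map_congr_inner hin, e1, mul_one]
    · rw [map_congr_inner (u := fun r => len X (v.normalForm r))
        (v := fun r => len X (v.toFun r)) (fun r h0 h1 => by rw [hin r h0 h1]), e1, len_one,
        add_zero, h2]
  refine ⟨⟨⟨_, h1⟩, ⟨v.normalForm, hfact⟩⟩, Quotient.sound ⟨hin, ?_⟩, rfl⟩
  change g * v.normalForm 1 * g⁻¹ * v.normalForm 0 = _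
  rw [e1]
  simp [LinFactPoset.normalForm]

theorem normalForm_injective (hX : ∀ a x, x ∈ X → a * x * a⁻¹ ∈ X) {a b : CircFactPoset X g}
    (h : a.normalForm = b.normalForm) : a = b := by
  obtain ⟨u, rfl, hu⟩ := exists_toFun_eq hX a
  obtain ⟨v, rfl, hv⟩ := exists_toFun_eq hX b
  rw [← hu, ← hv] at h
  exact Quotient.sound ⟨fun r _ _ => congrFun h r, by rw [h]⟩

/-- The order is the pointwise order of the normal forms. -/
theorem le_iff_normalForm (hX : ∀ a x, x ∈ X → a * x * a⁻¹ ∈ X) {a b : CircFactPoset X g} :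
    a ≤ b ↔ ∀ r, AbsLE X (a.normalForm r) (b.normalForm r) := by
  constructor
  · rintro ⟨v, u, rfl, rfl, h⟩ r
    rw [normalForm_mk, normalForm_mk]
    rcases eq_or_ne r 0 with rfl | h0
    · obtain ⟨F, hF⟩ := u.2.2.exists_finset
      have h3 := (u.normalForm_prod hX (F := F) fun r _ _ hr => hF r hr).2.2
      simp only [LinFactPoset.normalForm, if_true] at h3 ⊢
      exact AbsLE.mul_mul hX ((h 1).conj hX g) (h 0) h3
    · rcases eq_or_ne r 1 with rfl | h1
      · simp only [LinFactPoset.normalForm, h0, if_true, if_false]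
        exact AbsLE.refl (Submonoid.one_mem _)
      · rw [LinFactPoset.normalForm, LinFactPoset.normalForm, if_neg h0, if_neg h1, if_neg h0,
          if_neg h1]
        exact h r
  · intro h
    obtain ⟨u, hu, hu'⟩ := exists_toFun_eq hX a
    obtain ⟨v, hv, hv'⟩ := exists_toFun_eq hX b
    exact ⟨u, v, hu, hv, fun r => by rw [hu', hv']; exact h r⟩

theorem normalForm_absLE (hX : ∀ a x, x ∈ X → a * x * a⁻¹ ∈ X) (a : CircFactPoset X g) (r : I) :
    AbsLE X (a.normalForm r) g := by
  obtain ⟨u, -, hu⟩ := exists_toFun_eq hX a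
  rw [← hu]
  exact (u.2.2.absLE hX r).trans u.1.2

theorem normalForm_mul_absLE (hX : ∀ a x, x ∈ X → a * x * a⁻¹ ∈ X) (a : CircFactPoset X g)
    {r r' : I} (hr : r < r') :
    AbsLE X (a.normalForm r * a.normalForm r') g ∧
      AbsLE X (a.normalForm r) (a.normalForm r * a.normalForm r') := by
  obtain ⟨u, -, hu⟩ := exists_toFun_eq hX a
  rw [← hu]
  obtain ⟨h1, h2⟩ := u.2.2.mul_absLE hX hr
  exact ⟨h1.trans u.1.2, h2⟩

theorem normalForm_one (a : CircFactPoset X g) : a.normalForm 1 = 1 := by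
  obtain ⟨v, rfl⟩ := Quotient.exists_rep a
  change v.normalForm 1 = 1
  simp [LinFactPoset.normalForm]

end CircFactPoset

end MarkedGroup

/-! ### Convex hulls of subsets of the circle -/

theorem exp_turn (z : Circle) : Circle.exp (2 * Real.pi * turn z) = z := by
  have hpi := Real.pi_ne_zero
  conv_rhs => rw [← Circle.exp_arg z]
  rw [Circle.exp_eq_exp]
  refine ⟨-⌊Complex.arg (z : ℂ) / (2 * Real.pi)⌋, ?_⟩
  rw [turn, Int.fract]
  push_cast
  field_simp
  ring

theorem turn_nonneg (z : Circle) : 0 ≤ turn z := Int.fract_nonneg _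

theorem turn_lt_one (z : Circle) : turn z < 1 := Int.fract_lt_one _

theorem turn_injective : Function.Injective turn := by
  intro z w h
  rw [← exp_turn z, ← exp_turn w, h]

theorem turn_exp {x : ℝ} (h0 : 0 ≤ x) (h1 : x < 1) : turn (Circle.exp (2 * Real.pi * x)) = x := by
  obtain ⟨m, hm⟩ := Circle.exp_eq_exp.1 (exp_turn (Circle.exp (2 * Real.pi * x)))
  have h2 := turn_nonneg (Circle.exp (2 * Real.pi * x))
  have h3 := turn_lt_one (Circle.exp (2 * Real.pi * x))
  generalize turn (Circle.exp (2 * Real.pi * x)) = y at *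
  have h4 : y = x + m := by
    have := Real.pi_pos
    have h5 : 2 * Real.pi * (y - (x + m)) = 0 := by linarith
    rcases mul_eq_zero.1 h5 with h6 | h6
    · linarith
    · linarith
  have h5 : (-1 : ℝ) < m := by linarith
  have h6 : (m : ℝ) < 1 := by linarith
  have h7 : m = 0 := by
    have h8 : -1 < m := by exact_mod_cast h5
    have h9 : m < 1 := by exact_mod_cast h6
    omega
  rw [h4, h7, Int.cast_zero, add_zero]

theorem re_eq_cos (z : Circle) : (z : ℂ).re = Real.cos (2 * Real.pi * turn z) := by
  conv_lhs => rw [← exp_turn z]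
  rw [Circle.coe_exp, Complex.exp_ofReal_mul_I_re]

theorem im_eq_sin (z : Circle) : (z : ℂ).im = Real.sin (2 * Real.pi * turn z) := by
  conv_lhs => rw [← exp_turn z]
  rw [Circle.coe_exp, Complex.exp_ofReal_mul_I_im]

/-- A finite subset of the circle is separated by a line from the points outside of the arc that it
spans. -/
theorem disjoint_convexHull_of_arc {A B : Set Circle} (hB : B.Finite) (hne : B.Nonempty)
    (h : ∀ a ∈ A, ∀ b ∈ B, ∀ b' ∈ B, turn b ≤ turn a → turn a ≤ turn b' → False) :
    Disjoint (convexHull ℝ ((fun z : Circle => (z : ℂ)) '' A))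
      (convexHull ℝ ((fun z : Circle => (z : ℂ)) '' B)) := by
  obtain ⟨b₀, hb₀, h0⟩ := hB.exists_minimalFor turn B hne
  obtain ⟨b₁, hb₁, h1⟩ := hB.exists_maximalFor turn B hne
  replace h0 : ∀ b ∈ B, turn b₀ ≤ turn b := fun b hb => (le_total _ _).elim id (h0 hb)
  replace h1 : ∀ b ∈ B, turn b ≤ turn b₁ := fun b hb => (le_total _ _).elim id (h1 hb)
  have hpi := Real.pi_pos
  have h01 := h0 b₁ hb₁
  have hn := turn_nonneg b₀
  have hl := turn_lt_one b₁
  -- The height in the direction of the midpoint of the arc.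
  let m := Real.pi * (turn b₀ + turn b₁)
  let f : ℂ → ℝ := fun z => z.re * Real.cos m + z.im * Real.sin m
  have hf : IsLinearMap ℝ f :=
    ⟨fun x y => by simp only [f, Complex.add_re, Complex.add_im]; ring,
      fun c x => by
        simp only [f, Complex.real_smul, Complex.re_ofReal_mul, Complex.im_ofReal_mul, smul_eq_mul]
        ring⟩
  have hfz : ∀ z : Circle, f z = Real.cos (2 * Real.pi * turn z - m) := by
    intro z
    rw [Real.cos_sub, ← re_eq_cos, ← im_eq_sin]
  let c := Real.cos (Real.pi * (turn b₁ - turn b₀))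
  have hBc : convexHull ℝ ((fun z : Circle => (z : ℂ)) '' B) ⊆ {w | c ≤ f w} := by
    refine convexHull_min ?_ (convex_halfSpace_ge hf c)
    rintro _ ⟨b, hb, rfl⟩
    change c ≤ f b
    rw [hfz, ← Real.cos_abs (2 * Real.pi * turn b - m)]
    have h2 := h0 b hb
    have h3 := h1 b hb
    refine Real.cos_le_cos_of_nonneg_of_le_pi (abs_nonneg _) (by nlinarith) ?_
    rw [abs_le]
    constructor <;> nlinarith
  have hAc : convexHull ℝ ((fun z : Circle => (z : ℂ)) '' A) ⊆ {w | f w < c} := by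
    refine convexHull_min ?_ (convex_halfSpace_lt hf c)
    rintro _ ⟨a, ha, rfl⟩
    change f a < c
    rw [hfz]
    have hn' := turn_nonneg a
    have hl' := turn_lt_one a
    -- The angle from the midpoint, which is larger than half of the arc on both sides.
    have key : ∀ φ : ℝ, turn b₁ - turn b₀ < φ → φ < 2 - (turn b₁ - turn b₀) →
        Real.cos (Real.pi * φ) < c := by
      intro φ h2 h3
      rcases le_total φ 1 with h4 | h4
      · exact Real.cos_lt_cos_of_nonneg_of_le_pi (by nlinarith) (by nlinarith) (by nlinarith)
      · rw [← Real.cos_two_pi_sub]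
        exact Real.cos_lt_cos_of_nonneg_of_le_pi (by nlinarith) (by nlinarith) (by nlinarith)
    by_cases h2 : turn b₀ ≤ turn a
    · have h3 : turn b₁ < turn a := not_le.1 fun h3 => h a ha b₀ hb₀ b₁ hb₁ h2 h3
      have := key (2 * turn a - (turn b₀ + turn b₁)) (by linarith) (by linarith)
      rwa [show Real.pi * (2 * turn a - (turn b₀ + turn b₁)) = 2 * Real.pi * turn a - m by
        simp only [m]; ring] at this
    · have := key ((turn b₀ + turn b₁) - 2 * turn a) (by linarith) (by linarith)
      rw [← Real.cos_neg]
      rwa [show Real.pi * ((turn b₀ + turn b₁) - 2 * turn a) = -(2 * Real.pi * turn a - m) by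
        simp only [m]; ring] at this
  rw [Set.disjoint_left]
  intro z hz hz'
  exact absurd (show f z < c from hAc hz) (not_lt.2 (show c ≤ f z from hBc hz'))

/-- A triangle with vertices in counterclockwise order on the circle has positive area. -/
theorem area_pos {α β γ : ℝ} (h1 : α < β) (h2 : β < γ) (h3 : γ < α + 2 * Real.pi) :
    0 < (Real.cos β - Real.cos α) * (Real.sin γ - Real.sin α) -
      (Real.cos γ - Real.cos α) * (Real.sin β - Real.sin α) := by
  have h4 : 0 < Real.sin ((β - α) / 2) := Real.sin_pos_of_pos_of_lt_pi (by linarith) (by linarith)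
  have h5 : 0 < Real.sin ((γ - β) / 2) := Real.sin_pos_of_pos_of_lt_pi (by linarith) (by linarith)
  have h6 : 0 < Real.sin ((γ - α) / 2) := Real.sin_pos_of_pos_of_lt_pi (by linarith) (by linarith)
  have h7 : Real.sin ((γ - β) / 2) = Real.sin ((γ + α) / 2) * Real.cos ((β + α) / 2) -
      Real.cos ((γ + α) / 2) * Real.sin ((β + α) / 2) := by
    rw [← Real.sin_sub]
    congr 1
    ring
  rw [Real.cos_sub_cos, Real.cos_sub_cos, Real.sin_sub_sin, Real.sin_sub_sin]
  have h8 := mul_pos (mul_pos h4 h6) h5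
  rw [h7] at h8
  linarith

/-- Crossing chords of the circle intersect. -/
theorem not_disjoint_convexHull_of_crossing {A B : Set Circle} {a a' b b' : Circle} (ha : a ∈ A)
    (ha' : a' ∈ A) (hb : b ∈ B) (hb' : b' ∈ B) (h1 : turn a < turn b) (h2 : turn b < turn a')
    (h3 : turn a' < turn b') :
    ¬ Disjoint (convexHull ℝ ((fun z : Circle => (z : ℂ)) '' A))
      (convexHull ℝ ((fun z : Circle => (z : ℂ)) '' B)) := by
  have hpi := Real.pi_pos
  have h0 := turn_nonneg a
  have h4 := turn_lt_one b'
  have area : ∀ {x y z : Circle}, turn x < turn y → turn y < turn z → turn a ≤ turn x →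
      turn z ≤ turn b' → 0 < ((y : ℂ).re - (x : ℂ).re) * ((z : ℂ).im - (x : ℂ).im) -
        ((z : ℂ).re - (x : ℂ).re) * ((y : ℂ).im - (x : ℂ).im) := by
    intro x y z hxy hyz hx hz
    rw [re_eq_cos, re_eq_cos, re_eq_cos, im_eq_sin, im_eq_sin, im_eq_sin]
    exact area_pos (by nlinarith) (by nlinarith) (by nlinarith)
  -- Each vertex of the quadrilateral is weighted by the area of the triangle of the other three.
  have e1 := area h2 h3 h1.le le_rfl
  have e2 := area h1 (h2.trans h3) le_rfl le_rfl
  have e3 := area (h1.trans h2) h3 le_rfl le_rfl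
  have e4 := area h1 h2 le_rfl h3.le
  have hsum : ∀ {P Q : ℝ}, 0 < P → 0 < Q → ∀ z w : Circle,
      (((P / (P + Q) : ℝ) : ℂ) * z + ((Q / (P + Q) : ℝ) : ℂ) * w) ∈ segment ℝ (z : ℂ) (w : ℂ) := by
    intro P Q hP hQ z w
    refine ⟨P / (P + Q), Q / (P + Q), by positivity, by positivity, by field_simp, ?_⟩
    rw [Complex.real_smul, Complex.real_smul]
  rw [Set.not_disjoint_iff]
  refine ⟨_, segment_subset_convexHull (𝕜 := ℝ) (s := (fun z : Circle => (z : ℂ)) '' A)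
    ⟨a, ha, rfl⟩ ⟨a', ha', rfl⟩ (hsum e1 e2 a a'), ?_⟩
  have hmem := segment_subset_convexHull (𝕜 := ℝ) (s := (fun z : Circle => (z : ℂ)) '' B)
    ⟨b, hb, rfl⟩ ⟨b', hb', rfl⟩ (hsum e3 e4 b b')
  convert hmem using 1
  generalize (a : ℂ) = a at *
  generalize (a' : ℂ) = a' at *
  generalize (b : ℂ) = b at *
  generalize (b' : ℂ) = b' at *
  have e : ∀ {P Q R T x y z w : ℝ}, P + Q = R + T → P * x + Q * y = R * z + T * w →
      P / (P + Q) * x + Q / (P + Q) * y = R / (R + T) * z + T / (R + T) * w := by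
    intro P Q R T x y z w h5 h6
    rw [div_mul_eq_mul_div, div_mul_eq_mul_div, div_mul_eq_mul_div, div_mul_eq_mul_div, ← add_div,
      ← add_div, h5, h6]
  apply Complex.ext
  · simp only [Complex.add_re, Complex.re_ofReal_mul]
    exact e (by ring) (by ring)
  · simp only [Complex.add_im, Complex.im_ofReal_mul]
    exact e (by ring) (by ring)

/-! ### Coordinates on the circle -/

section Coordinates

variable {d : ℕ}

theorem powerTurn_lt_one (z : Circle) : powerTurn d z < 1 := Int.fract_lt_one (d * turn z)

variable [NeZero d]

theorem natCast_pos_of_neZero (d : ℕ) [NeZero d] : (0 : ℝ) < d := by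
  exact_mod_cast Nat.pos_of_ne_zero (NeZero.ne d)

theorem rootIndex_add_powerTurn (z : Circle) :
    ((rootIndex d z : ℕ) : ℝ) + (powerTurn d z : ℝ) = d * turn z := by
  have h : 0 ≤ d * turn z := mul_nonneg (natCast_pos_of_neZero d).le (turn_nonneg z)
  change ((⌊d * turn z⌋₊ : ℕ) : ℝ) + Int.fract (d * turn z) = _
  rw [natCast_floor_eq_intCast_floor h, Int.floor_add_fract]

theorem pow_eq_exp (z : Circle) : z ^ d = Circle.exp (2 * Real.pi * powerTurn d z) := by
  conv_lhs => rw [← exp_turn z]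
  rw [← Circle.exp_natCast_mul, Circle.exp_eq_exp]
  refine ⟨rootIndex d z, ?_⟩
  have := rootIndex_add_powerTurn (d := d) z
  have h : (d : ℝ) * (2 * Real.pi * turn z) = 2 * Real.pi * (d * turn z) := by ring
  rw [h, ← this]
  push_cast
  ring

theorem pow_eq_pow_iff {z w : Circle} : z ^ d = w ^ d ↔ powerTurn d z = powerTurn d w := by
  rw [pow_eq_exp, pow_eq_exp]
  refine ⟨fun h => Subtype.ext ?_, fun h => by rw [h]⟩
  have h1 := congrArg turn h
  rwa [turn_exp (powerTurn d z).2.1 (powerTurn_lt_one z),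
    turn_exp (powerTurn d w).2.1 (powerTurn_lt_one w)] at h1

/-- The `d`-th root of `exp (2 π i s)` with number `i`. -/
noncomputable def circlePoint (i : Fin d) (s : I) : Circle :=
  Circle.exp (2 * Real.pi * ((i.1 + s) / d))

theorem turn_circlePoint (i : Fin d) {s : I} (hs : s < 1) :
    turn (circlePoint i s) = (i.1 + s) / d := by
  have hd := natCast_pos_of_neZero d
  have h1 : ((i.1 + 1 : ℕ) : ℝ) ≤ d := by exact_mod_cast i.2
  have h2 : (s : ℝ) < 1 := hs
  push_cast at h1
  refine turn_exp (div_nonneg (add_nonneg (Nat.cast_nonneg _) s.2.1) hd.le) ?_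
  rw [div_lt_one hd]
  linarith

theorem coordinates_circlePoint (i : Fin d) {s : I} (hs : s < 1) :
    rootIndex d (circlePoint i s) = i ∧ powerTurn d (circlePoint i s) = s := by
  have h1 : d * turn (circlePoint i s) = i.1 + s := by
    rw [turn_circlePoint i hs, mul_div_cancel₀ _ (natCast_pos_of_neZero d).ne']
  have h2 : (s : ℝ) < 1 := hs
  constructor
  · refine Fin.ext ?_
    change ⌊d * turn (circlePoint i s)⌋₊ = i.1
    rw [h1, Nat.floor_eq_iff (add_nonneg (Nat.cast_nonneg _) s.2.1)]
    exact ⟨by linarith [s.2.1], by linarith⟩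
  · refine Subtype.ext ?_
    change Int.fract (d * turn (circlePoint i s)) = s
    rw [h1, Int.fract_natCast_add, Int.fract_eq_self.2 ⟨s.2.1, h2⟩]

theorem circlePoint_coordinates (z : Circle) :
    circlePoint (rootIndex d z) (powerTurn d z) = z := by
  apply turn_injective
  rw [turn_circlePoint _ (powerTurn_lt_one z), rootIndex_add_powerTurn,
    mul_div_cancel_left₀ _ (natCast_pos_of_neZero d).ne']

theorem turn_lt_iff {z w : Circle} : turn z < turn w ↔
    ((rootIndex d z : ℕ) : ℝ) + powerTurn d z < (rootIndex d w : ℕ) + powerTurn d w := by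
  rw [rootIndex_add_powerTurn, rootIndex_add_powerTurn,
    mul_lt_mul_iff_right₀ (natCast_pos_of_neZero d)]

end Coordinates

/-! ### Noncrossing partitions of the circle -/

/-- Classes whose points have the same `d`-th power have disjoint convex hulls if and only if no two
of them cross. -/
theorem mem_noncrossingPartitions_iff {d : ℕ} [NeZero d] {π : Setoid Circle} :
    π ∈ noncrossingPartitions d ↔ (∀ z w : Circle, π z w → powerTurn d z = powerTurn d w) ∧
      ∀ z w z' w' : Circle, turn z < turn w → turn w < turn z' → turn z' < turn w' →
        π z z' → π w w' → π z w := by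
  constructor
  · rintro ⟨h1, h2⟩
    refine ⟨fun z w h => pow_eq_pow_iff.1 (h1 z w h), fun z w z' w' h3 h4 h5 hz hw => ?_⟩
    by_contra hzw
    have hA : {x | π x z} ∈ π.classes := ⟨z, rfl⟩
    have hB : {x | π x w} ∈ π.classes := ⟨w, rfl⟩
    have hne : {x | π x z} ≠ {x | π x w} := by
      intro h
      have : z ∈ {x | π x w} := h ▸ π.refl z
      exact hzw this
    exact not_disjoint_convexHull_of_crossing (A := {x | π x z}) (B := {x | π x w}) (π.refl' z)
      (π.symm' hz) (π.refl' w) (π.symm' hw) h3 h4 h5 (h2 hA hB hne)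
  · rintro ⟨h1, h2⟩
    refine ⟨fun z w h => pow_eq_pow_iff.2 (h1 z w h), ?_⟩
    have hfin : ∀ x : Circle, {y | π y x}.Finite := by
      intro x
      refine Set.Finite.of_finite_image (f := rootIndex d) (Set.toFinite _) ?_
      intro y hy y' hy' hyy
      rw [← circlePoint_coordinates (d := d) y, ← circlePoint_coordinates (d := d) y', hyy,
        h1 y x hy, h1 y' x hy']
    -- The class that contains the smallest argument has no point in the arc spanned by the other.
    have key : ∀ x y : Circle, ¬ π x y → ∀ z, π z x → (∀ w, π w y → turn z < turn w) →
        Disjoint (convexHull ℝ ((fun z : Circle => (z : ℂ)) '' {z | π z x}))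
          (convexHull ℝ ((fun z : Circle => (z : ℂ)) '' {z | π z y})) := by
      intro x y hxy z hz hmin
      refine disjoint_convexHull_of_arc (hfin y) ⟨y, π.refl y⟩ fun a ha b hb b' hb' h3 h4 => ?_
      have hab : ∀ c, π c y → turn c ≠ turn a := by
        intro c hc h
        rw [turn_injective h] at hc
        exact hxy (π.trans (π.symm ha) hc)
      have := h2 z b a b' (hmin b hb) (lt_of_le_of_ne h3 (hab b hb))
        (lt_of_le_of_ne h4 (hab b' hb').symm) (π.trans hz (π.symm ha)) (π.trans hb (π.symm hb'))
      exact hxy (π.trans (π.symm hz) (π.trans this hb))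
    rintro _ ⟨x, rfl⟩ _ ⟨y, rfl⟩ hne
    have hxy : ¬ π x y := by
      intro h
      refine hne (Set.ext fun z => ⟨fun hz => π.trans hz h, fun hz => π.trans hz (π.symm h)⟩)
    obtain ⟨z, hz, hz'⟩ := (hfin x).exists_minimalFor turn _ ⟨x, π.refl x⟩
    obtain ⟨w, hw, hw'⟩ := (hfin y).exists_minimalFor turn _ ⟨y, π.refl y⟩
    have hne' : turn z ≠ turn w := by
      intro h
      rw [turn_injective h] at hz
      exact hxy (π.trans (π.symm hz) hw)
    rcases lt_or_gt_of_ne hne' with h | h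
    · exact key x y hxy z hz fun v hv => h.trans_le ((le_total _ _).elim id (hw' hv))
    · exact (key y x (fun h => hxy (π.symm h)) w hw
        fun v hv => h.trans_le ((le_total _ _).elim id (hz' hv))).symm

/-! ### The partition of a circular factorization -/

namespace MarkedGroup

open Equiv Equiv.Perm

variable {d : ℕ}

theorem sameCycle_of_crossing {x : Perm (Fin d)} (hx : AbsLE (transpositions d) x (finRotate d))
    {i j i' j' : Fin d} (h1 : i < j) (h2 : j < i') (h3 : i' < j') (hi : SameCycle x i i')
    (hj : SameCycle x j j') : SameCycle x i j := by
  by_contra h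
  have hii := h1.trans h2
  have hm := sameCycle_swap_mul_iff (not_sameCycle_swap_mul hii.ne hi) (a := j) (b := j')
  have hm' := sameCycle_swap_mul_iff (not_sameCycle_swap_mul hii.ne hi) (a := i) (b := j)
  rw [← mul_assoc, swap_mul_self, one_mul] at hm hm'
  rcases hm.1 hj with h4 | ⟨h4, -⟩
  · have h5 := ((sameCycle_swap_mul_iff_side hx hii hi).1 h4).2.1 ⟨h1.le, h2⟩
    exact absurd h5.2 (not_lt.2 h3.le)
  · exact h (hm'.2 (Or.inr ⟨Or.inl (SameCycle.refl _ _), h4⟩))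

/-- In a product below the `d`-cycle, the cycles of the second factor do not cross the cycles of
the first factor. -/
theorem side_of_mul_le {x y : Perm (Fin d)}
    (hxy : AbsLE (transpositions d) (x * y) (finRotate d))
    (hx : AbsLE (transpositions d) x (x * y)) {i i' : Fin d} (hi : i < i') (h : SameCycle x i i')
    {j j' : Fin d} (hj : SameCycle y j j') : j ∈ Set.Ico i i' ↔ j' ∈ Set.Ico i i' := by
  have h1 := (swap_mul_le hi.ne h hx).right_factor transpositions_conj
  rw [show (swap i i' * x)⁻¹ * (swap i i' * (x * y)) = y by group] at h1
  exact ((sameCycle_swap_mul_iff_side hxy hi (hx.sameCycle h)).1 (h1.sameCycle hj)).2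

theorem le_of_add_lt {a b : Fin d} {s s' : I} (hs' : s' < 1) (h : (a.1 : ℝ) + s < b.1 + s') :
    a ≤ b := by
  have h1 : (s' : ℝ) < 1 := hs'
  have h2 := s.2.1
  have h3 : (a.1 : ℝ) < ((b.1 + 1 : ℕ) : ℝ) := by
    push_cast
    linarith
  exact Nat.lt_succ_iff.1 (by exact_mod_cast h3)

theorem lt_of_add_lt {a b : Fin d} {s s' : I} (hs : s' ≤ s) (h : (a.1 : ℝ) + s < b.1 + s') :
    a < b := by
  have h1 : (s' : ℝ) ≤ s := hs
  have h3 : (a.1 : ℝ) < (b.1 : ℝ) := by linarith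
  exact_mod_cast h3

theorem add_lt_of_le {a b : Fin d} {s s' : I} (hs : s < s') (h : a ≤ b) :
    (a.1 : ℝ) + s < b.1 + s' := by
  have h1 : (s : ℝ) < s' := hs
  have h2 : (a.1 : ℝ) ≤ b.1 := by exact_mod_cast h
  linarith

theorem add_lt_of_lt {a b : Fin d} {s s' : I} (hs : s < 1) (h : a < b) :
    (a.1 : ℝ) + s < b.1 + s' := by
  have h1 : (s : ℝ) < 1 := hs
  have h2 : ((a.1 + 1 : ℕ) : ℝ) ≤ b.1 := by exact_mod_cast h
  push_cast at h2
  linarith [s'.2.1]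

/-- The blocks of the partition of a class do not cross: by `mem_noncrossingPartitions_iff`, this is
a statement on at most two entries of a geodesic factorization. -/
theorem circlePartition_mem [NeZero d] (a : SymCircFactPoset d) :
    circlePartition d a ∈ noncrossingPartitions d := by
  rw [mem_noncrossingPartitions_iff]
  refine ⟨fun z w h => h.1, ?_⟩
  rintro z w z' w' h1 h2 h3 ⟨hs, hz⟩ ⟨hs', hw⟩
  rw [turn_lt_iff (d := d)] at h1 h2 h3
  have hlt := powerTurn_lt_one (d := d) z
  have hlt' := powerTurn_lt_one (d := d) w
  change powerTurn d z = powerTurn d w ∧ SameCycle _ _ _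
  rw [← hs] at h2 h3
  rw [← hs'] at h3
  generalize rootIndex d z = i at *
  generalize rootIndex d w = j at *
  generalize rootIndex d z' = i' at *
  generalize rootIndex d w' = j' at *
  generalize powerTurn d z = s at *
  generalize powerTurn d w = s' at *
  rcases lt_trichotomy s s' with h | h | h
  · exfalso
    have hij := le_of_add_lt hlt' h1
    have hji := lt_of_add_lt h.le h2
    have hij' := le_of_add_lt hlt' h3
    obtain ⟨h4, h5⟩ := a.normalForm_mul_absLE transpositions_conj h
    have h6 := (side_of_mul_le h4 h5 (hij.trans_lt hji) hz hw).1 ⟨hij, hji⟩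
    exact absurd h6.2 (not_lt.2 hij')
  · subst h
    exact ⟨rfl, sameCycle_of_crossing (a.normalForm_absLE transpositions_conj s)
      (lt_of_add_lt le_rfl h1) (lt_of_add_lt le_rfl h2) (lt_of_add_lt le_rfl h3) hz hw⟩
  · exfalso
    have hij := lt_of_add_lt h.le h1
    have hji := le_of_add_lt hlt h2
    have hij' := lt_of_add_lt h.le h3
    obtain ⟨h4, h5⟩ := a.normalForm_mul_absLE transpositions_conj h
    have h6 := (side_of_mul_le h4 h5 (hji.trans_lt hij') hw hz).2 ⟨hji, hij'⟩
    exact absurd h6.1 (not_le.2 hij)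

/-- The partition determines the order. -/
theorem circlePartition_le_iff [NeZero d] {a b : SymCircFactPoset d} :
    circlePartition d a ≤ circlePartition d b ↔ a ≤ b := by
  rw [CircFactPoset.le_iff_normalForm transpositions_conj]
  constructor
  · intro h r
    rcases eq_or_lt_of_le (unitInterval.le_one' (t := r)) with rfl | hr
    · rw [a.normalForm_one, b.normalForm_one]
      exact AbsLE.refl (Submonoid.one_mem _)
    · refine absLE_of_sameCycle (a.normalForm_absLE transpositions_conj r)
        (b.normalForm_absLE transpositions_conj r) fun i j hij => ?_
      obtain ⟨h1, h2⟩ := coordinates_circlePoint i hr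
      obtain ⟨h3, h4⟩ := coordinates_circlePoint j hr
      have h5 : circlePartition d a (circlePoint i r) (circlePoint j r) := by
        change _ ∧ SameCycle _ _ _
        rw [h1, h2, h3, h4]
        exact ⟨rfl, hij⟩
      have h6 : _ ∧ SameCycle _ _ _ := h h5
      rw [h1, h2, h3] at h6
      exact h6.2
  · rintro h z w ⟨h1, h2⟩
    exact ⟨h1, (h _).sameCycle h2⟩

/-! ### Noncrossing families of partitions -/

/-- A family of partitions of `Fin d` is noncrossing on `L` if no two blocks cross, when the member
`i` of the set at `s` has the position `i + s`. -/
def CrossFree (L : List I) (π : I → Setoid (Fin d)) : Prop :=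
  ∀ s ∈ L, ∀ s' ∈ L, ∀ i j i' j' : Fin d, (i.1 : ℝ) + s < j.1 + s' → (j.1 : ℝ) + s' < i'.1 + s →
    (i'.1 : ℝ) + s < j'.1 + s' → π s i i' → π s' j j' → s = s' ∧ π s i j

/-- The refinement of a partition that separates the points inside and outside of the half-open
interval from `p` to `q`. -/
def splitAt (p q : Fin d) (r : Setoid (Fin d)) : Setoid (Fin d) where
  r a b := r a b ∧ (a ∈ Set.Ico p q ↔ b ∈ Set.Ico p q)
  iseqv := ⟨fun a => ⟨r.refl' a, Iff.rfl⟩, fun h => ⟨r.symm' h.1, h.2.symm⟩,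
    fun h h' => ⟨r.trans' h.1 h'.1, h.2.trans h'.2⟩⟩

theorem CrossFree.splitAt {L : List I} {π : I → Setoid (Fin d)} (h : CrossFree L π)
    (p q : Fin d) : CrossFree L fun s => splitAt p q (π s) := by
  rintro s hs s' hs' i j i' j' h1 h2 h3 ⟨h4, h4'⟩ ⟨h5, h5'⟩
  obtain ⟨rfl, h6⟩ := h s hs s' hs' i j i' j' h1 h2 h3 h4 h5
  have h1 := lt_of_add_lt le_rfl h1
  have h2 := lt_of_add_lt le_rfl h2
  have h3 := lt_of_add_lt le_rfl h3
  refine ⟨rfl, h6, fun hi => ?_, fun hj => ?_⟩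
  · exact ⟨hi.1.trans h1.le, h2.trans (h4'.1 hi).2⟩
  · exact h4'.2 ⟨hj.1.trans h2.le, h3.trans (h5'.1 hj).2⟩

theorem CrossFree.mono {L L' : List I} {π : I → Setoid (Fin d)} (h : CrossFree L π)
    (hL : ∀ s ∈ L', s ∈ L) : CrossFree L' π :=
  fun s hs s' hs' => h s (hL s hs) s' (hL s' hs')

/-- A block at the first position is not crossed by the blocks at later positions. -/
theorem CrossFree.side {s : I} {L : List I} (hL : (s :: L).Pairwise (· < ·))
    (hL1 : ∀ u ∈ s :: L, u < 1) {π : I → Setoid (Fin d)} (h : CrossFree (s :: L) π) {i i' : Fin d}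
    (hi : π s i i') {u : I} (hu : u ∈ L) {j j' : Fin d} (hj : π u j j') :
    j ∈ Set.Ico i i' ↔ j' ∈ Set.Ico i i' := by
  have hsu : s < u := (List.pairwise_cons.1 hL).1 u hu
  have hs := List.mem_cons_self (a := s) (l := L)
  have hu' := List.mem_cons_of_mem s hu
  have hu1 := hL1 u hu'
  have key : ∀ {j j' : Fin d}, π u j j' → j ∈ Set.Ico i i' → j' ∈ Set.Ico i i' := by
    intro j j' hj h1
    by_contra h2
    by_cases h3 : i ≤ j'
    · have h4 : i' ≤ j' := not_lt.1 fun h4 => h2 ⟨h3, h4⟩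
      exact hsu.ne (h s hs u hu' i j i' j' (add_lt_of_le hsu h1.1) (add_lt_of_lt hu1 h1.2)
        (add_lt_of_le hsu h4) hi hj).1
    · exact hsu.ne' (h u hu' s hs j' i j i' (add_lt_of_lt hu1 (not_le.1 h3))
        (add_lt_of_le hsu h1.1) (add_lt_of_lt hu1 h1.2) ((π u).symm' hj) hi).1
  exact ⟨key hj, key ((π u).symm' hj)⟩

/-- The points of a block on the two sides of an interval that is bounded by two related points are
related to these two points. -/
theorem CrossFree.rel_left {L : List I} {π : I → Setoid (Fin d)} (h : CrossFree L π) {s : I}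
    (hs : s ∈ L) {i i' a b : Fin d} (hi : π s i i') (hab : π s a b) (ha : a ∈ Set.Ico i i')
    (hb : b ∉ Set.Ico i i') : π s i a := by
  rcases eq_or_lt_of_le ha.1 with rfl | hia
  · exact (π s).refl' i
  have hadd : ∀ {a b : Fin d}, a < b → (a.1 : ℝ) + s < b.1 + s := fun h =>
    add_lt_add_left (by exact_mod_cast h) _
  by_cases h1 : i ≤ b
  · rcases eq_or_lt_of_le (not_lt.1 fun h2 => hb ⟨h1, h2⟩) with rfl | h2
    · exact (π s).trans' hi ((π s).symm' hab)
    · exact (h s hs s hs i a i' b (hadd hia) (hadd ha.2) (hadd h2) hi hab).2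
  · have := (h s hs s hs b i a i' (hadd (not_le.1 h1)) (hadd hia) (hadd ha.2)
      ((π s).symm' hab) hi).2
    exact (π s).symm' ((π s).trans' hab this)

theorem sameCycle_one_iff {a b : Fin d} : SameCycle (1 : Perm (Fin d)) a b ↔ a = b := by
  simp

/-- A noncrossing family of partitions that refine the cycles of `c` is the family of cycle
partitions of a geodesic factorization of an element below `c`. -/
theorem exists_geodesic_of_crossFree (L : List I) (hL : L.Pairwise (· < ·))
    (hL1 : ∀ u ∈ L, u < 1) (c : Perm (Fin d)) (hc : AbsLE (transpositions d) c (finRotate d))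
    (π : I → Setoid (Fin d)) (hπ : ∀ s ∈ L, ∀ a b, π s a b → SameCycle c a b)
    (hcross : CrossFree L π) :
    ∃ z : I → Perm (Fin d), (∀ s ∈ L, ∀ a b, SameCycle (z s) a b ↔ π s a b) ∧
      Geodesic (transpositions d) (L.map z) ∧ AbsLE (transpositions d) (L.map z).prod c := by
  induction L generalizing c π with
  | nil =>
    exact ⟨1, by simp, ⟨by simp, by simp [len_one]⟩,
      one_le_of_mem (mem_closure_transpositions c)⟩
  | cons s L ihL =>
    have hsL : s ∉ L := fun h => ((List.pairwise_cons.1 hL).1 s h).false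
    have hmap : ∀ (z : I → Perm (Fin d)) x, (s :: L).map (Function.update z s x) =
        x :: L.map z := by
      intro z x
      rw [List.map_cons, Function.update_self]
      congr 1
      refine List.map_congr_left fun u hu => Function.update_of_ne ?_ _ _
      rintro rfl
      exact hsL hu
    have hupd : ∀ (z : I → Perm (Fin d)) x, ∀ u ∈ L, Function.update z s x u = z u := by
      intro z x u hu
      refine Function.update_of_ne ?_ _ _
      rintro rfl
      exact hsL hu
    induction hn : len (transpositions d) c using Nat.strong_induction_on generalizing c π with
    | _ n ihn =>
      by_cases htriv : ∀ a b, π s a b → a = b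
      · obtain ⟨z, h2, h3, h4⟩ := ihL (List.pairwise_cons.1 hL).2
          (fun u hu => hL1 u (List.mem_cons_of_mem _ hu)) c hc π
          (fun s hs => hπ s (List.mem_cons_of_mem _ hs))
          (hcross.mono fun s hs => List.mem_cons_of_mem _ hs)
        refine ⟨Function.update z s 1, fun u hu a b => ?_, ?_, ?_⟩
        · rcases List.mem_cons.1 hu with rfl | hu
          · rw [Function.update_self, sameCycle_one_iff]
            exact ⟨fun h => h ▸ (π u).refl' a, htriv a b⟩
          · rw [hupd z 1 u hu]
            exact h2 u hu a b
        · rw [hmap]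
          exact h3.cons (Submonoid.one_mem _) (by simp [len_one])
        · rw [hmap, List.prod_cons, one_mul]
          exact h4
      -- Split off the transposition of two related points at the first position.
      obtain ⟨i, i', hii, hi⟩ : ∃ i i', i < i' ∧ π s i i' := by
        push Not at htriv
        obtain ⟨a, b, hab, hne⟩ := htriv
        rcases lt_or_gt_of_ne hne with h | h
        exacts [⟨a, b, h, hab⟩, ⟨b, a, h, (π s).symm' hab⟩]
      have hs := List.mem_cons_self (a := s) (l := L)
      have hci := hπ s hs _ _ hi
      have htc := (swap_le_iff hii.ne).2 hci
      have ht := swap_mem_transpositions hii.ne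
      have hle := htc.right_factor transpositions_conj
      have hlen := htc.2.2
      rw [swap_inv] at hle hlen
      rw [len_swap hii.ne] at hlen
      obtain ⟨z, h1, h2, h3⟩ := ihn _ (by omega) (swap i i' * c) (hle.trans hc)
        (fun s => splitAt i i' (π s))
        (fun u hu a b hab => (sameCycle_swap_mul_iff_side hc hii hci).2
          ⟨hπ u hu a b hab.1, hab.2⟩)
        (hcross.splitAt i i') rfl
      rw [List.map_cons] at h2 h3
      obtain ⟨h4, h5⟩ := h2.of_cons
      rw [List.prod_cons] at h3
      obtain ⟨h6, h7⟩ := htc.mul_le (by rwa [swap_inv])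
      obtain ⟨-, h8⟩ := htc.mul_le (y := z s) (by rw [swap_inv]; exact h5.trans h3)
      refine ⟨Function.update z s (swap i i' * z s), fun u hu a b => ?_, ?_, ?_⟩
      · rcases List.mem_cons.1 hu with rfl | hu
        · rw [Function.update_self]
          have hsplit : ∀ a b, SameCycle (z u) a b ↔
              π u a b ∧ (a ∈ Set.Ico i i' ↔ b ∈ Set.Ico i i') := h1 u hs
          have hin : i ∈ Set.Ico i i' := ⟨le_rfl, hii⟩
          have hout : i' ∉ Set.Ico i i' := fun h => h.2.false
          rw [sameCycle_swap_mul_iff fun h => hout (((hsplit _ _).1 h).2.1 hin)]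
          simp only [hsplit]
          have hfrom : ∀ {a}, (π u i a ∧ (i ∈ Set.Ico i i' ↔ a ∈ Set.Ico i i') ∨
              π u i' a ∧ (i' ∈ Set.Ico i i' ↔ a ∈ Set.Ico i i')) → π u i a :=
            fun h => h.elim And.left fun h => (π u).trans' hi h.1
          have hto : ∀ {a}, π u i a → (π u i a ∧ (i ∈ Set.Ico i i' ↔ a ∈ Set.Ico i i') ∨
              π u i' a ∧ (i' ∈ Set.Ico i i' ↔ a ∈ Set.Ico i i')) := by
            intro a ha
            by_cases h : a ∈ Set.Ico i i'
            · exact Or.inl ⟨ha, iff_of_true hin h⟩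
            · exact Or.inr ⟨(π u).trans' ((π u).symm' hi) ha, iff_of_false hout h⟩
          constructor
          · rintro (h | ⟨ha, hb⟩)
            · exact h.1
            · exact (π u).trans' ((π u).symm' (hfrom ha)) (hfrom hb)
          · intro hab
            by_cases hside : a ∈ Set.Ico i i' ↔ b ∈ Set.Ico i i'
            · exact Or.inl ⟨hab, hside⟩
            · right
              have hia : π u i a := by
                by_cases ha : a ∈ Set.Ico i i'
                · exact hcross.rel_left hs hi hab ha fun hb => hside (iff_of_true ha hb)
                · have hb : b ∈ Set.Ico i i' := by_contra fun hb => hside (iff_of_false ha hb)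
                  exact (π u).trans' (hcross.rel_left hs hi ((π u).symm' hab) hb ha)
                    ((π u).symm' hab)
              exact ⟨hto hia, hto ((π u).trans' hia hab)⟩
        · rw [hupd _ _ u hu]
          refine (h1 u (List.mem_cons_of_mem _ hu) a b).trans
            ⟨fun h => h.1, fun h => ⟨h, hcross.side hL hL1 hi hu h⟩⟩
      · rw [hmap]
        refine h4.cons (mem_closure_transpositions _) ?_
        have h9 := h5.2.2
        rw [inv_mul_cancel_left] at h9
        rw [mul_assoc, h7, h8, ← h9, add_assoc]
      · rw [hmap, List.prod_cons, mul_assoc]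
        exact h6

end MarkedGroup

/-! ### The isomorphism with the noncrossing partitions of the circle -/

namespace MarkedGroup

open Equiv Equiv.Perm

variable {d : ℕ}

theorem len_pos_of_sameCycle {x : Perm (Fin d)} {i j : Fin d} (hij : i ≠ j)
    (h : SameCycle x i j) : 0 < len (transpositions d) x := by
  have := ((swap_le_iff hij).2 h).len_le
  rw [len_swap hij] at this
  exact this

/-- The partition of the set of `d`-th roots of `exp (2 π i s)`, in terms of their numbers. -/
noncomputable def fiberSetoid [NeZero d] (π : Setoid Circle) (s : I) : Setoid (Fin d) :=
  π.comap fun i => circlePoint i s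

theorem crossFree_fiberSetoid [NeZero d] {π : Setoid Circle} (hπ : π ∈ noncrossingPartitions d)
    {L : List I} (hL : ∀ s ∈ L, s < 1) : CrossFree L (fiberSetoid (d := d) π) := by
  intro s hs s' hs' i j i' j' h1 h2 h3 h4 h5
  have hd := natCast_pos_of_neZero d
  have h := (mem_noncrossingPartitions_iff.1 hπ).2 (circlePoint i s) (circlePoint j s')
    (circlePoint i' s) (circlePoint j' s')
    (by rwa [turn_circlePoint _ (hL s hs), turn_circlePoint _ (hL s' hs'),
      div_lt_div_iff_of_pos_right hd])
    (by rwa [turn_circlePoint _ (hL s hs), turn_circlePoint _ (hL s' hs'),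
      div_lt_div_iff_of_pos_right hd])
    (by rwa [turn_circlePoint _ (hL s hs), turn_circlePoint _ (hL s' hs'),
      div_lt_div_iff_of_pos_right hd])
    h4 h5
  have h6 := (mem_noncrossingPartitions_iff.1 hπ).1 _ _ h
  rw [(coordinates_circlePoint i (hL s hs)).2, (coordinates_circlePoint j (hL s' hs')).2] at h6
  subst h6
  exact ⟨rfl, h⟩

/-- Only finitely many fibers of a noncrossing partition of the circle are not partitioned into
singletons: each of them contributes to the length of a permutation below the `d`-cycle. -/
theorem finite_nontrivial_fibers [NeZero d] {π : Setoid Circle}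
    (hπ : π ∈ noncrossingPartitions d) :
    {s : I | s < 1 ∧ ∃ i j : Fin d, i ≠ j ∧ fiberSetoid π s i j}.Finite := by
  by_contra hinf
  obtain ⟨F, hF, hcard⟩ :=
    Set.Infinite.exists_subset_card_eq hinf (len (transpositions d) (finRotate d) + 1)
  have hF1 : ∀ s ∈ F.sort (· ≤ ·), s < 1 := fun s hs => (hF ((Finset.mem_sort _).1 hs)).1
  obtain ⟨z, h1, h2, h3⟩ := exists_geodesic_of_crossFree (F.sort (· ≤ ·))
    (Finset.sortedLT_sort _).pairwise hF1 (finRotate d)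
    (AbsLE.refl (mem_closure_transpositions _)) (fiberSetoid π)
    (fun _ _ a b _ => sameCycle_finRotate a b) (crossFree_fiberSetoid hπ hF1)
  have h4 := h3.len_le
  rw [← h2.2, List.map_map] at h4
  have h5 : (F.sort (· ≤ ·)).length ≤
      ((F.sort (· ≤ ·)).map (len (transpositions d) ∘ z)).sum := by
    have := List.card_nsmul_le_sum ((F.sort (· ≤ ·)).map (len (transpositions d) ∘ z)) 1 (by
      intro n hn
      obtain ⟨s, hs, rfl⟩ := List.mem_map.1 hn
      obtain ⟨-, i, j, hij, h⟩ := hF ((Finset.mem_sort _).1 hs)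
      exact len_pos_of_sameCycle hij ((h1 s hs i j).2 h))
    simpa using this
  rw [Finset.length_sort, hcard] at h5
  omega

theorem exists_circlePartition_eq [NeZero d] {π : Setoid Circle}
    (hπ : π ∈ noncrossingPartitions d) : ∃ a, circlePartition d a = π := by
  classical
  let F := (finite_nontrivial_fibers hπ).toFinset
  have hF : ∀ s, s ∈ F ↔ s < 1 ∧ ∃ i j : Fin d, i ≠ j ∧ fiberSetoid π s i j := fun s =>
    (finite_nontrivial_fibers hπ).mem_toFinset
  have hF1 : ∀ s ∈ F.sort (· ≤ ·), s < 1 := fun s hs => ((hF s).1 ((Finset.mem_sort _).1 hs)).1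
  obtain ⟨z, h1, h2, h3⟩ := exists_geodesic_of_crossFree (F.sort (· ≤ ·))
    (Finset.sortedLT_sort _).pairwise hF1 (finRotate d)
    (AbsLE.refl (mem_closure_transpositions _)) (fiberSetoid π)
    (fun _ _ a b _ => sameCycle_finRotate a b) (crossFree_fiberSetoid hπ hF1)
  let u : I → Perm (Fin d) := fun s => if s ∈ F then z s else 1
  have hmap : (F.sort (· ≤ ·)).map u = (F.sort (· ≤ ·)).map z :=
    List.map_congr_left fun s hs => if_pos ((Finset.mem_sort _).1 hs)
  have hu : IsWeightedFact (transpositions d) ((F.sort (· ≤ ·)).map z).prod u := by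
    refine ⟨fun _ => mem_closure_transpositions _, F.sort (· ≤ ·),
      (Finset.sortedLT_sort _).pairwise, fun s hs => if_neg fun h => hs ((Finset.mem_sort _).2 h),
      congrArg List.prod hmap, ?_⟩
    rw [← h2.2, ← hmap, List.map_map]
    rfl
  let v : LinFactPoset (transpositions d) (finRotate d) := ⟨⟨_, h3⟩, ⟨u, hu⟩⟩
  have hu1 : u 1 = 1 := if_neg fun h => ((hF 1).1 h).1.false
  have hnf : (CircFactPoset.mk v).normalForm = u := by
    funext r
    change (if r = 0 then finRotate d * u 1 * (finRotate d)⁻¹ * u 0 else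
      if r = 1 then 1 else u r) = u r
    split_ifs with h4 h5
    · rw [h4, hu1, mul_one, mul_inv_cancel, one_mul]
    · rw [h5, hu1]
    · rfl
  refine ⟨CircFactPoset.mk v, Setoid.ext fun x y => ?_⟩
  have key : ∀ (s : I), s < 1 → ∀ i j : Fin d, SameCycle (u s) i j ↔ fiberSetoid π s i j := by
    intro s hs i j
    by_cases h : s ∈ F
    · simp only [u, if_pos h]
      exact h1 s ((Finset.mem_sort _).2 h) i j
    · simp only [u, if_neg h, sameCycle_one_iff]
      refine ⟨fun hij => hij ▸ (fiberSetoid π s).refl' i, fun hij => ?_⟩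
      by_contra hne
      exact h ((hF s).2 ⟨hs, i, j, hne, hij⟩)
  have hrel : circlePartition d (CircFactPoset.mk v) x y ↔ powerTurn d x = powerTurn d y ∧
      fiberSetoid π (powerTurn d x) (rootIndex d x) (rootIndex d y) := by
    rw [← key _ (powerTurn_lt_one x), ← hnf]
    rfl
  have hfib : ∀ h : powerTurn d x = powerTurn d y,
      fiberSetoid π (powerTurn d x) (rootIndex d x) (rootIndex d y) ↔ π x y := by
    intro h
    change π (circlePoint _ _) (circlePoint _ _) ↔ _
    rw [circlePoint_coordinates, h, circlePoint_coordinates]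
  rw [hrel]
  constructor
  · rintro ⟨h4, h5⟩
    exact (hfib h4).1 h5
  · intro h
    have h4 := (mem_noncrossingPartitions_iff.1 hπ).1 x y h
    exact ⟨h4, (hfib h4).2 h⟩

/-- The isomorphism from the circular factorizations of the `d`-cycle to the noncrossing partitions
of the circle. -/
noncomputable def circlePartitionIso (d : ℕ) [NeZero d] : SymCircFactPoset d ≃o NCCircle d where
  toEquiv := Equiv.ofBijective (fun a => ⟨circlePartition d a, circlePartition_mem a⟩) (by
    constructor
    · intro a b h
      have h1 : circlePartition d a = circlePartition d b := congrArg Subtype.val h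
      have h2 := (CircFactPoset.le_iff_normalForm transpositions_conj).1
        (circlePartition_le_iff.1 h1.le)
      have h3 := (CircFactPoset.le_iff_normalForm transpositions_conj).1
        (circlePartition_le_iff.1 h1.ge)
      exact CircFactPoset.normalForm_injective transpositions_conj
        (funext fun r => (h2 r).antisymm (h3 r))
    · rintro ⟨π, hπ⟩
      obtain ⟨a, rfl⟩ := exists_circlePartition_eq hπ
      exact ⟨a, rfl⟩)
  map_rel_iff' := circlePartition_le_iff

theorem circlePartitionIso_apply [NeZero d] (a : SymCircFactPoset d) :
    (circlePartitionIso d a : Setoid Circle) = circlePartition d a := rfl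

/-- The isomorphism is a homeomorphism for the topology that is imported along it. -/
noncomputable def circlePartitionHomeo (d : ℕ) [NeZero d] : SymCircFactPoset d ≃ₜ NCCircle d :=
  (circlePartitionIso d).toEquiv.toHomeomorph fun U => by
    refine Iff.trans ?_ isOpen_coinduced.symm
    constructor
    · exact fun h => h.preimage continuous_subtype_val
    · intro h
      exact h.preimage (continuous_id.subtype_mk fun a => circlePartition_mem a)

theorem isMax_circlePartitionIso_iff [NeZero d] (a : SymCircFactPoset d) :
    IsMax a ↔ IsMax (circlePartitionIso d a) := by
  constructor
  · intro h b hb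
    obtain ⟨b, rfl⟩ := (circlePartitionIso d).surjective b
    exact (circlePartitionIso d).le_iff_le.2 (h ((circlePartitionIso d).le_iff_le.1 hb))
  · intro h b hb
    exact (circlePartitionIso d).le_iff_le.1 (h ((circlePartitionIso d).le_iff_le.2 hb))

end MarkedGroup

/-! ### Coxeter elements -/

theorem CoxeterSystem.reflections_conj {B W : Type*} [Group W] {M : CoxeterMatrix B}
    (cs : CoxeterSystem M W) (a x : W) (hx : x ∈ cs.reflections) :
    a * x * a⁻¹ ∈ cs.reflections :=
  CoxeterSystem.IsReflection.conj hx a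

theorem CoxeterSystem.wordProd_mem_closure_reflections {B W : Type*} [Group W]
    {M : CoxeterMatrix B} (cs : CoxeterSystem M W) (l : List B) :
    cs.wordProd l ∈ Submonoid.closure cs.reflections := by
  refine Submonoid.list_prod_mem _ fun x hx => ?_
  obtain ⟨b, -, rfl⟩ := List.mem_map.1 hx
  exact Submonoid.subset_closure (cs.isReflection_simple b)

theorem corollaryC {B W : Type*} [Group W] {M : CoxeterMatrix B} (cs : CoxeterSystem M W)
    (c : W) (hc : cs.IsCoxeterElement c) (d : ℕ) [NeZero d] :
    (Nonempty ({a : MarkedGroup.CircFactPoset cs.reflections c // IsMax a} ≃ₜ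
        MarkedGroup.IntervalComplex cs.reflections c) ∧
      HasFundamentalGroup (MarkedGroup.IntervalComplex cs.reflections c)
        (cs.DualArtinGroup c)) ∧
    (Nonempty ({a : SymCircFactPoset d // IsMax a} ≃ₜ DualBraidComplex d) ∧
      (∃ Φ : SymCircFactPoset d ≃o NCCircle d,
        (∀ a, (Φ a : Setoid Circle) = circlePartition d a) ∧ IsHomeomorph Φ) ∧
      Nonempty ({π : NCCircle d // IsMax π} ≃ₜ DualBraidComplex d) ∧
      HasFundamentalGroup (DualBraidComplex d) (BraidGroup d)) := by
  have hcmem : c ∈ Submonoid.closure cs.reflections := by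
    obtain ⟨l, -, -, rfl⟩ := hc
    exact cs.wordProd_mem_closure_reflections l
  have hδ := mem_closure_transpositions (finRotate d)
  obtain ⟨e⟩ := MarkedGroup.nonempty_max_homeomorph hδ
  refine ⟨⟨MarkedGroup.nonempty_max_homeomorph hcmem,
    MarkedGroup.hasFundamentalGroup_intervalComplex cs.reflections_conj hcmem⟩, ⟨e⟩,
    ⟨MarkedGroup.circlePartitionIso d, MarkedGroup.circlePartitionIso_apply,
      (MarkedGroup.circlePartitionHomeo d).isHomeomorph⟩,
    ⟨((MarkedGroup.circlePartitionHomeo d).subtype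
      MarkedGroup.isMax_circlePartitionIso_iff).symm.trans e⟩, ?_⟩
  obtain ⟨h1, h2⟩ := MarkedGroup.hasFundamentalGroup_intervalComplex
    (X := transpositions d) (g := finRotate d) MarkedGroup.transpositions_conj hδ
  exact ⟨h1, fun y => (h2 y).map fun f => f.trans (MarkedGroup.intervalGroupEquivBraid d)⟩
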